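/- **Setting.** Let $Z^*\in\mathbb R^{n\times r}$, $r\ge 1$, with $X^*=Z^*(Z^*)^\top$ of rank $r$, and put $\sigma_{\min}=\sigma_r(X^*)/n$ and $\kappa=\sigma_1(X^*)/\sigma_r(X^*)$. Write $\|\cdot\|_F$, $\|\cdot\|$, $\|\cdot\|_{2\to\infty}$ for the Frobenius, operator and maximal-row-$\ell_2$ norms, and $\|M\|_{\infty\to1}=\max_i\sum_j|M_{ij}|$. For $Z\in\mathbb R^{n\times r}$ let $R^*\in\arg\min_{R\in\mathcal O^r}\|ZR-Z^*\|_F$ ($\mathcal O^r$ the orthogonal group), $\mathrm{dist}_2(Z,Z^*)=\|ZR^*-Z^*\|_F$, $\mathrm{dist}_\infty(Z,Z^*)=\|ZR^*-Z^*\|_{2\to\infty}$ (the smallest value, if several $R^*$ are optimal), and, for $\epsilon>0$, $$\mathcal D^{(2)}(\epsilon)=\Big\{Z:\tfrac{\mathrm{dist}_2(Z,Z^*)}{\|Z^*\|_F}\le\epsilon\Big\},\qquad \mathcal D^{(\infty)}(\epsilon)=\Big\{Z\in\mathcal D^{(2)}(\epsilon):\tfrac{\mathrm{dist}_\infty(Z,Z^*)}{\|Z^*\|_{2\to\infty}}\le\epsilon\Big\}.$$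 Let $\mathcal L(\cdot;\omega):\mathbb R^{n\times n}\to\mathbb R$ be a random loss on a probability space, almost surely twice continuously differentiable. Put $\mathcal G(Z)=\nabla_X\mathcal L(ZZ^\top;\omega)$, $\bar{\mathcal G}(Z)=\mathbb E\,\mathcal G(Z)$, which is assumed to exist for $Z$ in the local region $\mathcal D$, and $\tilde{\mathcal G}=\mathcal G-\bar{\mathcal G}$; assume $\bar{\mathcal G}(Z^*)=0$. Consider gradient descent $Z^{t+1}=Z^t-n^{-1}\eta\,\nabla_Z\mathcal L(Z^t(Z^t)^\top)$ with $\eta=\{10(\alpha+\beta)\kappa\sigma_{\min}\}^{-1}$, and put $\rho=1-\eta\alpha\sigma_{\min}/4$. Let $\mathcal P_Z(W)=ZW^\top+WZ^\top$. For a region $\mathcal D$ and $\beta\ge\alpha>0$ consider the conditions 1. almost surely, $\alpha\|\mathcal P_Z(W)\|_F^2\le\nabla_X^2\mathcal L(ZZ^\top)[\mathcal P_Z(W),\mathcal P_Z(W)]\le\beta\|\mathcal P_Z(W)\|_F^2$ for all $Z\in\mathcal D$, $W\in\mathbb R^{n\times r}$; 2. $\|\bar{\mathcal G}(Z_1)-\bar{\mathcal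 G}(Z_2)\|\le L_2\|Z_1Z_1^\top-Z_2Z_2^\top\|_F$ for all $Z_1,Z_2\in\mathcal D$; 3. almost surely, $|\nabla_X^2\mathcal L(ZZ^\top)[\mathcal P_Z(e_ih^\top),\mathcal P_Z(W)]|\le\beta\,\|Z_{i,\cdot}\|\,\|h\|\,\|Z\|\,\|W\|_F$ for all $Z\in\mathcal D$, $i\in[n]$, $h\in\mathbb R^r$ and $W$ with $W_{i,\cdot}=0$; 4. $\|\bar{\mathcal G}(Z_1)-\bar{\mathcal G}(Z_2)\|_{2\to\infty}\le L_\infty\|Z_1Z_1^\top-Z_2Z_2^\top\|_{2\to\infty}$ for all $Z_1,Z_2\in\mathcal D$. **Theorem.** There is a universal constant $C>0$ such that the following hold, where $\delta\in(0,1)$. *($\ell_2$ part.)* For every $L_2$ there is $c_0>0$, depending only on $L_2$, such that the following holds with $\mathcal D=\mathcal D^{(2)}(\epsilon)$. Suppose $\epsilon\le c_0\alpha/(\kappa\sqrt r)$; conditions 1 and 2 hold; with probability at least $1-\delta$, $n^{-1}\|\tilde{\mathcal G}(Z)\|\le\Delta_2$ for all $Z\in\mathcal D$; $\Delta_2/(\alpha\sigma_{\min})\le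 c_0\epsilon$; and almost surely $\mathrm{dist}_2(Z^0,Z^*)\le\phi_n\|Z^*\|_F$ with $\phi_n\le\frac\epsilon2\wedge c_0\frac{\alpha}{\kappa\sqrt r}$. Then with probability at least $1-\delta$, for all $t\ge0$, $$\mathrm{dist}_2(Z^t,Z^*)\le\Big\{\rho^t\phi_n+C\tfrac{\Delta_2}{\alpha\sigma_{\min}}\Big\}\|Z^*\|_F ,$$ and, on the same event, minimizers $\hat Z$ of $Z\mapsto\mathcal L(ZZ^\top)$ over $\mathcal D$ exist, the aligned minimizer $\hat Z\hat R$ (with $\hat R\in\arg\min_{R\in\mathcal O^r}\|\hat ZR-Z^*\|_F$) is the same for all choices of $\hat Z$ and $\hat R$, $\nabla_Z\mathcal L(ZZ^\top)=0$ at $Z=\hat Z$ and at $Z=\hat Z\hat R$, and $\|\hat Z\hat R-Z^*\|_F\le C\frac{\Delta_2}{\alpha\sigma_{\min}}\|Z^*\|_F$. *($\ell_\infty$ part.)* For all $L_2,L_\infty$ there is $c_0>0$, depending only on them, such that the following holds with $\mathcal D=\mathcal D^{(\infty)}(\epsilon)$. Suppose $\epsilon\le c_0\alpha/(\kappa\sqrt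 r)$; almost surely $\mathcal G(Z)$ is a symmetric matrix for all $Z\in\mathcal D$ (so that $\nabla_Z\mathcal L(ZZ^\top)=2\mathcal G(Z)Z$); conditions 1–4 hold; with probability at least $1-\delta$, $$\sup_{Z\in\mathcal D}\tfrac{\|\tilde{\mathcal G}(Z)\|}{n}\le\Delta_2,\qquad \tfrac{\|\tilde{\mathcal G}(Z^*)Z^*\|_{2\to\infty}}{\sqrt n\,\|Z^*\|}\le\Delta_\infty,\qquad \sup_{Z\in\mathcal D}\tfrac{\|\tilde{\mathcal G}(Z)\|_{\infty\to1}}{n}\le\bar\Delta_\infty;$$ $$\big(\tfrac\beta\alpha+\sqrt r\big)\kappa\sqrt r\,\tfrac{\Delta_\infty}{\alpha\sigma_{\min}}\le c_0\epsilon,\qquad \big(\tfrac\beta\alpha\kappa\sqrt{\kappa r}+r\kappa\big)\Delta_2\le c_0\Delta_\infty,\qquad \tfrac{\bar\Delta_\infty}{\alpha\sigma_{\min}}\le\tfrac14;$$ and almost surely $\mathrm{dist}_2(Z^0,Z^*)\le\phi_n\|Z^*\|_F$ and $\mathrm{dist}_\infty(Z^0,Z^*)\le\psi_n\|Z^*\|_{2\to\infty}$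 with $\phi_n\le\frac\epsilon2\wedge c_0\frac\alpha{\kappa\sqrt r}$, $\psi_n\le\frac\epsilon2$ and $\frac\beta\alpha\kappa^{3/2}\sqrt r\,\phi_n\le c_0\psi_n$. Then with probability at least $1-\delta$ all the conclusions of the $\ell_2$ part hold (with $\mathcal D=\mathcal D^{(\infty)}(\epsilon)$) and, in addition, for all $t\ge0$, $$\mathrm{dist}_\infty(Z^t,Z^*)\le\Big\{\rho^t\psi_n+C\tfrac{\Delta_\infty}{\alpha\sigma_{\min}}\Big\}\|Z^*\|_{2\to\infty},\qquad \|\hat Z\hat R-Z^*\|_{2\to\infty}\le C\tfrac{\Delta_\infty}{\alpha\sigma_{\min}}\|Z^*\|_{2\to\infty}.$$ -/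

import Mathlib

open MeasureTheory
open scoped Matrix.Norms.Frobenius

noncomputable section

namespace LowRankGD

/-- Real matrices. Throughout, `‖M‖` is the Frobenius norm of `M`. -/
abbrev Mat (m k : ℕ) : Type := Matrix (Fin m) (Fin k) ℝ

/-- The operator (spectral) norm. -/
def opNorm {m k : ℕ} (M : Mat m k) : ℝ :=
  ‖LinearMap.toContinuousLinearMap (Matrix.toEuclideanLin M)‖

/-- The two-to-infinity norm: the largest Euclidean norm of a row. -/
def rowNorm {m k : ℕ} (M : Mat m k) : ℝ :=
  ⨆ i : Fin m, Real.sqrt (∑ j : Fin k, (M i j) ^ 2)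

/-- The largest `ℓ₁` norm of a row. -/
def maxRowSum {m k : ℕ} (M : Mat m k) : ℝ :=
  ⨆ i : Fin m, ∑ j : Fin k, |M i j|

/-- The `k`-th largest singular value, `k = 1, 2, …` (Mathlib's sequence starts at index `0`). -/
def sigma {m q : ℕ} (k : ℕ) (M : Mat m q) : ℝ :=
  (Matrix.toEuclideanLin M).singularValues (k - 1)

/-- `σ_min = σ_r(X*) / n`, for `X* = Z* Z*ᵀ`. -/
def sigmaMin {n r : ℕ} (Zs : Mat n r) : ℝ := sigma r (Zs * Zs.transpose) / n

/-- `κ = σ_1(X*) / σ_r(X*)`, for `X* = Z* Z*ᵀ`. -/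
def kappa {n r : ℕ} (Zs : Mat n r) : ℝ :=
  sigma 1 (Zs * Zs.transpose) / sigma r (Zs * Zs.transpose)

/-- `R` is an optimal orthogonal alignment of `Z` with `Z*`:
it minimizes `‖Z R - Z*‖_F` over the orthogonal group. -/
def IsAlignment {n r : ℕ} (Z Zs : Mat n r) (R : Mat r r) : Prop :=
  R ∈ Matrix.orthogonalGroup (Fin r) ℝ ∧
    ∀ Q ∈ Matrix.orthogonalGroup (Fin r) ℝ, ‖Z * R - Zs‖ ≤ ‖Z * Q - Zs‖

/-- `dist₂(Z, Z*)`, the Frobenius error after optimal alignment. -/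
def dist2 {n r : ℕ} (Z Zs : Mat n r) : ℝ :=
  ⨅ R : Matrix.orthogonalGroup (Fin r) ℝ, ‖Z * (R : Mat r r) - Zs‖

/-- Optimal alignments exist. -/
theorem exists_isAlignment {n r : ℕ} (Z Zs : Mat n r) : ∃ R, IsAlignment Z Zs R := by
  have hc : IsCompact ((Matrix.orthogonalGroup (Fin r) ℝ : Set (Mat r r))) := by
    apply Metric.isCompact_of_isClosed_isBounded
    · have : (Matrix.orthogonalGroup (Fin r) ℝ : Set (Mat r r)) = {A | A * star A = 1} := by
        ext A; exact Matrix.mem_orthogonalGroup_iff _ _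
      rw [this]
      exact isClosed_eq (by fun_prop) continuous_const
    · refine (Metric.isBounded_iff_subset_closedBall 0).2 ⟨Real.sqrt r, fun A hA => ?_⟩
      have h : A * Matrix.transpose A = 1 := (Matrix.mem_orthogonalGroup_iff _ _).1 hA
      have h2 : ‖A‖ ^ 2 = r := by
        rw [Matrix.frobenius_norm_def, ← Real.rpow_natCast, ← Real.rpow_mul (by positivity)]
        have : ∀ i, (A * Matrix.transpose A) i i = 1 := fun i => by rw [h]; simp
        simp only [Matrix.mul_apply, Matrix.transpose_apply] at this
        simp [← pow_two] at this ⊢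
        simp [this]
      simp only [Metric.mem_closedBall, dist_zero_right]
      rw [← h2, Real.sqrt_sq (norm_nonneg _)]
  obtain ⟨R, hR, h⟩ := hc.exists_isMinOn ⟨1, one_mem _⟩
    (f := fun R => ‖Z * R - Zs‖) (by fun_prop)
  exact ⟨R, hR, fun Q hQ => h hQ⟩

/-- `dist₂` is the Frobenius error at any optimal alignment. -/
theorem IsAlignment.dist2_eq {n r : ℕ} {Z Zs : Mat n r} {R : Mat r r} (h : IsAlignment Z Zs R) :
    dist2 Z Zs = ‖Z * R - Zs‖ := by
  apply le_antisymm
  · exact ciInf_le ⟨0, by rintro _ ⟨Q, rfl⟩; exact norm_nonneg _⟩ (⟨R, h.1⟩ : Matrix.orthogonalGroup (Fin r) ℝ)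
  · exact le_ciInf fun Q => h.2 Q.1 Q.2
/-- `dist_∞(Z, Z*)`, the row-wise error after the alignment that is optimal in Frobenius norm
(the smallest such value if there is more than one optimal alignment). -/
def distInf {n r : ℕ} (Z Zs : Mat n r) : ℝ :=
  ⨅ R : {R : Mat r r // IsAlignment Z Zs R}, rowNorm (Z * R.1 - Zs)

/-- The local region in `dist₂`. -/
def region2 {n r : ℕ} (Zs : Mat n r) (ε : ℝ) : Set (Mat n r) :=
  {Z | dist2 Z Zs / ‖Zs‖ ≤ ε}

/-- The local region in `dist₂` and `dist_∞`. -/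
def regionInf {n r : ℕ} (Zs : Mat n r) (ε : ℝ) : Set (Mat n r) :=
  {Z | dist2 Z Zs / ‖Zs‖ ≤ ε ∧ distInf Z Zs / rowNorm Zs ≤ ε}

/-- The gradient of a function of a matrix, as the matrix of its partial derivatives. -/
def matGrad {m k : ℕ} (f : Mat m k → ℝ) (M : Mat m k) : Mat m k :=
  Matrix.of fun i j => fderiv ℝ f M (Matrix.single i j 1)

/-- The Hessian bilinear form of a function of a matrix. -/
def matHess {m k : ℕ} (f : Mat m k → ℝ) (X H₁ H₂ : Mat m k) : ℝ :=
  fderiv ℝ (fderiv ℝ f) X H₁ H₂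

/-- `𝒢(Z)`, the gradient of the loss in `X`, at `X = Z Zᵀ`. -/
def score {n r : ℕ} (ℓ : Mat n n → ℝ) (Z : Mat n r) : Mat n n :=
  matGrad ℓ (Z * Z.transpose)

/-- The factorized objective `Z ↦ ℓ(Z Zᵀ)`. -/
def factored {n : ℕ} (r : ℕ) (ℓ : Mat n n → ℝ) : Mat n r → ℝ :=
  fun Z => ℓ (Z * Z.transpose)

/-- Gradient descent on the factorized objective:
`Z^{t+1} = Z^t - n⁻¹ η ∇_Z ℓ(Z^t (Z^t)ᵀ)`. -/
def iterate {n r : ℕ} (ℓ : Mat n n → ℝ) (η : ℝ) (Z₀ : Mat n r) : ℕ → Mat n r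
  | 0 => Z₀
  | t + 1 => iterate ℓ η Z₀ t - ((n : ℝ)⁻¹ * η) • matGrad (factored r ℓ) (iterate ℓ η Z₀ t)

/-- The step size `η = {10 (α + β) κ σ_min}⁻¹`. -/
def stepSize {n r : ℕ} (α β : ℝ) (Zs : Mat n r) : ℝ :=
  (10 * (α + β) * kappa Zs * sigmaMin Zs)⁻¹

/-- The contraction factor `ρ = 1 - η α σ_min / 4`. -/
def rate {n r : ℕ} (α β : ℝ) (Zs : Mat n r) : ℝ :=
  1 - stepSize α β Zs * α * sigmaMin Zs / 4

/-- `𝒫_Z(W) = Z Wᵀ + W Zᵀ`. -/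
def tangent {n r : ℕ} (Z W : Mat n r) : Mat n n :=
  Z * W.transpose + W * Z.transpose

/-- Restricted strong convexity and smoothness of a loss on the region `D`. -/
def LocalRIP {n r : ℕ} (ℓ : Mat n n → ℝ) (D : Set (Mat n r)) (α β : ℝ) : Prop :=
  ∀ Z ∈ D, ∀ W : Mat n r,
    α * ‖tangent Z W‖ ^ 2 ≤ matHess ℓ (Z * Z.transpose) (tangent Z W) (tangent Z W) ∧
    matHess ℓ (Z * Z.transpose) (tangent Z W) (tangent Z W) ≤ β * ‖tangent Z W‖ ^ 2

/-- Row-wise control of the Hessian on the region `D`: for `W_i = e_i hᵀ` and `W` with vanishing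
`i`-th row, `|∇²ℓ(Z Zᵀ)[𝒫_Z(W_i), 𝒫_Z(W)]| ≤ β (‖Z_i‖ ‖h‖) (‖Z‖_op ‖W‖_F)`. -/
def RowCrossCurvature {n r : ℕ} (ℓ : Mat n n → ℝ) (D : Set (Mat n r)) (β : ℝ) : Prop :=
  ∀ Z ∈ D, ∀ (i : Fin n) (h : Fin r → ℝ) (W : Mat n r), (∀ j, W i j = 0) →
    |matHess ℓ (Z * Z.transpose)
        (tangent Z (Matrix.vecMulVec (Pi.single i 1) h)) (tangent Z W)| ≤
      β * (Real.sqrt (∑ j, (Z i j) ^ 2) * Real.sqrt (∑ j, (h j) ^ 2)) * (opNorm Z * ‖W‖)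

/-- Lipschitz condition, in operator norm, on a gradient map `G`. -/
def GradLip {n r : ℕ} (G : Mat n r → Mat n n) (D : Set (Mat n r)) (L₂ : ℝ) : Prop :=
  ∀ Z₁ ∈ D, ∀ Z₂ ∈ D,
    opNorm (G Z₁ - G Z₂) ≤ L₂ * ‖Z₁ * Z₁.transpose - Z₂ * Z₂.transpose‖

/-- Lipschitz condition, in two-to-infinity norm, on a gradient map `G`. -/
def RowGradLip {n r : ℕ} (G : Mat n r → Mat n n) (D : Set (Mat n r)) (Linf : ℝ) : Prop :=
  ∀ Z₁ ∈ D, ∀ Z₂ ∈ D,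
    rowNorm (G Z₁ - G Z₂) ≤ Linf * rowNorm (Z₁ * Z₁.transpose - Z₂ * Z₂.transpose)

section Stochastic

variable {Ω : Type*} [MeasurableSpace Ω]

/-- The mean gradient `E 𝒢(Z; ω)`. -/
def meanScore {n r : ℕ} (μ : Measure Ω) (L : Ω → Mat n n → ℝ) (Z : Mat n r) : Mat n n :=
  Matrix.of fun i j => ∫ ω, score (L ω) Z i j ∂μ

/-- The gradient noise `𝒢(Z; ω) - E 𝒢(Z; ω)`. -/
def noise {n r : ℕ} (μ : Measure Ω) (L : Ω → Mat n n → ℝ) (ω : Ω) (Z : Mat n r) : Mat n n :=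
  score (L ω) Z - meanScore μ L Z

/-- `P` holds with probability at least `p`. -/
def WithProbAtLeast (μ : Measure Ω) (p : ℝ) (P : Ω → Prop) : Prop :=
  ∃ E : Set Ω, MeasurableSet E ∧ ENNReal.ofReal p ≤ μ E ∧ ∀ ω ∈ E, P ω

/-- The stochastic loss is twice continuously differentiable, its gradient has a mean at every
point of the local region, and the mean gradient vanishes at the true parameter. -/
structure StochasticLoss {n r : ℕ} (μ : Measure Ω) (L : Ω → Mat n n → ℝ) (Zs : Mat n r)
    (D : Set (Mat n r)) : Prop where
  smooth : ∀ᵐ ω ∂μ, ContDiff ℝ 2 (L ω)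
  integrable : ∀ Z ∈ D, ∀ i j, Integrable (fun ω => score (L ω) Z i j) μ
  mean_zero : meanScore μ L Zs = 0

end Stochastic

/-- `Ẑ` is a local empirical minimizer: a minimizer of `Z ↦ ℓ(Z Zᵀ)` over the region `D`. -/
def IsLocalMinimizer {n r : ℕ} (ℓ : Mat n n → ℝ) (D : Set (Mat n r)) (Zh : Mat n r) : Prop :=
  Zh ∈ D ∧ ∀ Z ∈ D, factored r ℓ Zh ≤ factored r ℓ Z

/-- `Zt` is the aligned local empirical minimizer: minimizers over `D` exist, and every minimizer
`Ẑ`, after any optimal alignment `R̂` with `Z*`, satisfies `Ẑ R̂ = Zt`. -/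
def IsAlignedMinimizer {n r : ℕ} (ℓ : Mat n n → ℝ) (D : Set (Mat n r)) (Zs Zt : Mat n r) : Prop :=
  (∃ Zh, IsLocalMinimizer ℓ D Zh) ∧
    ∀ Zh, IsLocalMinimizer ℓ D Zh → ∀ R, IsAlignment Zh Zs R → Zh * R = Zt

/-- Stationarity of every local empirical minimizer `Ẑ` and of its aligned version `Zt`. -/
def StationaryMinimizers {n r : ℕ} (ℓ : Mat n n → ℝ) (D : Set (Mat n r)) (Zt : Mat n r) : Prop :=
  matGrad (factored r ℓ) Zt = 0 ∧
    ∀ Zh, IsLocalMinimizer ℓ D Zh → matGrad (factored r ℓ) Zh = 0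

end LowRankGD

end

/-! ### Frobenius inner product. -/

namespace LowRankGD

variable {m k l n r : ℕ}

/-! The objective Z ↦ ℓ(Z Zᵀ) is invariant under right multiplication by orthogonal matrices. The
proof removes this symmetry by working on the slice of points already aligned with Z*. Being aligned
by the identity means ⟨Z Q, Z*⟩ ≤ ⟨Z, Z*⟩ for all orthogonal Q, a family of linear inequalities in
Z, so the slice is convex (`convex_slice2`). It also makes Zᵀ Z* symmetric (`IsAlignment.isSymm`);
hence a difference D of slice points has Z*ᵀ D symmetric, and then ‖𝒫_Z(D)‖² ≥ 1.9 σ_r(X*) ‖D‖² near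
Z* (`Conditioned.norm_tangent_sq_ge`). On the slice the objective thus behaves like a strongly
convex one.

Frobenius norm: let V be the difference of the gradient steps from two slice points. The mean value
theorem, tested against V, bounds ‖V‖² by a Cauchy-Schwarz inequality for the identity minus τ times
the curvature form, plus a term in the score 𝒢. That term is small because the mean of 𝒢 is
Lipschitz and vanishes at Z*, and the noise is small. So the gradient step contracts distances on
the slice (`SliceRegular.norm_gradStep_sub_le`). The gradient is equivariant, so each iterate may be
realigned before the next step, and realignment never increases the Frobenius error; linear
convergence up to the noise level follows.

Rows: the same identity is tested against a single row of V. The same row of D has curvature without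
any alignment; the other rows enter through `RowCrossCurvature` and cost a multiple of the Frobenius
error; the noise is absorbed by its row sums (`RowRegular.norm_rowPart_gradStep_sub_le`).
Realignment may increase row errors, but its rotation is bounded by score times error
(`SliceRegular.norm_alignment_sub_one_le`). The row recursion is therefore driven by (β/α) κ √r
times the Frobenius error, which the assumptions on Δ₂ and φ keep below Δ_∞ and ψ.

Minimizers exist by compactness of the slice. The first-order inequality along the segment to Z*
puts them well inside the Frobenius ball, so gradient steps from them stay in the region; hence they
are stationary, and the contraction makes the aligned one unique
(`IsSlice.exists_isAlignedMinimizer`).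

The constant c₀ may depend only on the Lipschitz constants, while the radius is measured against α.
This is reconciled by α ≤ 2 L₂ (`alpha_le_two_mul`), obtained by comparing convexity and Lipschitz
bounds along a rank-one path. -/

/-- The Frobenius inner product. -/
noncomputable def ip (A B : Mat m k) : ℝ := (A.transpose * B).trace

theorem ip_eq_sum (A B : Mat m k) : ip A B = ∑ i, ∑ j, A i j * B i j := by
  rw [ip, Matrix.trace, Finset.sum_comm]
  simp [Matrix.mul_apply]

theorem ip_comm (A B : Mat m k) : ip A B = ip B A := by
  simp only [ip_eq_sum, mul_comm]

theorem ip_add_right (A B C : Mat m k) : ip A (B + C) = ip A B + ip A C := by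
  simp [ip, Matrix.mul_add]

theorem ip_sub_right (A B C : Mat m k) : ip A (B - C) = ip A B - ip A C := by
  simp [ip, Matrix.mul_sub]

theorem ip_smul_right (c : ℝ) (A B : Mat m k) : ip A (c • B) = c * ip A B := by
  simp [ip]

theorem ip_add_left (A B C : Mat m k) : ip (A + B) C = ip A C + ip B C := by
  simp [ip, Matrix.add_mul]

theorem ip_sub_left (A B C : Mat m k) : ip (A - B) C = ip A C - ip B C := by
  simp [ip, Matrix.sub_mul]

theorem ip_smul_left (c : ℝ) (A B : Mat m k) : ip (c • A) B = c * ip A B := by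
  simp [ip]

theorem ip_transpose (A B : Mat m k) : ip A.transpose B.transpose = ip A B := by
  rw [ip_eq_sum, ip_eq_sum, Finset.sum_comm]; rfl

theorem ip_mul_right (A : Mat m k) (B : Mat m l) (C : Mat l k) :
    ip A (B * C) = ip (B.transpose * A) C := by
  simp [ip, Matrix.mul_assoc]

theorem ip_mul_right' (A : Mat m k) (B : Mat m l) (C : Mat l k) :
    ip A (B * C) = ip (A * C.transpose) B := by
  rw [← ip_transpose, Matrix.transpose_mul, ip_mul_right, ← ip_transpose]
  simp

theorem ip_single (A : Mat m k) (i : Fin m) (j : Fin k) : ip A (Matrix.single i j 1) = A i j := by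
  rw [ip_eq_sum, Finset.sum_eq_single i, Finset.sum_eq_single j] <;>
    simp +contextual [Matrix.single_apply, eq_comm]

theorem ip_ext {A B : Mat m k} (h : ∀ C, ip A C = ip B C) : A = B := by
  ext i j
  rw [← ip_single A, ← ip_single B, h]

theorem norm_sq_eq_sum (A : Mat m k) : ‖A‖ ^ 2 = ∑ i, ∑ j, A i j ^ 2 := by
  rw [Matrix.frobenius_norm_def, ← Real.rpow_natCast, ← Real.rpow_mul (by positivity)]
  simp

theorem ip_self (A : Mat m k) : ip A A = ‖A‖ ^ 2 := by
  rw [norm_sq_eq_sum, ip_eq_sum]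
  simp only [sq]

theorem abs_ip_le (A B : Mat m k) : |ip A B| ≤ ‖A‖ * ‖B‖ := by
  apply abs_le_of_sq_le_sq _ (by positivity)
  rw [mul_pow, norm_sq_eq_sum, norm_sq_eq_sum, ip_eq_sum, ← Fintype.sum_prod_type',
    ← Fintype.sum_prod_type', ← Fintype.sum_prod_type']
  exact Finset.sum_mul_sq_le_sq_mul_sq _ _ _

theorem ip_le (A B : Mat m k) : ip A B ≤ ‖A‖ * ‖B‖ := (le_abs_self _).trans (abs_ip_le A B)

theorem norm_sub_sq (A B : Mat m k) : ‖A - B‖ ^ 2 = ‖A‖ ^ 2 - 2 * ip A B + ‖B‖ ^ 2 := by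
  rw [← ip_self, ← ip_self, ← ip_self, ip_sub_left, ip_sub_right, ip_sub_right, ip_comm B A]
  ring

theorem norm_add_sq (A B : Mat m k) : ‖A + B‖ ^ 2 = ‖A‖ ^ 2 + 2 * ip A B + ‖B‖ ^ 2 := by
  rw [← ip_self, ← ip_self, ← ip_self, ip_add_left, ip_add_right, ip_add_right, ip_comm B A]
  ring

theorem norm_transpose (A : Mat m k) : ‖A.transpose‖ = ‖A‖ := Matrix.frobenius_norm_transpose A

theorem norm_mul_orthogonal (A : Mat m k) {Q : Mat k k}
    (hQ : Q ∈ Matrix.orthogonalGroup (Fin k) ℝ) : ‖A * Q‖ = ‖A‖ := by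
  have h : Q * Q.transpose = 1 := (Matrix.mem_orthogonalGroup_iff _ _).1 hQ
  rw [← sq_eq_sq₀ (norm_nonneg _) (norm_nonneg _), ← ip_self, ← ip_self, ip_mul_right',
    Matrix.mul_assoc, h, Matrix.mul_one]

/-! ### The operator norm -/

theorem opNorm_nonneg (A : Mat m k) : 0 ≤ opNorm A := norm_nonneg _

theorem norm_toEuclideanLin_le (A : Mat m k) (v : EuclideanSpace ℝ (Fin k)) :
    ‖Matrix.toEuclideanLin A v‖ ≤ opNorm A * ‖v‖ :=
  (LinearMap.toContinuousLinearMap (Matrix.toEuclideanLin A)).le_opNorm v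

theorem opNorm_add_le (A B : Mat m k) : opNorm (A + B) ≤ opNorm A + opNorm B := by
  simp only [opNorm, map_add]
  exact norm_add_le _ _

theorem opNorm_transpose (A : Mat m k) : opNorm A.transpose = opNorm A := by
  have := Matrix.l2_opNorm_conjTranspose (𝕜 := ℝ) A
  rw [Matrix.conjTranspose_eq_transpose_of_trivial] at this
  exact this

theorem norm_toEuclideanLin_sq (A : Mat m k) (B : Mat k l) (j : Fin l) :
    ‖Matrix.toEuclideanLin A (WithLp.toLp 2 fun i => B i j)‖ ^ 2 = ∑ i, (A * B) i j ^ 2 := by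
  rw [EuclideanSpace.norm_sq_eq]
  simp [Matrix.mul_apply, Matrix.toLpLin_toLp, Matrix.mulVec, dotProduct]

theorem norm_mul_le_opNorm (A : Mat m k) (B : Mat k l) : ‖A * B‖ ≤ opNorm A * ‖B‖ := by
  apply le_of_sq_le_sq _ (by have := opNorm_nonneg A; positivity)
  rw [mul_pow, norm_sq_eq_sum, norm_sq_eq_sum, Finset.sum_comm, Finset.sum_comm (s := Finset.univ (α := Fin k)), Finset.mul_sum]
  refine Finset.sum_le_sum fun j _ => ?_
  rw [← norm_toEuclideanLin_sq]
  have h := norm_toEuclideanLin_le A (WithLp.toLp 2 fun i => B i j)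
  have h2 : ‖WithLp.toLp 2 fun i => B i j‖ ^ 2 = ∑ i, B i j ^ 2 := by
    rw [EuclideanSpace.norm_sq_eq]; simp
  rw [← h2, ← mul_pow]
  exact pow_le_pow_left₀ (norm_nonneg _) h 2

theorem norm_mul_le_opNorm' (A : Mat m k) (B : Mat k l) : ‖A * B‖ ≤ ‖A‖ * opNorm B := by
  rw [← norm_transpose, Matrix.transpose_mul, ← norm_transpose A, ← opNorm_transpose B, mul_comm]
  exact norm_mul_le_opNorm _ _

theorem opNorm_le_of_forall (A : Mat m k) {c : ℝ} (hc : 0 ≤ c)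
    (h : ∀ v, ‖Matrix.toEuclideanLin A v‖ ≤ c * ‖v‖) : opNorm A ≤ c :=
  ContinuousLinearMap.opNorm_le_bound _ hc h

theorem opNorm_le_norm (A : Mat m k) : opNorm A ≤ ‖A‖ := by
  refine opNorm_le_of_forall A (norm_nonneg _) fun v => ?_
  have h := Matrix.frobenius_norm_mul A (Matrix.of fun i (_ : Fin 1) => v i)
  have h1 : ‖A * (Matrix.of fun i (_ : Fin 1) => v i)‖ = ‖Matrix.toEuclideanLin A v‖ := by
    rw [← sq_eq_sq₀ (norm_nonneg _) (norm_nonneg _), norm_sq_eq_sum, Finset.sum_comm,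
      Fin.sum_univ_one, ← norm_toEuclideanLin_sq]
    rfl
  have h2 : ‖(Matrix.of fun i (_ : Fin 1) => v i)‖ = ‖v‖ := by
    rw [← sq_eq_sq₀ (norm_nonneg _) (norm_nonneg _), norm_sq_eq_sum, EuclideanSpace.norm_sq_eq]
    simp
  rwa [h1, h2] at h

theorem norm_le_sqrt_mul_opNorm (A : Mat m k) : ‖A‖ ≤ Real.sqrt k * opNorm A := by
  have h := norm_mul_le_opNorm A (1 : Mat k k)
  rw [Matrix.mul_one] at h
  have h1 : ‖(1 : Mat k k)‖ = Real.sqrt k := by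
    rw [eq_comm, Real.sqrt_eq_iff_eq_sq (by positivity) (norm_nonneg _), norm_sq_eq_sum]
    simp [Matrix.one_apply]
  rw [h1] at h
  linarith

theorem abs_ip_mul_transpose_le (G : Mat n n) (U V : Mat n r) :
    |ip G (U * V.transpose)| ≤ opNorm G * ‖U‖ * ‖V‖ := by
  rw [ip_mul_right']
  refine (abs_ip_le _ _).trans ?_
  rw [Matrix.transpose_transpose, mul_right_comm]
  exact mul_le_mul_of_nonneg_right (norm_mul_le_opNorm _ _) (norm_nonneg _)

/-! ### Rows -/

/-- The matrix with all rows but the `i`-th replaced by zero. -/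
noncomputable def rowPart (i : Fin m) (A : Mat m k) : Mat m k := Matrix.vecMulVec (Pi.single i 1) (A i)

theorem rowPart_apply (i : Fin m) (A : Mat m k) (a : Fin m) (j : Fin k) :
    rowPart i A a j = if a = i then A i j else 0 := by
  simp [rowPart, Matrix.vecMulVec_apply, Pi.single_apply]

theorem rowPart_eq_mul (i : Fin m) (A : Mat m k) : rowPart i A = Matrix.single i i (1 : ℝ) * A := by
  ext a j
  rw [rowPart_apply, Matrix.mul_apply, Finset.sum_eq_single i]
  · simp [Matrix.single_apply, eq_comm]
  · simp +contextual [eq_comm]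
  · simp

theorem rowPart_add (i : Fin m) (A B : Mat m k) :
    rowPart i (A + B) = rowPart i A + rowPart i B := by
  simp [rowPart_eq_mul, Matrix.mul_add]

theorem rowPart_smul (i : Fin m) (c : ℝ) (A : Mat m k) :
    rowPart i (c • A) = c • rowPart i A := by
  simp [rowPart_eq_mul]

theorem rowPart_mul (i : Fin m) (A : Mat m k) (B : Mat k l) :
    rowPart i (A * B) = rowPart i A * B := by
  simp [rowPart_eq_mul, Matrix.mul_assoc]

theorem rowPart_rowPart (i : Fin m) (A : Mat m k) : rowPart i (rowPart i A) = rowPart i A := by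
  ext a j; simp [rowPart_apply]

theorem ip_rowPart (i : Fin m) (A B : Mat m k) : ip (rowPart i A) B = ip A (rowPart i B) := by
  simp only [ip_eq_sum, rowPart_apply]
  refine Finset.sum_congr rfl fun a _ => Finset.sum_congr rfl fun j _ => ?_
  split_ifs with h <;> simp [h]

theorem ip_rowPart_rowPart (i : Fin m) (A B : Mat m k) :
    ip (rowPart i A) (rowPart i B) = ip (rowPart i A) B := by
  rw [ip_comm, ip_rowPart, rowPart_rowPart, ip_comm]

theorem norm_rowPart (i : Fin m) (A : Mat m k) : ‖rowPart i A‖ = Real.sqrt (∑ j, A i j ^ 2) := by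
  rw [eq_comm, Real.sqrt_eq_iff_eq_sq (by positivity) (norm_nonneg _), norm_sq_eq_sum,
    Finset.sum_eq_single i] <;> simp +contextual [rowPart_apply]

theorem norm_rowPart_le (i : Fin m) (A : Mat m k) : ‖rowPart i A‖ ≤ ‖A‖ := by
  have h : ‖rowPart i A‖ ^ 2 ≤ ‖rowPart i A‖ * ‖A‖ := by
    rw [← ip_self, ip_rowPart_rowPart]; exact ip_le _ _
  nlinarith [norm_nonneg (rowPart i A), norm_nonneg A]

theorem rowNorm_eq (A : Mat m k) : rowNorm A = ⨆ i, ‖rowPart i A‖ := by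
  simp only [rowNorm, norm_rowPart]

theorem norm_rowPart_le_rowNorm (i : Fin m) (A : Mat m k) : ‖rowPart i A‖ ≤ rowNorm A := by
  rw [rowNorm_eq]
  exact le_ciSup (Set.finite_range fun i => ‖rowPart i A‖).bddAbove i

theorem rowNorm_le {A : Mat m k} {c : ℝ} (hc : 0 ≤ c) (h : ∀ i, ‖rowPart i A‖ ≤ c) :
    rowNorm A ≤ c := by
  rw [rowNorm_eq]
  exact Real.iSup_le h hc

theorem rowNorm_nonneg (A : Mat m k) : 0 ≤ rowNorm A := by
  rw [rowNorm_eq]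
  exact Real.iSup_nonneg fun i => norm_nonneg _

theorem rowNorm_le_norm (A : Mat m k) : rowNorm A ≤ ‖A‖ :=
  rowNorm_le (norm_nonneg _) fun i => norm_rowPart_le i A

theorem rowNorm_add_le (A B : Mat m k) : rowNorm (A + B) ≤ rowNorm A + rowNorm B := by
  refine rowNorm_le (add_nonneg (rowNorm_nonneg _) (rowNorm_nonneg _)) fun i => ?_
  rw [rowPart_add]
  exact (norm_add_le _ _).trans
    (add_le_add (norm_rowPart_le_rowNorm i A) (norm_rowPart_le_rowNorm i B))

theorem rowNorm_smul (c : ℝ) (A : Mat m k) : rowNorm (c • A) = |c| * rowNorm A := by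
  simp only [rowNorm_eq, rowPart_smul, norm_smul, Real.norm_eq_abs]
  rw [Real.mul_iSup_of_nonneg (abs_nonneg c)]

theorem rowNorm_mul_le (A : Mat m k) (B : Mat k l) : rowNorm (A * B) ≤ rowNorm A * opNorm B := by
  refine rowNorm_le (mul_nonneg (rowNorm_nonneg _) (opNorm_nonneg _)) fun i => ?_
  rw [rowPart_mul]
  exact (norm_mul_le_opNorm' _ _).trans
    (mul_le_mul_of_nonneg_right (norm_rowPart_le_rowNorm i A) (opNorm_nonneg _))

theorem rowNorm_mul_orthogonal (A : Mat m k) {Q : Mat k k}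
    (hQ : Q ∈ Matrix.orthogonalGroup (Fin k) ℝ) : rowNorm (A * Q) = rowNorm A := by
  simp only [rowNorm_eq, rowPart_mul, norm_mul_orthogonal _ hQ]

theorem norm_le_sqrt_mul_rowNorm (A : Mat m k) : ‖A‖ ≤ Real.sqrt m * rowNorm A := by
  apply le_of_sq_le_sq _ (by have := rowNorm_nonneg A; positivity)
  rw [mul_pow, Real.sq_sqrt (by positivity), norm_sq_eq_sum]
  calc ∑ i, ∑ j, A i j ^ 2 ≤ ∑ i : Fin m, rowNorm A ^ 2 := by
        refine Finset.sum_le_sum fun i _ => ?_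
        rw [← Real.sqrt_le_left (rowNorm_nonneg A), ← norm_rowPart]
        exact norm_rowPart_le_rowNorm i A
    _ = m * rowNorm A ^ 2 := by simp

/-- Hölder's inequality on row i: the ℓ₁ norm of a row of G against the entries of a row of H Dᵀ,
each an inner product of a row of H with a row of D. It yields the row norm of D where
Cauchy-Schwarz would give its Frobenius norm. -/
theorem abs_ip_le_maxRowSum (G : Mat n n) (i : Fin n) (H D : Mat n r) :
    |ip G (rowPart i H * D.transpose)| ≤ maxRowSum G * rowNorm D * ‖rowPart i H‖ := by
  have hentry : ∀ j, |(H * D.transpose) i j| ≤ rowNorm D * ‖rowPart i H‖ := fun j => by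
    have h1 := abs_ip_le (Matrix.of fun (_ : Fin 1) b => H i b) (Matrix.of fun (_ : Fin 1) b => D j b)
    have h2 : ∀ (A : Mat n r) (i : Fin n), ‖Matrix.of fun (_ : Fin 1) b => A i b‖ = ‖rowPart i A‖ := by
      intro A i
      rw [norm_rowPart, eq_comm, Real.sqrt_eq_iff_eq_sq (by positivity) (norm_nonneg _),
        norm_sq_eq_sum]
      simp
    rw [h2, h2, ip_eq_sum] at h1
    simp only [Matrix.of_apply, Fin.sum_univ_one] at h1
    rw [Matrix.mul_apply]
    refine h1.trans ?_
    rw [mul_comm]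
    exact mul_le_mul_of_nonneg_right (norm_rowPart_le_rowNorm j D) (norm_nonneg _)
  rw [← rowPart_mul, ← ip_rowPart, ip_eq_sum, Finset.sum_eq_single i]
  · calc |∑ j, rowPart i G i j * (H * D.transpose) i j|
        ≤ ∑ j, |G i j| * (rowNorm D * ‖rowPart i H‖) := by
          refine (Finset.abs_sum_le_sum_abs _ _).trans (Finset.sum_le_sum fun j _ => ?_)
          rw [abs_mul, rowPart_apply, if_pos rfl]
          exact mul_le_mul_of_nonneg_left (hentry j) (abs_nonneg _)
      _ ≤ maxRowSum G * rowNorm D * ‖rowPart i H‖ := by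
          rw [← Finset.sum_mul, mul_assoc]
          refine mul_le_mul_of_nonneg_right ?_ (mul_nonneg (rowNorm_nonneg _) (norm_nonneg _))
          exact le_ciSup (Set.finite_range fun i => ∑ j, |G i j|).bddAbove i
  · intro a _ ha
    simp [rowPart_apply, ha]
  · simp

end LowRankGD

/-! ### Singular values of T and of T T†. -/

namespace LowRankGD

section SingularValues

variable {E F : Type*} [NormedAddCommGroup E] [InnerProductSpace ℝ E] [FiniteDimensional ℝ E]
  [NormedAddCommGroup F] [InnerProductSpace ℝ F] [FiniteDimensional ℝ F]

open Module InnerProductSpace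

theorem norm_sq_apply_eq_sum_singularValues (T : E →ₗ[ℝ] F) (v : E) :
    ‖T v‖ ^ 2 = ∑ i : Fin (finrank ℝ E), T.singularValues i ^ 2 *
      inner ℝ (T.isSymmetric_adjoint_comp_self.eigenvectorBasis rfl i) v ^ 2 := by
  have h : ‖T v‖ ^ 2 = inner ℝ v ((LinearMap.adjoint T ∘ₗ T) v) := by
    rw [LinearMap.comp_apply, LinearMap.adjoint_inner_right, real_inner_self_eq_norm_sq]
  rw [h, ← (T.isSymmetric_adjoint_comp_self.eigenvectorBasis rfl).sum_inner_mul_inner]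
  refine Finset.sum_congr rfl fun i _ => ?_
  rw [← T.isSymmetric_adjoint_comp_self, LinearMap.IsSymmetric.apply_eigenvectorBasis,
    T.sq_singularValues_fin rfl, inner_smul_left, real_inner_comm]
  simp only [RCLike.ofReal_real_eq_id, id_eq, conj_trivial]
  ring

theorem norm_sq_eq_sum_singularBasis (T : E →ₗ[ℝ] F) (v : E) :
    ‖v‖ ^ 2 = ∑ i : Fin (finrank ℝ E),
      inner ℝ (T.isSymmetric_adjoint_comp_self.eigenvectorBasis rfl i) v ^ 2 := by
  rw [← (T.isSymmetric_adjoint_comp_self.eigenvectorBasis rfl).sum_sq_norm_inner_right v]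
  simp

theorem norm_apply_le_singularValues_zero (T : E →ₗ[ℝ] F) (v : E) :
    ‖T v‖ ≤ T.singularValues 0 * ‖v‖ := by
  apply le_of_sq_le_sq _ (mul_nonneg (T.singularValues_nonneg 0) (norm_nonneg _))
  rw [mul_pow, norm_sq_apply_eq_sum_singularValues, norm_sq_eq_sum_singularBasis T, Finset.mul_sum]
  refine Finset.sum_le_sum fun i _ => mul_le_mul_of_nonneg_right ?_ (sq_nonneg _)
  exact pow_le_pow_left₀ (T.singularValues_nonneg _) (T.singularValues_antitone (Nat.zero_le _)) 2

/-- On the range of `T`, the map `T T†` expands by at least its last nonzero singular value. -/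
theorem singularValues_mul_norm_le (T : E →ₗ[ℝ] F) {r : ℕ} (hr : 1 ≤ r)
    (hrank : finrank ℝ (T ∘ₗ LinearMap.adjoint T).range = r) (v : E) :
    (T ∘ₗ LinearMap.adjoint T).singularValues (r - 1) * ‖T v‖ ≤
      ‖(T ∘ₗ LinearMap.adjoint T) (T v)‖ := by
  set A := T ∘ₗ LinearMap.adjoint T with hA
  refine (sq_le_sq₀ (mul_nonneg (A.singularValues_nonneg _) (norm_nonneg _)) (norm_nonneg _)).1 ?_
  rw [mul_pow, norm_sq_apply_eq_sum_singularValues A, norm_sq_eq_sum_singularBasis A (T v),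
    Finset.mul_sum]
  apply Finset.sum_le_sum
  intro i _
  -- For indices below r monotonicity suffices. From r on the singular value of A = T T† vanishes by
  -- the rank, so the basis vector is killed by A, hence by T†, hence is orthogonal to T v.
  by_cases hi : (i : ℕ) < r
  · refine mul_le_mul_of_nonneg_right ?_ (sq_nonneg _)
    exact pow_le_pow_left₀ (A.singularValues_nonneg _)
      (A.singularValues_antitone (by omega)) 2
  · have h0 : A.singularValues i = 0 := by
      rw [A.singularValues_eq_zero_iff_le_finrank_range]; omega
    set u := A.isSymmetric_adjoint_comp_self.eigenvectorBasis rfl i with hu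
    have h1 : (LinearMap.adjoint A ∘ₗ A) u = 0 := by
      rw [hu, LinearMap.IsSymmetric.apply_eigenvectorBasis, ← A.sq_singularValues_fin rfl, h0]
      simp
    have h2 : A u = 0 := by
      have : inner ℝ (A u) (A u) = 0 := by
        rw [← LinearMap.adjoint_inner_right]
        rw [LinearMap.comp_apply] at h1
        rw [h1, inner_zero_right]
      exact inner_self_eq_zero.1 this
    have h3 : LinearMap.adjoint T u = 0 := by
      have : inner ℝ (LinearMap.adjoint T u) (LinearMap.adjoint T u) = 0 := by
        rw [LinearMap.adjoint_inner_left, ← LinearMap.comp_apply, ← hA, h2, inner_zero_right]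
      exact inner_self_eq_zero.1 this
    have h4 : inner ℝ u (T v) = 0 := by
      rw [← LinearMap.adjoint_inner_left, h3, inner_zero_left]
    simp [h4]

/-- If v is a right singular vector of T, then T v is an eigenvector of T T† with eigenvalue the
squared singular value, and it is nonzero because the rank forces T to be injective. The bounds of T
T† on the range of T then apply, and the two spectra need not be matched. -/
theorem singularValues_sq_bounds (T : E →ₗ[ℝ] F) {r : ℕ} (hr : 1 ≤ r)
    (hE : finrank ℝ E = r) (hrank : finrank ℝ (T ∘ₗ LinearMap.adjoint T).range = r)
    (i : Fin (finrank ℝ E)) :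
    (T ∘ₗ LinearMap.adjoint T).singularValues (r - 1) ≤ T.singularValues i ^ 2 ∧
      T.singularValues i ^ 2 ≤ (T ∘ₗ LinearMap.adjoint T).singularValues 0 := by
  set A := T ∘ₗ LinearMap.adjoint T with hA
  have hinj : Function.Injective T := by
    have h1 : A.range ≤ T.range := LinearMap.range_comp_le_range _ _
    have h2 := Submodule.finrank_mono h1
    have h3 := T.finrank_range_add_finrank_ker
    rw [← LinearMap.ker_eq_bot]
    apply Submodule.finrank_eq_zero.1
    omega
  set v := T.isSymmetric_adjoint_comp_self.eigenvectorBasis rfl i with hv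
  have hv0 : v ≠ 0 := by
    exact (T.isSymmetric_adjoint_comp_self.eigenvectorBasis rfl).orthonormal.ne_zero i
  have hTv : 0 < ‖T v‖ := norm_pos_iff.2 fun h => hv0 (hinj (by rw [h, map_zero]))
  have hAT : ‖A (T v)‖ = T.singularValues i ^ 2 * ‖T v‖ := by
    have h1 : (LinearMap.adjoint T ∘ₗ T) v = (T.singularValues i ^ 2) • v := by
      rw [hv, LinearMap.IsSymmetric.apply_eigenvectorBasis, ← T.sq_singularValues_fin rfl]
      simp
    have h2 : A (T v) = T ((LinearMap.adjoint T ∘ₗ T) v) := rfl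
    rw [h2, h1, map_smul, norm_smul, Real.norm_eq_abs, abs_of_nonneg (sq_nonneg _)]
  have hl := singularValues_mul_norm_le T hr hrank v
  have hu := norm_apply_le_singularValues_zero A (T v)
  rw [← hA, hAT] at hl
  rw [hAT] at hu
  exact ⟨le_of_mul_le_mul_right hl hTv, le_of_mul_le_mul_right hu hTv⟩

theorem singularValues_mul_norm_sq_le (T : E →ₗ[ℝ] F) {r : ℕ} (hr : 1 ≤ r)
    (hE : finrank ℝ E = r) (hrank : finrank ℝ (T ∘ₗ LinearMap.adjoint T).range = r) (v : E) :
    (T ∘ₗ LinearMap.adjoint T).singularValues (r - 1) * ‖v‖ ^ 2 ≤ ‖T v‖ ^ 2 ∧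
      ‖T v‖ ^ 2 ≤ (T ∘ₗ LinearMap.adjoint T).singularValues 0 * ‖v‖ ^ 2 := by
  rw [norm_sq_apply_eq_sum_singularValues, norm_sq_eq_sum_singularBasis T, Finset.mul_sum,
    Finset.mul_sum]
  exact ⟨Finset.sum_le_sum fun i _ => mul_le_mul_of_nonneg_right
      (singularValues_sq_bounds T hr hE hrank i).1 (sq_nonneg _),
    Finset.sum_le_sum fun i _ => mul_le_mul_of_nonneg_right
      (singularValues_sq_bounds T hr hE hrank i).2 (sq_nonneg _)⟩

end SingularValues

/-! ### Conditioning of the factor Z*. -/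

variable {n r m : ℕ}

/-- The conditioning of a full-rank factor: its smallest singular value is at least `p`, its
largest one at most `q p`. -/
structure Conditioned (Zs : Mat n r) (p q : ℝ) : Prop where
  p_pos : 0 < p
  one_le_q : 1 ≤ q
  lower : ∀ {m : ℕ} (W : Mat r m), p * ‖W‖ ≤ ‖Zs * W‖
  upper : opNorm Zs ≤ q * p

theorem toEuclideanLin_mul_transpose (Zs : Mat n r) :
    Matrix.toEuclideanLin (Zs * Zs.transpose) =
      Matrix.toEuclideanLin Zs ∘ₗ LinearMap.adjoint (Matrix.toEuclideanLin Zs) := by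
  rw [← Matrix.toEuclideanLin_conjTranspose_eq_adjoint,
    Matrix.conjTranspose_eq_transpose_of_trivial]
  ext v i
  simp [Matrix.toLpLin_apply]

theorem finrank_range_toEuclideanLin (A : Mat m n) :
    Module.finrank ℝ (Matrix.toEuclideanLin A).range = A.rank := by
  rw [Matrix.rank_eq_finrank_range_toLin A (EuclideanSpace.basisFun (Fin m) ℝ).toBasis
    (EuclideanSpace.basisFun (Fin n) ℝ).toBasis]
  rw [Matrix.toEuclideanLin_eq_toLin_orthonormal]

theorem sigma_rank_pos {Zs : Mat n r} (hr : 1 ≤ r) (hrank : (Zs * Zs.transpose).rank = r) :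
    0 < sigma r (Zs * Zs.transpose) := by
  rw [sigma, LinearMap.singularValues_pos_iff_lt_finrank_range, finrank_range_toEuclideanLin,
    hrank]
  omega

theorem sigma_rank_le_sigma_one (Zs : Mat n r) :
    sigma r (Zs * Zs.transpose) ≤ sigma 1 (Zs * Zs.transpose) :=
  LinearMap.singularValues_antitone _ (by simp)

theorem one_le_kappa {Zs : Mat n r} (hr : 1 ≤ r) (hrank : (Zs * Zs.transpose).rank = r) :
    1 ≤ kappa Zs := by
  rw [kappa, one_le_div (sigma_rank_pos hr hrank)]
  exact sigma_rank_le_sigma_one Zs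

theorem conditioned_of_rank {Zs : Mat n r} (hr : 1 ≤ r) (hrank : (Zs * Zs.transpose).rank = r) :
    Conditioned Zs (Real.sqrt (sigma r (Zs * Zs.transpose))) (Real.sqrt (kappa Zs)) := by
  have hpos := sigma_rank_pos hr hrank
  have hb : ∀ v, sigma r (Zs * Zs.transpose) * ‖v‖ ^ 2 ≤ ‖Matrix.toEuclideanLin Zs v‖ ^ 2 ∧
      ‖Matrix.toEuclideanLin Zs v‖ ^ 2 ≤ sigma 1 (Zs * Zs.transpose) * ‖v‖ ^ 2 := fun v => by
    have := singularValues_mul_norm_sq_le (Matrix.toEuclideanLin Zs) hr (by simp)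
      (by rw [← toEuclideanLin_mul_transpose, finrank_range_toEuclideanLin, hrank]) v
    rwa [← toEuclideanLin_mul_transpose] at this
  refine ⟨Real.sqrt_pos.2 hpos, Real.one_le_sqrt.2 (one_le_kappa hr hrank), fun {m} W => ?_, ?_⟩
  · apply le_of_sq_le_sq _ (norm_nonneg _)
    rw [mul_pow, Real.sq_sqrt hpos.le, norm_sq_eq_sum, norm_sq_eq_sum, Finset.sum_comm,
      Finset.sum_comm (s := Finset.univ (α := Fin n)), Finset.mul_sum]
    refine Finset.sum_le_sum fun j _ => ?_
    rw [← norm_toEuclideanLin_sq]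
    have h2 : ‖WithLp.toLp 2 fun i => W i j‖ ^ 2 = ∑ i, W i j ^ 2 := by
      rw [EuclideanSpace.norm_sq_eq]; simp
    rw [← h2]
    exact (hb _).1
  · refine opNorm_le_of_forall _ (by positivity) fun v => ?_
    apply le_of_sq_le_sq _ (by positivity)
    have hk : 0 ≤ kappa Zs := zero_le_one.trans (one_le_kappa hr hrank)
    rw [mul_pow, mul_pow, Real.sq_sqrt hpos.le, Real.sq_sqrt hk, kappa, div_mul_cancel₀ _ hpos.ne']
    exact (hb v).2

end LowRankGD

/-! ### Optimal alignments. -/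

namespace LowRankGD

variable {n r : ℕ}

/-- Orthogonal factors preserve the Frobenius norm, so only the cross term of ‖Z Q - Z*‖² depends on
Q. The resulting condition is linear in Z, which is what makes the slices convex. -/
theorem isAlignment_iff {Z Zs : Mat n r} {R : Mat r r} :
    IsAlignment Z Zs R ↔ R ∈ Matrix.orthogonalGroup (Fin r) ℝ ∧
      ∀ Q ∈ Matrix.orthogonalGroup (Fin r) ℝ, ip (Z * Q) Zs ≤ ip (Z * R) Zs := by
  refine and_congr_right fun hR => forall₂_congr fun Q hQ => ?_
  rw [← sq_le_sq₀ (norm_nonneg _) (norm_nonneg _), norm_sub_sq, norm_sub_sq,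
    norm_mul_orthogonal _ hR, norm_mul_orthogonal _ hQ]
  constructor <;> intro h <;> linarith

theorem isAlignment_one_iff {Z Zs : Mat n r} :
    IsAlignment Z Zs 1 ↔
      ∀ Q ∈ Matrix.orthogonalGroup (Fin r) ℝ, ip (Z * Q) Zs ≤ ip Z Zs := by
  rw [isAlignment_iff, Matrix.mul_one]
  exact and_iff_right (one_mem _)

theorem isAlignment_mul_iff {Z Zs : Mat n r} {R S : Mat r r}
    (hR : R ∈ Matrix.orthogonalGroup (Fin r) ℝ) :
    IsAlignment (Z * R) Zs S ↔ IsAlignment Z Zs (R * S) := by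
  have hR' : R.transpose ∈ Matrix.orthogonalGroup (Fin r) ℝ := by
    rw [Matrix.mem_orthogonalGroup_iff, Matrix.transpose_transpose]
    exact (Matrix.mem_orthogonalGroup_iff' _ _).1 hR
  have h1 : R * R.transpose = 1 := (Matrix.mem_orthogonalGroup_iff _ _).1 hR
  have h2 : R.transpose * R = 1 := (Matrix.mem_orthogonalGroup_iff' _ _).1 hR
  constructor
  · rintro ⟨hS, h⟩
    refine ⟨mul_mem hR hS, fun Q hQ => ?_⟩
    have := h (R.transpose * Q) (mul_mem hR' hQ)
    rwa [Matrix.mul_assoc, Matrix.mul_assoc, ← Matrix.mul_assoc R R.transpose, h1,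
      Matrix.one_mul] at this
  · rintro ⟨hS, h⟩
    refine ⟨?_, fun Q hQ => ?_⟩
    · have := mul_mem hR' hS
      rwa [← Matrix.mul_assoc, h2, Matrix.one_mul] at this
    · have := h (R * Q) (mul_mem hR hQ)
      rwa [← Matrix.mul_assoc, ← Matrix.mul_assoc] at this

theorem IsAlignment.mul {Z Zs : Mat n r} {R : Mat r r} (h : IsAlignment Z Zs R) :
    IsAlignment (Z * R) Zs 1 := by
  rw [isAlignment_mul_iff h.1, Matrix.mul_one]
  exact h

theorem dist2_mul {Z Zs : Mat n r} {R : Mat r r}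
    (hR : R ∈ Matrix.orthogonalGroup (Fin r) ℝ) : dist2 (Z * R) Zs = dist2 Z Zs := by
  obtain ⟨S, hS⟩ := exists_isAlignment (Z * R) Zs
  rw [hS.dist2_eq, ((isAlignment_mul_iff hR).1 hS).dist2_eq, Matrix.mul_assoc]

theorem distInf_le {Z Zs : Mat n r} {R : Mat r r} (hR : IsAlignment Z Zs R) :
    distInf Z Zs ≤ rowNorm (Z * R - Zs) :=
  ciInf_le (f := fun R : {R : Mat r r // IsAlignment Z Zs R} => rowNorm (Z * R.1 - Zs))
    ⟨0, by rintro _ ⟨Q, rfl⟩; exact rowNorm_nonneg _⟩ ⟨R, hR⟩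

theorem distInf_nonneg (Z Zs : Mat n r) : 0 ≤ distInf Z Zs :=
  Real.iInf_nonneg fun _ => rowNorm_nonneg _

theorem dist2_nonneg (Z Zs : Mat n r) : 0 ≤ dist2 Z Zs :=
  Real.iInf_nonneg fun _ => norm_nonneg _

theorem dist2_le {Z Zs : Mat n r} {R : Mat r r} (hR : R ∈ Matrix.orthogonalGroup (Fin r) ℝ) :
    dist2 Z Zs ≤ ‖Z * R - Zs‖ :=
  ciInf_le ⟨0, by rintro _ ⟨Q, rfl⟩; exact norm_nonneg _⟩
    (⟨R, hR⟩ : Matrix.orthogonalGroup (Fin r) ℝ)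

/-- The rotation with cosine `c` and sine `s` in the coordinate plane of `i` and `j`. -/
noncomputable def givens (i j : Fin r) (c s : ℝ) : Mat r r :=
  1 + Matrix.single i i (c - 1) + Matrix.single j j (c - 1) + Matrix.single i j s
    + Matrix.single j i (-s)

theorem givens_mem_orthogonalGroup {i j : Fin r} (hij : i ≠ j) {c s : ℝ} (h : c ^ 2 + s ^ 2 = 1) :
    givens i j c s ∈ Matrix.orthogonalGroup (Fin r) ℝ := by
  rw [Matrix.mem_orthogonalGroup_iff]
  simp only [givens, Matrix.transpose_add, Matrix.transpose_one, Matrix.transpose_single,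
    Matrix.mul_add, Matrix.add_mul, Matrix.one_mul, Matrix.mul_one, Matrix.single_mul_single_same,
    Matrix.single_mul_single_of_ne _ _ _ _ hij, Matrix.single_mul_single_of_ne _ _ _ _ hij.symm]
  ext a b
  simp only [Matrix.add_apply, Matrix.single_apply, Matrix.zero_apply]
  by_cases h1 : i = a <;> by_cases h2 : j = a <;> by_cases h3 : i = b <;> by_cases h4 : j = b <;>
    simp_all <;> nlinarith

/-- At an optimally aligned point, `Zᵀ Z*` is symmetric. -/
theorem IsAlignment.isSymm {Z Zs : Mat n r} (h : IsAlignment Z Zs 1) :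
    (Z.transpose * Zs).IsSymm := by
  have key : ∀ i j : Fin r, i ≠ j → (Z.transpose * Zs) j i = (Z.transpose * Zs) i j := by
    intro i j hij
    set M := Z.transpose * Zs with hM
    have hQ : ∀ c s : ℝ, c ^ 2 + s ^ 2 = 1 →
        (c - 1) * (M i i + M j j) + s * (M i j - M j i) ≤ 0 := by
      intro c s hcs
      have h1 := isAlignment_one_iff.1 h _ (givens_mem_orthogonalGroup hij hcs)
      rw [ip_comm, ip_mul_right] at h1
      have hs : ∀ (x y : Fin r) (a : ℝ), ip M (Matrix.single x y a) = a * M x y := by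
        intro x y a
        rw [← ip_single M x y, ← ip_smul_right]; simp
      rw [givens, ip_add_right, ip_add_right, ip_add_right, ip_add_right, ← hM, hs, hs, hs, hs,
        ← ip_mul_right, Matrix.mul_one, ip_comm Zs Z] at h1
      linarith
    set a := M i i + M j j
    set b := M i j - M j i with hb
    rcases eq_or_lt_of_le (add_nonneg (sq_nonneg a) (sq_nonneg b)) with h0 | h0
    · nlinarith [sq_nonneg a, sq_nonneg b, hb]
    -- The tested quantity is (c - 1) a + s b; its maximum over the unit circle is at the normalized
    -- (a, b), where it equals √(a² + b²) - a. Optimality makes this nonpositive, so b = 0.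
    · have h1 := hQ (a / Real.sqrt (a ^ 2 + b ^ 2)) (b / Real.sqrt (a ^ 2 + b ^ 2)) (by
        rw [div_pow, div_pow, Real.sq_sqrt h0.le]; field_simp)
      have hs := Real.sqrt_pos.2 h0
      have hsq := Real.sq_sqrt h0.le
      set s := Real.sqrt (a ^ 2 + b ^ 2)
      have h2 : (a / s - 1) * a + b / s * b = s - a := by
        field_simp
        nlinarith
      rw [h2] at h1
      have h3 : s ^ 2 ≤ a ^ 2 := pow_le_pow_left₀ hs.le (by linarith) 2
      nlinarith [sq_nonneg b]
  ext i j
  rw [Matrix.transpose_apply]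
  by_cases hij : i = j
  · rw [hij]
  · exact key i j hij

/-- Near `Z*`, the optimal alignment depends on the skew part of `Zᵀ Z*` in a Lipschitz way. -/
theorem IsAlignment.norm_sub_one_le {Z Zs : Mat n r} {Q : Mat r r} {p q : ℝ}
    (hc : Conditioned Zs p q) (hQ : IsAlignment Z Zs Q) (hd : ‖Z - Zs‖ ≤ p / (100 * q)) :
    99 / 100 * p ^ 2 * ‖Q - 1‖ ≤ ‖Z.transpose * Zs - Zs.transpose * Z‖ := by
  have hp := hc.p_pos
  have hq : 0 < q := zero_lt_one.trans_le hc.one_le_q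
  set D := Q - 1 with hD
  have hQD : Q = D + 1 := by rw [hD]; abel
  have h1 : 0 ≤ ip D (Z.transpose * Zs) := by
    have h := (isAlignment_iff.1 hQ).2 1 (one_mem _)
    rw [hQD, Matrix.mul_add, ip_add_left] at h
    rw [ip_comm, ← ip_mul_right, ip_comm]
    linarith
  have horth : D.transpose * D = -(D + D.transpose) := by
    have h : Q.transpose * Q = 1 := (Matrix.mem_orthogonalGroup_iff' _ _).1 hQ.1
    rw [hQD, Matrix.transpose_add, Matrix.transpose_one, Matrix.add_mul, Matrix.mul_add,
      Matrix.mul_one, Matrix.one_mul] at h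
    have : D.transpose * D = (D.transpose * D + D.transpose + (D + 1)) - D.transpose - D - 1 := by
      abel
    rw [this, h]
    abel
  set N := Z.transpose * Zs with hN
  have hNt : Zs.transpose * Z = N.transpose := by rw [hN]; simp
  -- Orthogonality of 1 + D makes the symmetric part of D quadratic. The left side is nonnegative by
  -- optimality, while ⟨N, DᵀD⟩ is ‖Z* Dᵀ‖² ≥ p² ‖D‖² up to one percent of p² ‖D‖²; only the skew
  -- part of N can compensate, and one factor ‖D‖ cancels.
  have h2 : 2 * ip D N = ip D (N - N.transpose) - ip N (D.transpose * D) := by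
    rw [horth]
    have : ip N (-(D + D.transpose)) = - ip D N - ip D N.transpose := by
      rw [← neg_one_smul ℝ, ip_smul_right, ip_add_right, ← ip_transpose N D.transpose,
        Matrix.transpose_transpose, ip_comm N, ip_comm N.transpose]
      ring
    rw [this, ip_sub_right]
    ring
  have h3 : ip N (D.transpose * D) = ‖Zs * D.transpose‖ ^ 2 +
      ip ((Z - Zs) * D.transpose) (Zs * D.transpose) := by
    rw [ip_mul_right', ip_comm, hN, Matrix.mul_assoc, ip_mul_right, Matrix.transpose_transpose,
      ← ip_self, ← ip_add_left, ← Matrix.add_mul]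
    congr 2
    abel
  have h4 : ip D (N - N.transpose) ≤ ‖D‖ * ‖N - N.transpose‖ := ip_le _ _
  have h5 : p * ‖D‖ ≤ ‖Zs * D.transpose‖ := by
    rw [← norm_transpose D]; exact hc.lower _
  have h6 : |ip ((Z - Zs) * D.transpose) (Zs * D.transpose)| ≤ p ^ 2 / 100 * ‖D‖ ^ 2 := by
    refine (abs_ip_le _ _).trans ?_
    have h7 : ‖(Z - Zs) * D.transpose‖ ≤ p / (100 * q) * ‖D‖ := by
      refine (Matrix.frobenius_norm_mul _ _).trans ?_
      rw [norm_transpose]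
      exact mul_le_mul_of_nonneg_right hd (norm_nonneg _)
    have h8 : ‖Zs * D.transpose‖ ≤ q * p * ‖D‖ := by
      refine (norm_mul_le_opNorm _ _).trans ?_
      rw [norm_transpose]
      exact mul_le_mul_of_nonneg_right hc.upper (norm_nonneg _)
    calc _ ≤ (p / (100 * q) * ‖D‖) * (q * p * ‖D‖) :=
          mul_le_mul h7 h8 (norm_nonneg _) (by positivity)
      _ = p ^ 2 / 100 * ‖D‖ ^ 2 := by field_simp
  rw [hNt]
  have h9 : (p * ‖D‖) ^ 2 ≤ ‖Zs * D.transpose‖ ^ 2 := pow_le_pow_left₀ (by positivity) h5 2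
  have h10 := neg_abs_le (ip ((Z - Zs) * D.transpose) (Zs * D.transpose))
  have h11 : ‖D‖ * (99 / 100 * p ^ 2 * ‖D‖) ≤ ‖D‖ * ‖N - N.transpose‖ := by nlinarith
  rcases eq_or_lt_of_le (norm_nonneg D) with h0 | h0
  · rw [← h0]; simp
  · exact le_of_mul_le_mul_left h11 h0

theorem IsAlignment.eq_one {Z Zs : Mat n r} {Q : Mat r r} {p q : ℝ}
    (hc : Conditioned Zs p q) (h1 : IsAlignment Z Zs 1) (hQ : IsAlignment Z Zs Q)
    (hd : ‖Z - Zs‖ ≤ p / (100 * q)) : Q = 1 := by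
  have h := hQ.norm_sub_one_le hc hd
  have hs : Zs.transpose * Z = Z.transpose * Zs := by
    have := h1.isSymm.eq
    rwa [Matrix.transpose_mul, Matrix.transpose_transpose] at this
  rw [hs, sub_self, norm_zero] at h
  have hp := hc.p_pos
  have : ‖Q - 1‖ ≤ 0 := by
    by_contra! hlt
    have : 0 < 99 / 100 * p ^ 2 * ‖Q - 1‖ := by positivity
    linarith
  exact sub_eq_zero.1 (norm_le_zero_iff.1 this)

/-- Near `Z*`, the optimal alignment is unique. -/
theorem IsAlignment.unique {Z Zs : Mat n r} {R S : Mat r r} {p q : ℝ}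
    (hc : Conditioned Zs p q) (hR : IsAlignment Z Zs R) (hS : IsAlignment Z Zs S)
    (hd : dist2 Z Zs ≤ p / (100 * q)) : R = S := by
  have h1 : R * R.transpose = 1 := (Matrix.mem_orthogonalGroup_iff _ _).1 hR.1
  have h : IsAlignment (Z * R) Zs (R.transpose * S) := by
    rw [isAlignment_mul_iff hR.1, ← Matrix.mul_assoc, h1, Matrix.one_mul]
    exact hS
  have h2 := hR.mul.eq_one hc h (by rwa [← hR.dist2_eq])
  calc R = R * (R.transpose * S) := by rw [h2, Matrix.mul_one]
    _ = S := by rw [← Matrix.mul_assoc, h1, Matrix.one_mul]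

/-- Inside the radius where the alignment is unique, the infimum over optimal alignments runs over a
single matrix. -/
theorem distInf_eq {Z Zs : Mat n r} {R : Mat r r} {p q : ℝ}
    (hc : Conditioned Zs p q) (hR : IsAlignment Z Zs R)
    (hd : dist2 Z Zs ≤ p / (100 * q)) : distInf Z Zs = rowNorm (Z * R - Zs) := by
  refine le_antisymm (distInf_le hR) ?_
  have : Nonempty {R : Mat r r // IsAlignment Z Zs R} := ⟨⟨R, hR⟩⟩
  exact le_ciInf fun S => by rw [hR.unique hc S.2 hd]

theorem distInf_mul {Z Zs : Mat n r} {R : Mat r r}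
    (hR : R ∈ Matrix.orthogonalGroup (Fin r) ℝ) : distInf (Z * R) Zs = distInf Z Zs := by
  have h1 : R * R.transpose = 1 := (Matrix.mem_orthogonalGroup_iff _ _).1 hR
  apply le_antisymm
  · have : Nonempty {R : Mat r r // IsAlignment Z Zs R} :=
      (exists_isAlignment Z Zs).elim fun R hR => ⟨⟨R, hR⟩⟩
    refine le_ciInf fun S => ?_
    have h2 : IsAlignment (Z * R) Zs (R.transpose * S.1) := by
      rw [isAlignment_mul_iff hR, ← Matrix.mul_assoc, h1, Matrix.one_mul]
      exact S.2
    have h3 := distInf_le h2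
    rwa [Matrix.mul_assoc, ← Matrix.mul_assoc R, h1, Matrix.one_mul] at h3
  · have : Nonempty {S : Mat r r // IsAlignment (Z * R) Zs S} :=
      (exists_isAlignment (Z * R) Zs).elim fun R hR => ⟨⟨R, hR⟩⟩
    refine le_ciInf fun S => ?_
    have h3 := distInf_le ((isAlignment_mul_iff hR).1 S.2)
    rwa [← Matrix.mul_assoc] at h3

end LowRankGD

/-! ### Derivatives of the factorized objective. -/

namespace LowRankGD

variable {m k n r : ℕ}

theorem fderiv_eq_ip (f : Mat m k → ℝ) (X H : Mat m k) : fderiv ℝ f X H = ip (matGrad f X) H := by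
  conv_lhs => rw [Matrix.matrix_eq_sum_single H]
  rw [ip_eq_sum]
  simp only [map_sum]
  refine Finset.sum_congr rfl fun i _ => Finset.sum_congr rfl fun j _ => ?_
  have : Matrix.single i j (H i j) = H i j • Matrix.single i j (1 : ℝ) := by simp
  rw [this, map_smul, matGrad, Matrix.of_apply, smul_eq_mul, mul_comm]

section Quadratic

variable {E F : Type*} [NormedAddCommGroup E] [NormedSpace ℝ E] [NormedAddCommGroup F]
  [NormedSpace ℝ F] {b : E →ₗ[ℝ] E →ₗ[ℝ] F}

/-- Z ↦ Z Zᵀ is treated as the diagonal of a bilinear map of norm at most one; the derivative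
formulas of this section need nothing else about matrices. -/
theorem hasFDerivAt_bilinear_diag (hb : ∀ x y, ‖b x y‖ ≤ 1 * ‖x‖ * ‖y‖) (x : E) :
    ∃ T : E →L[ℝ] F, (∀ v, T v = b x v + b v x) ∧ HasFDerivAt (fun x => b x x) T x := by
  let B := LinearMap.mkContinuous₂ b 1 hb
  refine ⟨_, ?_, B.hasFDerivAt_of_bilinear (hasFDerivAt_id x) (hasFDerivAt_id x)⟩
  intro v
  simp [ContinuousLinearMap.precompR, ContinuousLinearMap.precompL, B]

theorem continuous_bilinear_diag (hb : ∀ x y, ‖b x y‖ ≤ 1 * ‖x‖ * ‖y‖) :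
    Continuous (fun x => b x x) :=
  continuous_iff_continuousAt.2 fun x =>
    (hasFDerivAt_bilinear_diag hb x).elim fun _ h => h.2.continuousAt

theorem fderiv_comp_bilinear_diag (hb : ∀ x y, ‖b x y‖ ≤ 1 * ‖x‖ * ‖y‖) {f : F → ℝ}
    (hf : ContDiff ℝ 2 f) (x v : E) :
    fderiv ℝ (fun x => f (b x x)) x v = fderiv ℝ f (b x x) (b x v + b v x) := by
  obtain ⟨T, hT, h⟩ := hasFDerivAt_bilinear_diag hb x
  have h2 := ((hf.differentiable (by norm_num) _).hasFDerivAt).comp x h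
  have h3 := h2.fderiv
  simp only [Function.comp_def] at h3
  rw [h3, ContinuousLinearMap.comp_apply, hT]

theorem hasDerivAt_comp_line {f : E → ℝ} {x : E} (hf : DifferentiableAt ℝ f x) (v : E) :
    HasDerivAt (fun s : ℝ => f (x + s • v)) (fderiv ℝ f x v) 0 := by
  have h : HasDerivAt (fun s : ℝ => x + s • v) v 0 := by
    simpa using ((hasDerivAt_id (0 : ℝ)).smul_const v).const_add x
  have hx : x = x + (0 : ℝ) • v := by simp
  have h2 : HasFDerivAt f (fderiv ℝ f x) (x + (0 : ℝ) • v) := by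
    rw [← hx]; exact hf.hasFDerivAt
  exact h2.comp_hasDerivAt 0 h

theorem differentiable_comp_bilinear_diag (hb : ∀ x y, ‖b x y‖ ≤ 1 * ‖x‖ * ‖y‖) {f : F → ℝ}
    (hf : ContDiff ℝ 2 f) : Differentiable ℝ (fun x => f (b x x)) := fun x => by
  obtain ⟨T, hT, h⟩ := hasFDerivAt_bilinear_diag hb x
  exact ((hf.differentiable (by norm_num) _).comp x h.differentiableAt)

theorem hasDerivAt_fderiv_apply {f : F → ℝ} (hf : ContDiff ℝ 2 f) {X T : ℝ → F}
    {X' T' : F} {s : ℝ} (hX : HasDerivAt X X' s) (hT : HasDerivAt T T' s) :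
    HasDerivAt (fun s => fderiv ℝ f (X s) (T s))
      (fderiv ℝ (fderiv ℝ f) (X s) X' (T s) + fderiv ℝ f (X s) T') s := by
  have h1 : Differentiable ℝ (fderiv ℝ f) :=
    (hf.fderiv_right (m := 1) (by norm_num)).differentiable (by norm_num)
  exact ((h1 (X s)).hasFDerivAt.comp_hasDerivAt s hX).clm_apply hT

theorem hasDerivAt_fderiv_bilinear_line (hb : ∀ x y, ‖b x y‖ ≤ 1 * ‖x‖ * ‖y‖) {f : F → ℝ}
    (hf : ContDiff ℝ 2 f) (x d v : E) (s : ℝ) :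
    HasDerivAt (fun s : ℝ => fderiv ℝ f (b (x + s • d) (x + s • d))
        (b (x + s • d) v + b v (x + s • d)))
      (fderiv ℝ (fderiv ℝ f) (b (x + s • d) (x + s • d)) (b (x + s • d) d + b d (x + s • d))
          (b (x + s • d) v + b v (x + s • d))
        + fderiv ℝ f (b (x + s • d) (x + s • d)) (b d v + b v d)) s := by
  have hline : HasDerivAt (fun s : ℝ => x + s • d) d s := by
    simpa using ((hasDerivAt_id s).smul_const d).const_add x
  obtain ⟨T, hT, h⟩ := hasFDerivAt_bilinear_diag hb (x + s • d)
  have hX := h.comp_hasDerivAt s hline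
  rw [hT] at hX
  refine hasDerivAt_fderiv_apply hf hX ?_
  have h2 : HasDerivAt (fun s : ℝ => (b x v + b v x) + s • (b d v + b v d)) (b d v + b v d) s := by
    simpa using ((hasDerivAt_id s).smul_const (b d v + b v d)).const_add (b x v + b v x)
  convert h2 using 2
  simp only [map_add, map_smul, LinearMap.add_apply, LinearMap.smul_apply, smul_add]
  abel

/-- A line through a quadratic curve in the base point of a derivative. -/
theorem hasDerivAt_fderiv_quadratic {f : F → ℝ} (hf : ContDiff ℝ 2 f) (X M : F) (s : ℝ) :
    HasDerivAt (fun s : ℝ => fderiv ℝ f (X + (2 * s + s ^ 2) • M) M)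
      (fderiv ℝ (fderiv ℝ f) (X + (2 * s + s ^ 2) • M) ((2 + 2 * s) • M) M) s := by
  have h1 : HasDerivAt (fun s : ℝ => 2 * s + s ^ 2) (2 + 2 * s) s := by
    have h := ((hasDerivAt_id s).const_mul 2).add (hasDerivAt_pow 2 s)
    simp only [mul_one, Nat.cast_ofNat, Nat.add_one_sub_one, pow_one] at h
    exact h
  have hX := (h1.smul_const M).const_add X
  have := hasDerivAt_fderiv_apply hf hX (hasDerivAt_const s M)
  simpa using this

end Quadratic

/-- `(A, B) ↦ A Bᵀ` as a bilinear map. -/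
noncomputable def mulTranspose (n r : ℕ) : Mat n r →ₗ[ℝ] Mat n r →ₗ[ℝ] Mat n n :=
  LinearMap.mk₂ ℝ (fun A B : Mat n r => A * B.transpose)
    (fun A B C => Matrix.add_mul A B _) (fun c A B => Matrix.smul_mul c A _)
    (fun A B C => by rw [Matrix.transpose_add, Matrix.mul_add])
    (fun c A B => by rw [Matrix.transpose_smul, Matrix.mul_smul])

theorem norm_mulTranspose_le (A B : Mat n r) : ‖mulTranspose n r A B‖ ≤ 1 * ‖A‖ * ‖B‖ := by
  have h : mulTranspose n r A B = A * B.transpose := rfl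
  rw [h, one_mul]
  exact (Matrix.frobenius_norm_mul _ _).trans_eq (by rw [norm_transpose])

theorem tangent_add_right (Z V W : Mat n r) : tangent Z (V + W) = tangent Z V + tangent Z W := by
  simp only [tangent, Matrix.transpose_add, Matrix.mul_add, Matrix.add_mul]
  abel

theorem tangent_add_left (Y Z W : Mat n r) : tangent (Y + Z) W = tangent Y W + tangent Z W := by
  simp only [tangent, Matrix.transpose_add, Matrix.mul_add, Matrix.add_mul]
  abel

theorem tangent_smul_right (c : ℝ) (Z W : Mat n r) : tangent Z (c • W) = c • tangent Z W := by
  simp [tangent]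

theorem fderiv_factored {ℓ : Mat n n → ℝ} (hℓ : ContDiff ℝ 2 ℓ) (Z V : Mat n r) :
    fderiv ℝ (factored r ℓ) Z V = fderiv ℝ ℓ (Z * Z.transpose) (tangent Z V) :=
  fderiv_comp_bilinear_diag (b := mulTranspose n r) norm_mulTranspose_le hℓ Z V

theorem continuous_factored {ℓ : Mat n n → ℝ} (hℓ : ContDiff ℝ 2 ℓ) :
    Continuous (factored r ℓ) :=
  hℓ.continuous.comp (continuous_bilinear_diag (b := mulTranspose n r) norm_mulTranspose_le)

theorem hasDerivAt_factored_line {ℓ : Mat n n → ℝ} (hℓ : ContDiff ℝ 2 ℓ) (Z V : Mat n r) :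
    HasDerivAt (fun s : ℝ => factored r ℓ (Z + s • V)) (ip (matGrad (factored r ℓ) Z) V) 0 := by
  rw [← fderiv_eq_ip]
  exact hasDerivAt_comp_line
    (differentiable_comp_bilinear_diag (b := mulTranspose n r) norm_mulTranspose_le hℓ Z) V

theorem ip_tangent (G : Mat n n) (Z V : Mat n r) :
    ip G (tangent Z V) = ip ((G + G.transpose) * Z) V := by
  rw [tangent, ip_add_right, ip_mul_right' G V, ← ip_transpose G (Z * V.transpose),
    Matrix.transpose_mul, Matrix.transpose_transpose, ip_mul_right' G.transpose V,
    Matrix.transpose_transpose, Matrix.add_mul, ip_add_left]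
  ring

/-- The gradient of the factorized objective is `(𝒢 + 𝒢ᵀ) Z`. -/
theorem matGrad_factored {ℓ : Mat n n → ℝ} (hℓ : ContDiff ℝ 2 ℓ) (Z : Mat n r) :
    matGrad (factored r ℓ) Z = (score ℓ Z + (score ℓ Z).transpose) * Z := by
  refine ip_ext fun V => ?_
  rw [← fderiv_eq_ip, fderiv_factored hℓ, ← ip_tangent, score, ← fderiv_eq_ip]

theorem ip_matGrad_factored {ℓ : Mat n n → ℝ} (hℓ : ContDiff ℝ 2 ℓ) (Z V : Mat n r) :
    ip (matGrad (factored r ℓ) Z) V = fderiv ℝ ℓ (Z * Z.transpose) (tangent Z V) := by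
  rw [matGrad_factored hℓ, ← ip_tangent, fderiv_eq_ip, score]

theorem mul_orthogonal_mul_transpose (Z : Mat n r) {R : Mat r r}
    (hR : R ∈ Matrix.orthogonalGroup (Fin r) ℝ) :
    Z * R * (Z * R).transpose = Z * Z.transpose := by
  have h : R * R.transpose = 1 := (Matrix.mem_orthogonalGroup_iff _ _).1 hR
  rw [Matrix.transpose_mul, Matrix.mul_assoc, ← Matrix.mul_assoc R, h, Matrix.one_mul]

theorem factored_mul (ℓ : Mat n n → ℝ) (Z : Mat n r) {R : Mat r r}
    (hR : R ∈ Matrix.orthogonalGroup (Fin r) ℝ) : factored r ℓ (Z * R) = factored r ℓ Z := by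
  rw [factored, mul_orthogonal_mul_transpose Z hR, factored]

theorem matGrad_factored_mul {ℓ : Mat n n → ℝ} (hℓ : ContDiff ℝ 2 ℓ) (Z : Mat n r) {R : Mat r r}
    (hR : R ∈ Matrix.orthogonalGroup (Fin r) ℝ) :
    matGrad (factored r ℓ) (Z * R) = matGrad (factored r ℓ) Z * R := by
  rw [matGrad_factored hℓ, matGrad_factored hℓ, score, mul_orthogonal_mul_transpose Z hR,
    Matrix.mul_assoc, score]

/-- The mean value theorem for the gradient of the factorized objective. -/
theorem exists_ip_matGrad_sub_eq {ℓ : Mat n n → ℝ} (hℓ : ContDiff ℝ 2 ℓ) (Y D V : Mat n r) :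
    ∃ s ∈ Set.Ioo (0 : ℝ) 1,
      ip (matGrad (factored r ℓ) (Y + D) - matGrad (factored r ℓ) Y) V =
        matHess ℓ ((Y + s • D) * (Y + s • D).transpose) (tangent (Y + s • D) D)
          (tangent (Y + s • D) V) + ip (score ℓ (Y + s • D)) (tangent D V) := by
  have hd : ∀ s : ℝ, HasDerivAt (fun s : ℝ => ip (matGrad (factored r ℓ) (Y + s • D)) V)
      (matHess ℓ ((Y + s • D) * (Y + s • D).transpose) (tangent (Y + s • D) D)
          (tangent (Y + s • D) V) + ip (score ℓ (Y + s • D)) (tangent D V)) s := by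
    intro s
    simp only [ip_matGrad_factored hℓ]
    rw [score, ← fderiv_eq_ip]
    exact hasDerivAt_fderiv_bilinear_line (b := mulTranspose n r) norm_mulTranspose_le hℓ Y D V s
  obtain ⟨s, hs, h⟩ := exists_hasDerivAt_eq_slope _ _ (zero_lt_one' ℝ)
    (fun s _ => (hd s).continuousAt.continuousWithinAt) (fun s _ => hd s)
  refine ⟨s, hs, ?_⟩
  rw [h, ip_sub_left]
  simp

theorem matHess_add_left (ℓ : Mat n n → ℝ) (X A B C : Mat n n) :
    matHess ℓ X (A + B) C = matHess ℓ X A C + matHess ℓ X B C := by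
  simp [matHess]

theorem matHess_add_right (ℓ : Mat n n → ℝ) (X A B C : Mat n n) :
    matHess ℓ X A (B + C) = matHess ℓ X A B + matHess ℓ X A C := by
  simp [matHess]

theorem matHess_smul_left (ℓ : Mat n n → ℝ) (X A C : Mat n n) (c : ℝ) :
    matHess ℓ X (c • A) C = c * matHess ℓ X A C := by
  simp [matHess]

theorem matHess_smul_right (ℓ : Mat n n → ℝ) (X A C : Mat n n) (c : ℝ) :
    matHess ℓ X A (c • C) = c * matHess ℓ X A C := by
  simp [matHess]

theorem matHess_comm {ℓ : Mat n n → ℝ} (hℓ : ContDiff ℝ 2 ℓ) (X A B : Mat n n) :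
    matHess ℓ X A B = matHess ℓ X B A :=
  (hℓ.contDiffAt.isSymmSndFDerivAt (by simp)).eq A B

end LowRankGD

namespace LowRankGD

variable {m k n r : ℕ}

/-! ### The size of tangent matrices -/

theorem norm_tangent_le (Z W : Mat n r) : ‖tangent Z W‖ ≤ 2 * opNorm Z * ‖W‖ := by
  refine (norm_add_le _ _).trans ?_
  have h1 := norm_mul_le_opNorm Z W.transpose
  have h2 := norm_mul_le_opNorm' W Z.transpose
  rw [norm_transpose] at h1
  rw [opNorm_transpose] at h2
  linarith

theorem norm_tangent_sq (Z W : Mat n r) :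
    ‖tangent Z W‖ ^ 2 = 2 * ‖Z * W.transpose‖ ^ 2 + 2 * ip (Z * W.transpose) (W * Z.transpose) := by
  rw [tangent, norm_add_sq, ← norm_transpose (W * Z.transpose), Matrix.transpose_mul,
    Matrix.transpose_transpose]
  ring

theorem Conditioned.q_pos {Zs : Mat n r} {p q : ℝ} (hc : Conditioned Zs p q) : 0 < q :=
  zero_lt_one.trans_le hc.one_le_q

theorem Conditioned.radius_le {Zs : Mat n r} {p q : ℝ} (hc : Conditioned Zs p q) :
    p / (100 * q) ≤ p / 100 := by
  have := hc.one_le_q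
  have := hc.p_pos
  exact div_le_div_of_nonneg_left (by linarith) (by norm_num) (by linarith)

theorem Conditioned.opNorm_le {Zs Z : Mat n r} {p q : ℝ} (hc : Conditioned Zs p q)
    (hd : ‖Z - Zs‖ ≤ p / (100 * q)) : opNorm Z ≤ 101 / 100 * (q * p) := by
  have h1 := opNorm_add_le Zs (Z - Zs)
  rw [add_sub_cancel] at h1
  have h2 := opNorm_le_norm (Z - Zs)
  have h3 := hc.upper
  have h4 := hc.radius_le
  have h5 : p ≤ q * p := le_mul_of_one_le_left hc.p_pos.le hc.one_le_q
  linarith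

/-- At Z* the cross term ⟨Z* Dᵀ, D Z*ᵀ⟩ equals ‖Z*ᵀ D‖² when Z*ᵀ D is symmetric, so it only helps.
Some such condition is necessary: for skew A, the direction Z* A lies in the kernel of 𝒫_{Z*}. -/
theorem Conditioned.norm_tangent_sq_ge {Zs Z D : Mat n r} {p q : ℝ} (hc : Conditioned Zs p q)
    (hd : ‖Z - Zs‖ ≤ p / (100 * q)) (hD : (Zs.transpose * D).IsSymm) :
    19 / 10 * p ^ 2 * ‖D‖ ^ 2 ≤ ‖tangent Z D‖ ^ 2 := by
  have hp := hc.p_pos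
  have h1 : 2 * (p * ‖D‖) ^ 2 ≤ ‖tangent Zs D‖ ^ 2 := by
    rw [norm_tangent_sq]
    have h2 : 0 ≤ ip (Zs * D.transpose) (D * Zs.transpose) := by
      have hs : D.transpose * Zs = Zs.transpose * D := by
        have := hD.eq
        rwa [Matrix.transpose_mul, Matrix.transpose_transpose] at this
      rw [ip_mul_right', Matrix.transpose_transpose, Matrix.mul_assoc, hs, ip_comm, ip_mul_right,
        ip_self]
      positivity
    have h3 := hc.lower D.transpose
    rw [norm_transpose] at h3
    have h4 := pow_le_pow_left₀ (by positivity) h3 2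
    linarith
  have h5 : ‖tangent (Z - Zs) D‖ ≤ 1 / 50 * (p * ‖D‖) := by
    refine (norm_tangent_le _ _).trans ?_
    have := (opNorm_le_norm (Z - Zs)).trans (hd.trans hc.radius_le)
    calc 2 * opNorm (Z - Zs) * ‖D‖ ≤ 2 * (p / 100) * ‖D‖ := by gcongr
      _ = _ := by ring
  have h6 : ‖tangent Zs D‖ ≤ ‖tangent Z D‖ + ‖tangent (Z - Zs) D‖ := by
    have : tangent Z D = tangent (Z - Zs) D + tangent Zs D := by
      rw [← tangent_add_left, sub_add_cancel]
    have h7 : tangent Zs D = tangent Z D - tangent (Z - Zs) D := by rw [this]; abel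
    rw [h7]
    exact norm_sub_le _ _
  have h8 : 0 ≤ p * ‖D‖ := by positivity
  -- 7/5 lies below √2, and (7/5 - 1/50)² = 1.9044 still exceeds 19/10.
  have h9 : 7 / 5 * (p * ‖D‖) ≤ ‖tangent Zs D‖ := by
    apply le_of_sq_le_sq _ (norm_nonneg _)
    nlinarith
  have h10 : 69 / 50 * (p * ‖D‖) ≤ ‖tangent Z D‖ := by linarith
  have h11 := pow_le_pow_left₀ (by positivity) h10 2
  nlinarith

theorem ip_rowPart_transpose_nonneg (i : Fin n) (M : Mat n n) :
    0 ≤ ip (rowPart i M).transpose (rowPart i M) := by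
  rw [ip_eq_sum]
  refine Finset.sum_nonneg fun a _ => Finset.sum_nonneg fun b _ => ?_
  rw [Matrix.transpose_apply, rowPart_apply, rowPart_apply]
  split_ifs with h1 h2
  · rw [h1, h2]; exact mul_self_nonneg _
  all_goals simp

/-- A matrix with a single nonzero row needs no alignment: in the cross term a matrix supported on
row i meets its transpose, and only the square of the (i, i) entry survives. -/
theorem Conditioned.norm_tangent_rowPart_sq_ge {Zs Z : Mat n r} {p q : ℝ} (hc : Conditioned Zs p q)
    (hd : ‖Z - Zs‖ ≤ p / (100 * q)) (i : Fin n) (A : Mat n r) :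
    19 / 10 * p ^ 2 * ‖rowPart i A‖ ^ 2 ≤ ‖tangent Z (rowPart i A)‖ ^ 2 := by
  have hp := hc.p_pos
  set D := rowPart i A with hD
  rw [norm_tangent_sq]
  have h2 : 0 ≤ ip (Z * D.transpose) (D * Z.transpose) := by
    have h : Z * D.transpose = (rowPart i (A * Z.transpose)).transpose := by
      rw [rowPart_mul, Matrix.transpose_mul, Matrix.transpose_transpose]
    rw [h, hD, ← rowPart_mul]
    exact ip_rowPart_transpose_nonneg i _
  have h3 := hc.lower D.transpose
  rw [norm_transpose] at h3
  have h5 : ‖(Z - Zs) * D.transpose‖ ≤ 1 / 100 * (p * ‖D‖) := by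
    refine (norm_mul_le_opNorm _ _).trans ?_
    rw [norm_transpose]
    have := (opNorm_le_norm (Z - Zs)).trans (hd.trans hc.radius_le)
    calc opNorm (Z - Zs) * ‖D‖ ≤ (p / 100) * ‖D‖ := by gcongr
      _ = _ := by ring
  have h6 : ‖Zs * D.transpose‖ ≤ ‖Z * D.transpose‖ + ‖(Z - Zs) * D.transpose‖ := by
    have h7 : Zs * D.transpose = Z * D.transpose - (Z - Zs) * D.transpose := by
      rw [← Matrix.sub_mul, sub_sub_cancel]
    rw [h7]
    exact norm_sub_le _ _
  have h8 : 0 ≤ p * ‖D‖ := by positivity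
  have h10 : 99 / 100 * (p * ‖D‖) ≤ ‖Z * D.transpose‖ := by linarith
  have h11 := pow_le_pow_left₀ (by positivity) h10 2
  nlinarith

/-! ### Curvature along one gradient step -/

/-- Cauchy-Schwarz for the form `⟨U, V⟩ - τ ∇²ℓ[𝒫(U), 𝒫(V)]`. -/
theorem ip_sub_matHess_le {ℓ : Mat n n → ℝ} (hℓ : ContDiff ℝ 2 ℓ) {Z : Mat n r} {α β τ M c : ℝ}
    (hα : 0 ≤ α) (hβ : 0 ≤ β) (hτ : 0 ≤ τ) (hrip : LocalRIP ℓ {Z} α β) (hZ : opNorm Z ≤ M)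
    (hstep : τ * β * (4 * M ^ 2) ≤ 1) {U : Mat n r} (V : Mat n r)
    (hU : c * ‖U‖ ^ 2 ≤ ‖tangent Z U‖ ^ 2) (hc : τ * α * c ≤ 2) :
    ip U V - τ * matHess ℓ (Z * Z.transpose) (tangent Z U) (tangent Z V) ≤
      (1 - τ * α * c / 2) * (‖U‖ * ‖V‖) := by
  set H := matHess ℓ (Z * Z.transpose) with hH
  have hpsd : ∀ W : Mat n r, 0 ≤ ip W W - τ * H (tangent Z W) (tangent Z W) := by
    intro W
    have h1 := (hrip Z rfl W).2
    have h2 : ‖tangent Z W‖ ≤ 2 * M * ‖W‖ := (norm_tangent_le Z W).trans (by gcongr)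
    have h3 : τ * H (tangent Z W) (tangent Z W) ≤ τ * (β * (2 * M * ‖W‖) ^ 2) := by
      refine mul_le_mul_of_nonneg_left (h1.trans ?_) hτ
      gcongr
    have h4 : τ * (β * (2 * M * ‖W‖) ^ 2) ≤ 1 * ‖W‖ ^ 2 :=
      calc _ = τ * β * (4 * M ^ 2) * ‖W‖ ^ 2 := by ring
        _ ≤ _ := by gcongr
    rw [ip_self]
    linarith
  -- The form is nonnegative on x U + V for every x; the discriminant of this quadratic gives
  -- Cauchy-Schwarz.
  have hquad : ∀ x : ℝ, 0 ≤ (ip U U - τ * H (tangent Z U) (tangent Z U)) * (x * x) +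
      (2 * (ip U V - τ * H (tangent Z U) (tangent Z V))) * x +
      (ip V V - τ * H (tangent Z V) (tangent Z V)) := by
    intro x
    have h := hpsd (x • U + V)
    simp only [ip_add_left, ip_add_right, ip_smul_left, ip_smul_right, tangent_add_right,
      tangent_smul_right, hH, matHess_add_left, matHess_add_right, matHess_smul_left,
      matHess_smul_right] at h
    rw [matHess_comm hℓ _ (tangent Z V) (tangent Z U), ip_comm V U] at h
    rw [hH]
    linarith
  have hdisc := discrim_le_zero hquad
  rw [discrim] at hdisc
  have hUU : ip U U - τ * H (tangent Z U) (tangent Z U) ≤ (1 - τ * α * c) * ‖U‖ ^ 2 := by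
    have h1 := (hrip Z rfl U).1
    have h2 : τ * (α * (c * ‖U‖ ^ 2)) ≤ τ * H (tangent Z U) (tangent Z U) := by
      refine mul_le_mul_of_nonneg_left (le_trans ?_ h1) hτ
      gcongr
    rw [ip_self]
    linarith
  -- No lower bound on 𝒫(V) proportional to ‖V‖ is available: V will come from gradient steps, which
  -- need not be aligned. Nonnegative curvature is enough here.
  have hVV : ip V V - τ * H (tangent Z V) (tangent Z V) ≤ ‖V‖ ^ 2 := by
    have h1 := (hrip Z rfl V).1
    have h2 : 0 ≤ τ * H (tangent Z V) (tangent Z V) :=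
      mul_nonneg hτ (le_trans (by positivity) h1)
    rw [ip_self]
    linarith
  refine le_of_sq_le_sq ?_ (mul_nonneg (by linarith) (by positivity))
  have h5 : (ip U U - τ * H (tangent Z U) (tangent Z U)) *
      (ip V V - τ * H (tangent Z V) (tangent Z V)) ≤ (1 - τ * α * c) * ‖U‖ ^ 2 * ‖V‖ ^ 2 :=
    mul_le_mul hUU hVV (hpsd V) ((hpsd U).trans hUU)
  -- This is √(1 - y) ≤ 1 - y/2 in squared form, with y = τ α c.
  have h6 : (1 - τ * α * c) * ‖U‖ ^ 2 * ‖V‖ ^ 2 ≤ ((1 - τ * α * c / 2) * (‖U‖ * ‖V‖)) ^ 2 := by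
    have : ((1 - τ * α * c / 2) * (‖U‖ * ‖V‖)) ^ 2 - (1 - τ * α * c) * ‖U‖ ^ 2 * ‖V‖ ^ 2 =
      (τ * α * c / 2) ^ 2 * (‖U‖ * ‖V‖) ^ 2 := by ring
    have h7 : 0 ≤ (τ * α * c / 2) ^ 2 * (‖U‖ * ‖V‖) ^ 2 := by positivity
    linarith
  linarith

/-- One gradient step of length `τ` on the factorized objective. -/
noncomputable def gradStep (ℓ : Mat n n → ℝ) (τ : ℝ) (Z : Mat n r) : Mat n r :=
  Z - τ • matGrad (factored r ℓ) Z

/-- Regularity of a loss on a convex set of points which are aligned with `Z*` and near it. -/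
structure SliceRegular (ℓ : Mat n n → ℝ) (Zs : Mat n r) (K : Set (Mat n r)) (α β p q : ℝ) :
    Prop where
  cond : Conditioned Zs p q
  alpha_pos : 0 < α
  alpha_le : α ≤ β
  smooth : ContDiff ℝ 2 ℓ
  convex : Convex ℝ K
  base : Zs ∈ K
  aligned : ∀ Z ∈ K, IsAlignment Z Zs 1
  near : ∀ Z ∈ K, ‖Z - Zs‖ ≤ p / (100 * q)
  rip : LocalRIP ℓ K α β
  score_le : ∀ Z ∈ K, opNorm (score ℓ Z) ≤ α * p ^ 2 / 100

/-- Step lengths for which the gradient step is a contraction. -/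
structure StepLength (α β p q τ : ℝ) : Prop where
  nonneg : 0 ≤ τ
  le : τ * (10 * (α + β) * q ^ 2 * p ^ 2) ≤ 1

/-! ### Contraction of the gradient step in Frobenius norm. -/

section Slice

variable {ℓ : Mat n n → ℝ} {Zs : Mat n r} {K : Set (Mat n r)} {α β p q τ : ℝ}

theorem SliceRegular.beta_pos (h : SliceRegular ℓ Zs K α β p q) : 0 < β :=
  h.alpha_pos.trans_le h.alpha_le

/-- This makes the form ‖W‖² - τ ∇²ℓ[𝒫(W), 𝒫(W)] nonnegative, since ‖𝒫_Z(W)‖ ≤ 2 ‖Z‖ ‖W‖ in operator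
norm of Z. The factor 10 of the step size exceeds 4 · 1.01². -/
theorem SliceRegular.step_beta_le (h : SliceRegular ℓ Zs K α β p q) (hτ : StepLength α β p q τ) :
    τ * β * (4 * (101 / 100 * (q * p)) ^ 2) ≤ 1 := by
  have h1 := hτ.le
  have h2 : 0 ≤ τ * α * (q ^ 2 * p ^ 2) :=
    mul_nonneg (mul_nonneg hτ.nonneg h.alpha_pos.le) (by positivity)
  have h3 : 0 ≤ τ * β * (q ^ 2 * p ^ 2) :=
    mul_nonneg (mul_nonneg hτ.nonneg h.beta_pos.le) (by positivity)
  nlinarith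

theorem SliceRegular.step_alpha_nonneg (h : SliceRegular ℓ Zs K α β p q)
    (hτ : StepLength α β p q τ) : 0 ≤ τ * α * p ^ 2 :=
  mul_nonneg (mul_nonneg hτ.nonneg h.alpha_pos.le) (by positivity)

theorem SliceRegular.step_alpha_le (h : SliceRegular ℓ Zs K α β p q) (hτ : StepLength α β p q τ) :
    τ * α * p ^ 2 ≤ 1 / 20 := by
  have h1 := hτ.le
  have h2 : 1 ≤ q ^ 2 := one_le_pow₀ h.cond.one_le_q
  have h3 : 0 ≤ τ * p ^ 2 := mul_nonneg hτ.nonneg (by positivity)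
  have h4 : τ * p ^ 2 * (20 * α) ≤ τ * p ^ 2 * (10 * (α + β) * q ^ 2) := by
    refine mul_le_mul_of_nonneg_left ?_ h3
    have := h.alpha_le
    have := h.alpha_pos
    nlinarith
  nlinarith

theorem SliceRegular.ip_sub_matHess_le (h : SliceRegular ℓ Zs K α β p q)
    (hτ : StepLength α β p q τ) {Z : Mat n r} (hZ : Z ∈ K) {U : Mat n r} (V : Mat n r)
    (hU : 19 / 10 * p ^ 2 * ‖U‖ ^ 2 ≤ ‖tangent Z U‖ ^ 2) :
    ip U V - τ * matHess ℓ (Z * Z.transpose) (tangent Z U) (tangent Z V) ≤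
      (1 - 19 / 20 * (τ * α * p ^ 2)) * (‖U‖ * ‖V‖) := by
  have h1 := LowRankGD.ip_sub_matHess_le h.smooth h.alpha_pos.le h.beta_pos.le hτ.nonneg
    (fun Y hY => by rw [Set.mem_singleton_iff.1 hY]; exact h.rip Z hZ)
    (h.cond.opNorm_le (h.near Z hZ)) (h.step_beta_le hτ) V hU
    (by linarith [h.step_alpha_le hτ])
  convert h1 using 3
  ring

/-- The gradient step is a contraction on the slice. -/
theorem SliceRegular.norm_gradStep_sub_le (h : SliceRegular ℓ Zs K α β p q)
    (hτ : StepLength α β p q τ) {Y Z : Mat n r} (hY : Y ∈ K) (hZ : Z ∈ K) :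
    ‖gradStep ℓ τ Z - gradStep ℓ τ Y‖ ≤ (1 - τ * α * p ^ 2 / 2) * ‖Z - Y‖ := by
  set D := Z - Y with hD
  set g := matGrad (factored r ℓ) Z - matGrad (factored r ℓ) Y with hg
  set V := D - τ • g with hV
  have hVe : gradStep ℓ τ Z - gradStep ℓ τ Y = V := by
    rw [hV, hg, hD, gradStep, gradStep, smul_sub]; abel
  rw [hVe]
  -- There is no mean value theorem for the vector-valued gradient; pairing it with V itself
  -- suffices, because ⟨D - τ g, V⟩ = ‖V‖².
  obtain ⟨s, hs, hmv⟩ := exists_ip_matGrad_sub_eq h.smooth Y D V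
  rw [show Y + D = Z by rw [hD]; abel, ← hg] at hmv
  have hsK : Y + s • D ∈ K := h.convex.add_smul_sub_mem hY hZ ⟨hs.1.le, hs.2.le⟩
  set S := Y + s • D with hS
  have hsymm : (Zs.transpose * D).IsSymm := by
    have h1 := (h.aligned Z hZ).isSymm.transpose.eq
    have h2 := (h.aligned Y hY).isSymm.transpose.eq
    simp only [Matrix.transpose_mul, Matrix.transpose_transpose] at h1 h2
    rw [Matrix.IsSymm, hD, Matrix.mul_sub, Matrix.transpose_sub, Matrix.transpose_mul,
      Matrix.transpose_mul, Matrix.transpose_transpose, h1, h2]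
  have hB := h.ip_sub_matHess_le hτ hsK V (h.cond.norm_tangent_sq_ge (h.near S hsK) hsymm)
  have hE : |ip (score ℓ S) (tangent D V)| ≤ 2 * (α * p ^ 2 / 100) * (‖D‖ * ‖V‖) := by
    rw [tangent, ip_add_right]
    have h1 := abs_ip_mul_transpose_le (score ℓ S) D V
    have h2 := abs_ip_mul_transpose_le (score ℓ S) V D
    have h3 := mul_le_mul_of_nonneg_right (h.score_le S hsK)
      (mul_nonneg (norm_nonneg D) (norm_nonneg V))
    refine (abs_add_le _ _).trans ?_
    nlinarith
  have hVV : ‖V‖ ^ 2 = ip D V - τ * ip g V := by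
    rw [← ip_self, ← ip_smul_left, ← ip_sub_left]
  have h1 : ‖V‖ * ‖V‖ ≤ ‖V‖ * ((1 - τ * α * p ^ 2 / 2) * ‖D‖) := by
    have h2 : -(τ * ip (score ℓ S) (tangent D V)) ≤
        τ * (2 * (α * p ^ 2 / 100) * (‖D‖ * ‖V‖)) := by
      rw [← mul_neg]
      exact mul_le_mul_of_nonneg_left ((neg_le_abs _).trans hE) hτ.nonneg
    have h3 : 0 ≤ τ * α * p ^ 2 * (‖D‖ * ‖V‖) :=
      mul_nonneg (h.step_alpha_nonneg hτ) (by positivity)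
    rw [hmv] at hVV
    nlinarith
  rcases eq_or_lt_of_le (norm_nonneg V) with h0 | h0
  · rw [← h0]
    exact mul_nonneg (by linarith [h.step_alpha_le hτ]) (norm_nonneg _)
  · exact le_of_mul_le_mul_left h1 h0

theorem SliceRegular.norm_matGrad_base_le (h : SliceRegular ℓ Zs K α β p q) {N : ℝ}
    (hN : opNorm (score ℓ Zs) ≤ N) : ‖matGrad (factored r ℓ) Zs‖ ≤ 2 * N * ‖Zs‖ := by
  rw [matGrad_factored h.smooth]
  refine (norm_mul_le_opNorm _ _).trans (mul_le_mul_of_nonneg_right ?_ (norm_nonneg _))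
  have := opNorm_add_le (score ℓ Zs) (score ℓ Zs).transpose
  rw [opNorm_transpose] at this
  linarith

/-- The Frobenius error after one gradient step. -/
theorem SliceRegular.norm_gradStep_sub_base_le (h : SliceRegular ℓ Zs K α β p q)
    (hτ : StepLength α β p q τ) {N : ℝ} (hN : opNorm (score ℓ Zs) ≤ N) {Z : Mat n r} (hZ : Z ∈ K) :
    ‖gradStep ℓ τ Z - Zs‖ ≤ (1 - τ * α * p ^ 2 / 2) * ‖Z - Zs‖ + τ * (2 * N) * ‖Zs‖ := by
  have h1 := h.norm_gradStep_sub_le hτ h.base hZ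
  have h2 := h.norm_matGrad_base_le hN
  have h3 : gradStep ℓ τ Z - Zs =
      (gradStep ℓ τ Z - gradStep ℓ τ Zs) - τ • matGrad (factored r ℓ) Zs := by
    simp only [gradStep]; abel
  rw [h3]
  refine (norm_sub_le _ _).trans ?_
  rw [norm_smul, Real.norm_eq_abs, abs_of_nonneg hτ.nonneg]
  have h4 := mul_le_mul_of_nonneg_left h2 hτ.nonneg
  linarith

end Slice

end LowRankGD

/-! ### Contraction of single rows, and the effect of realignment. -/

namespace LowRankGD

variable {m k n r : ℕ}

theorem norm_sub_rowPart_le (i : Fin n) (D : Mat n r) : ‖D - rowPart i D‖ ≤ ‖D‖ := by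
  apply le_of_sq_le_sq _ (norm_nonneg _)
  rw [norm_sub_sq, ip_comm, ← ip_rowPart_rowPart, ip_self]
  nlinarith [sq_nonneg ‖rowPart i D‖]

theorem rowNorm_mul_transpose_sub_le (Z Zs : Mat n r) :
    rowNorm (Z * Z.transpose - Zs * Zs.transpose) ≤
      rowNorm (Z - Zs) * opNorm Z + rowNorm Zs * ‖Z - Zs‖ := by
  have h : Z * Z.transpose - Zs * Zs.transpose =
      (Z - Zs) * Z.transpose + Zs * (Z - Zs).transpose := by
    rw [Matrix.transpose_sub, Matrix.sub_mul, Matrix.mul_sub]; abel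
  rw [h]
  refine (rowNorm_add_le _ _).trans (add_le_add ?_ ?_)
  · have := rowNorm_mul_le (Z - Zs) Z.transpose
    rwa [opNorm_transpose] at this
  · refine (rowNorm_mul_le _ _).trans (mul_le_mul_of_nonneg_left ?_ (rowNorm_nonneg _))
    rw [opNorm_transpose]
    exact opNorm_le_norm _

/-- Row-wise regularity of a loss on a slice, with mean gradient map `G`. -/
structure RowRegular (ℓ : Mat n n → ℝ) (Zs : Mat n r) (K : Set (Mat n r)) (α β p q : ℝ)
    (G : Mat n r → Mat n n) (Λ : ℝ) : Prop extends SliceRegular ℓ Zs K α β p q where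
  symm : ∀ Z ∈ K, (score ℓ Z).IsSymm
  cross : RowCrossCurvature ℓ K β
  row_near : ∀ Z ∈ K, rowNorm (Z - Zs) ≤ rowNorm Zs
  lip_nonneg : 0 ≤ Λ
  mean_le : ∀ Z ∈ K, rowNorm (G Z) ≤ Λ * rowNorm (Z * Z.transpose - Zs * Zs.transpose)
  noise_le : ∀ Z ∈ K, maxRowSum (score ℓ Z - G Z) ≤ α * p ^ 2 / 4
  lip_near : ∀ Z ∈ K, Λ * (q * p * ‖Z - Zs‖) ≤ α * p ^ 2 / 100

section Row

variable {ℓ : Mat n n → ℝ} {Zs : Mat n r} {K : Set (Mat n r)} {α β p q τ Λ : ℝ}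
  {G : Mat n r → Mat n n}

theorem RowRegular.rowNorm_mean_le (h : RowRegular ℓ Zs K α β p q G Λ) {D : Mat n r} {s : ℝ}
    (hs : s ∈ Set.Ioo (0 : ℝ) 1) (hS : Zs + s • D ∈ K) :
    rowNorm (G (Zs + s • D)) ≤
      Λ * (rowNorm D * (101 / 100 * (q * p)) + rowNorm Zs * ‖D‖) := by
  refine (h.mean_le _ hS).trans (mul_le_mul_of_nonneg_left ?_ h.lip_nonneg)
  refine (rowNorm_mul_transpose_sub_le _ _).trans ?_
  rw [add_sub_cancel_left, rowNorm_smul, norm_smul, Real.norm_eq_abs, abs_of_pos hs.1]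
  have h1 : s * rowNorm D ≤ rowNorm D := mul_le_of_le_one_left (rowNorm_nonneg _) hs.2.le
  have h2 : s * ‖D‖ ≤ ‖D‖ := mul_le_of_le_one_left (norm_nonneg _) hs.2.le
  have h3 := h.cond.opNorm_le (h.near _ hS)
  have h4 := rowNorm_nonneg Zs
  have h5 := rowNorm_nonneg D
  have h6 := opNorm_nonneg (Zs + s • D)
  gcongr

/-- The influence of the other rows of D on row i: `RowCrossCurvature` applies because row i of D -
`rowPart i D` vanishes. The price is the full Frobenius norm of D, the source of the coupling
between the two errors. -/
theorem RowRegular.abs_cross_le (h : RowRegular ℓ Zs K α β p q G Λ) {S : Mat n r} (hS : S ∈ K)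
    (i : Fin n) (V D : Mat n r) :
    |matHess ℓ (S * S.transpose) (tangent S (D - rowPart i D)) (tangent S (rowPart i V))| ≤
      β * (2 * rowNorm Zs * ‖rowPart i V‖) * (101 / 100 * (q * p) * ‖D‖) := by
  rw [matHess_comm h.smooth]
  have hz : ∀ j, (D - rowPart i D) i j = 0 := fun j => by
    rw [Matrix.sub_apply, rowPart_apply, if_pos rfl, sub_self]
  have h1 := h.cross S hS i (V i) (D - rowPart i D) hz
  rw [← norm_rowPart, ← norm_rowPart] at h1
  refine h1.trans ?_
  have h2 : ‖rowPart i S‖ ≤ 2 * rowNorm Zs := by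
    have h3 := rowNorm_add_le (S - Zs) Zs
    rw [sub_add_cancel] at h3
    linarith [norm_rowPart_le_rowNorm i S, h.row_near S hS]
  have h3 := h.cond.opNorm_le (h.near S hS)
  have h4 := norm_sub_rowPart_le i D
  have h5 := h.beta_pos
  have h6 := rowNorm_nonneg Zs
  have h7 : 0 ≤ opNorm S := opNorm_nonneg S
  have h8 : 0 ≤ 101 / 100 * (q * p) := h7.trans h3
  gcongr

/-- Symmetry of the score reduces the pairing to twice that with H Dᵀ, which is supported on row i.
The mean part is paired with one row of G in Frobenius norm, the noise part with its row sums. -/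
theorem RowRegular.abs_score_le (h : RowRegular ℓ Zs K α β p q G Λ) {D : Mat n r} {s : ℝ}
    (hs : s ∈ Set.Ioo (0 : ℝ) 1) (hS : Zs + s • D ∈ K) (i : Fin n) (V : Mat n r) :
    |ip (score ℓ (Zs + s • D)) (tangent D (rowPart i V))| ≤
      2 * (Λ * (rowNorm D * (101 / 100 * (q * p)) + rowNorm Zs * ‖D‖) * ‖D‖ +
        α * p ^ 2 / 4 * rowNorm D) * ‖rowPart i V‖ := by
  set S := Zs + s • D
  set H := rowPart i V with hH
  have hsym : ip (score ℓ S) (tangent D H) = 2 * ip (score ℓ S) (H * D.transpose) := by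
    rw [tangent, ip_add_right, ← ip_transpose (score ℓ S) (D * H.transpose), (h.symm S hS).eq,
      Matrix.transpose_mul, Matrix.transpose_transpose]
    ring
  have hsplit : ip (score ℓ S) (H * D.transpose) =
      ip (rowPart i (G S)) (H * D.transpose) + ip (score ℓ S - G S) (H * D.transpose) := by
    rw [ip_rowPart, hH, rowPart_mul, rowPart_rowPart, ← ip_add_left, add_sub_cancel]
  have h1 : |ip (rowPart i (G S)) (H * D.transpose)| ≤
      Λ * (rowNorm D * (101 / 100 * (q * p)) + rowNorm Zs * ‖D‖) * ‖D‖ * ‖H‖ := by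
    refine (abs_ip_le _ _).trans ?_
    have h2 : ‖H * D.transpose‖ ≤ ‖D‖ * ‖H‖ := by
      refine (Matrix.frobenius_norm_mul _ _).trans_eq ?_
      rw [norm_transpose, mul_comm]
    have h3 := (norm_rowPart_le_rowNorm i (G S)).trans (h.rowNorm_mean_le hs hS)
    rw [mul_assoc]
    exact mul_le_mul h3 h2 (norm_nonneg _) ((norm_nonneg _).trans h3)
  have h2 : |ip (score ℓ S - G S) (H * D.transpose)| ≤ α * p ^ 2 / 4 * rowNorm D * ‖H‖ := by
    refine (abs_ip_le_maxRowSum _ i V D).trans ?_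
    have h3 := h.noise_le S hS
    have h4 := rowNorm_nonneg D
    gcongr
  rw [hsym, hsplit, abs_mul, abs_two]
  have h3 := abs_add_le (ip (rowPart i (G S)) (H * D.transpose))
    (ip (score ℓ S - G S) (H * D.transpose))
  linarith

/-- Contraction of a single row of the error, up to the Frobenius error. -/
theorem RowRegular.norm_rowPart_gradStep_sub_le (h : RowRegular ℓ Zs K α β p q G Λ)
    (hτ : StepLength α β p q τ) {Y : Mat n r} (hY : Y ∈ K) (i : Fin n) :
    ‖rowPart i (gradStep ℓ τ Y - gradStep ℓ τ Zs)‖ ≤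
      (1 - 2 / 5 * (τ * α * p ^ 2)) * rowNorm (Y - Zs) +
        τ * (102 / 50 * (β * (q * p) * ‖Y - Zs‖)) * rowNorm Zs := by
  set D := Y - Zs with hD
  set g := matGrad (factored r ℓ) Y - matGrad (factored r ℓ) Zs with hg
  set V := D - τ • g with hV
  have hVe : gradStep ℓ τ Y - gradStep ℓ τ Zs = V := by
    rw [hV, hg, hD, gradStep, gradStep, smul_sub]; abel
  rw [hVe]
  set H := rowPart i V with hH
  obtain ⟨s, hs, hmv⟩ := exists_ip_matGrad_sub_eq h.smooth Zs D H
  rw [show Zs + D = Y by rw [hD]; abel, ← hg] at hmv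
  have hsK : Zs + s • D ∈ K := h.convex.add_smul_sub_mem h.base hY ⟨hs.1.le, hs.2.le⟩
  have hE := h.abs_score_le hs hsK i V
  have hX := h.abs_cross_le hsK i V D
  set S := Zs + s • D with hS
  rw [← hH] at hE hX
  have hB := h.ip_sub_matHess_le hτ hsK H
    (h.cond.norm_tangent_rowPart_sq_ge (h.near S hsK) i D)
  have hHH : ‖H‖ ^ 2 = ip (rowPart i D) H - τ * ip g H := by
    rw [ip_rowPart, hH, rowPart_rowPart, ← ip_smul_left, ← ip_sub_left, ← hV, ← ip_rowPart,
      ← ip_rowPart_rowPart, ip_self]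
  -- The i-th row of D carries the contraction; the remaining rows are an error term.
  have hsplit : matHess ℓ (S * S.transpose) (tangent S D) (tangent S H) =
      matHess ℓ (S * S.transpose) (tangent S (rowPart i D)) (tangent S H) +
      matHess ℓ (S * S.transpose) (tangent S (D - rowPart i D)) (tangent S H) := by
    rw [← matHess_add_left, ← tangent_add_right, add_sub_cancel]
  rw [hmv, hsplit] at hHH
  have hτ0 := hτ.nonneg
  have hα := h.alpha_pos
  have hβ := h.beta_pos
  have hp := h.cond.p_pos
  have hq := h.cond.q_pos
  have hw := rowNorm_nonneg D
  have hζ := rowNorm_nonneg Zs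
  have hu := norm_nonneg D
  have hHn := norm_nonneg H
  have hwi := norm_rowPart_le_rowNorm i D
  have hlip := h.lip_near Y hY
  rw [← hD] at hlip
  have hy := h.step_alpha_nonneg hτ
  have hy1 := h.step_alpha_le hτ
  set w := rowNorm D
  set u := ‖D‖
  set ζ := rowNorm Zs
  have e1 := mul_le_mul_of_nonneg_left ((neg_le_abs _).trans hX) hτ0
  have e2 := mul_le_mul_of_nonneg_left ((neg_le_abs _).trans hE) hτ0
  have e3 : (1 - 19 / 20 * (τ * α * p ^ 2)) * (‖rowPart i D‖ * ‖H‖) ≤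
      (1 - 19 / 20 * (τ * α * p ^ 2)) * (w * ‖H‖) := by
    refine mul_le_mul_of_nonneg_left ?_ (by linarith)
    gcongr
  have e4 : Λ * u ≤ β * (q * p) / 100 := by
    have h1 : Λ * u * (q * p) ≤ β * (q * p) / 100 * (q * p) := by
      have h2 : α * p ^ 2 ≤ β * (q * p) * (q * p) := by
        have h3 := h.alpha_le
        have h4 : p ≤ q * p := le_mul_of_one_le_left hp.le h.cond.one_le_q
        calc α * p ^ 2 = α * p * p := by ring
          _ ≤ β * (q * p) * (q * p) := by gcongr
      linarith
    exact le_of_mul_le_mul_right h1 (by positivity)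
  have e5 : τ * (Λ * (w * (101 / 100 * (q * p)) + ζ * u) * u) ≤
      101 / 10000 * (τ * α * p ^ 2) * w + τ * (1 / 100 * (β * (q * p) * u)) * ζ := by
    have h1 : Λ * (w * (101 / 100 * (q * p)) + ζ * u) * u ≤
        101 / 10000 * (α * p ^ 2) * w + 1 / 100 * (β * (q * p) * u) * ζ := by
      have h2 := mul_le_mul_of_nonneg_left hlip hw
      have h3 := mul_le_mul_of_nonneg_left e4 (mul_nonneg hζ hu)
      linarith
    have h2 := mul_le_mul_of_nonneg_left h1 hτ0
    linarith
  -- In units of τ α p² w ‖H‖, curvature gives 19/20, the noise takes 1/2 and the mean score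
  -- 202/10000, leaving more than 2/5. The terms in β q p u add up to 2.02 + 0.02 = 102/50.
  have h1 : ‖H‖ * ‖H‖ ≤ ‖H‖ * ((1 - 2 / 5 * (τ * α * p ^ 2)) * w +
        τ * (102 / 50 * (β * (q * p) * u)) * ζ) := by
    have h6 := mul_le_mul_of_nonneg_right e5 hHn
    have h7 : 0 ≤ τ * α * p ^ 2 * w * ‖H‖ := by positivity
    rw [← sq]
    linarith
  rcases eq_or_lt_of_le hHn with h0 | h0
  · rw [← h0]
    exact add_nonneg (mul_nonneg (by linarith) hw) (by positivity)
  · exact le_of_mul_le_mul_left h1 h0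

/-- The change of alignment caused by one gradient step is of second order. -/
theorem SliceRegular.norm_alignment_sub_one_le (h : SliceRegular ℓ Zs K α β p q)
    (hτ : StepLength α β p q τ) {Y : Mat n r} (hY : Y ∈ K)
    (hd : ‖gradStep ℓ τ Y - Zs‖ ≤ p / (100 * q)) {Q : Mat r r}
    (hQ : IsAlignment (gradStep ℓ τ Y) Zs Q) :
    ‖Q - 1‖ ≤ τ * (1 / 20 * (β * (q * p) * ‖Y - Zs‖)) := by
  have h1 := hQ.norm_sub_one_le h.cond hd
  set D := Y - Zs with hD
  set A := score ℓ Y + (score ℓ Y).transpose with hA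
  have hAs : A.transpose = A := by
    rw [hA, Matrix.transpose_add, Matrix.transpose_transpose, add_comm]
  have hYs : Y.transpose * Zs = Zs.transpose * Y := by
    have := (h.aligned Y hY).isSymm.transpose.eq
    simpa using this
  have hZs : Zs = Y - D := by rw [hD]; abel
  -- Since Y is aligned and A is symmetric, the terms Yᵀ Z* and Yᵀ A Y cancel in the skew part;
  -- replacing Z* by Y - D leaves only Yᵀ A D, a product of score and error.
  have hN : (gradStep ℓ τ Y).transpose * Zs - Zs.transpose * gradStep ℓ τ Y =
      τ • (Y.transpose * (A * D) - (Y.transpose * (A * D)).transpose) := by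
    have e1 : (A * Y).transpose * Zs =
        Y.transpose * (A * Y) - Y.transpose * (A * D) := by
      rw [Matrix.transpose_mul, hAs, Matrix.mul_assoc, ← Matrix.mul_sub, ← Matrix.mul_sub, ← hZs]
    have e2 : Zs.transpose * (A * Y) =
        Y.transpose * (A * Y) - (Y.transpose * (A * D)).transpose := by
      rw [Matrix.transpose_mul, Matrix.transpose_mul, Matrix.transpose_transpose, hAs,
        Matrix.mul_assoc, ← Matrix.sub_mul, ← Matrix.transpose_sub, ← hZs]
    rw [gradStep, matGrad_factored h.smooth, ← hA, Matrix.transpose_sub, Matrix.transpose_smul,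
      Matrix.sub_mul, Matrix.mul_sub, hYs, Matrix.smul_mul, Matrix.mul_smul, e1, e2,
      smul_sub, smul_sub, smul_sub]
    abel
  have hτ0 := hτ.nonneg
  have hp := h.cond.p_pos
  have hq := h.cond.q_pos
  have hα := h.alpha_pos
  have h2 : ‖Y.transpose * (A * D)‖ ≤ 101 / 100 * (q * p) * (2 * (α * p ^ 2 / 100) * ‖D‖) := by
    have h3 := h.cond.opNorm_le (h.near Y hY)
    have h4 : opNorm A ≤ 2 * (α * p ^ 2 / 100) := by
      have := opNorm_add_le (score ℓ Y) (score ℓ Y).transpose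
      rw [opNorm_transpose] at this
      linarith [h.score_le Y hY]
    refine (norm_mul_le_opNorm _ _).trans ?_
    rw [opNorm_transpose]
    have h5 : ‖A * D‖ ≤ 2 * (α * p ^ 2 / 100) * ‖D‖ :=
      (norm_mul_le_opNorm _ _).trans (by gcongr)
    exact mul_le_mul h3 h5 (norm_nonneg _) (by positivity)
  have h3 : ‖(gradStep ℓ τ Y).transpose * Zs - Zs.transpose * gradStep ℓ τ Y‖ ≤
      τ * (2 * (101 / 100 * (q * p) * (2 * (α * p ^ 2 / 100) * ‖D‖))) := by
    rw [hN, norm_smul, Real.norm_eq_abs, abs_of_nonneg hτ0]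
    refine mul_le_mul_of_nonneg_left ((norm_sub_le _ _).trans ?_) hτ0
    rw [norm_transpose]
    linarith
  have h4 : 99 / 100 * p ^ 2 * ‖Q - 1‖ ≤
      99 / 100 * p ^ 2 * (τ * (1 / 20 * (β * (q * p) * ‖D‖))) := by
    have h5 : 0 ≤ τ * p ^ 2 * (q * p) * ‖D‖ := by positivity
    have h6 := mul_le_mul_of_nonneg_right h.alpha_le h5
    have h7 : 0 ≤ α * (τ * p ^ 2 * (q * p) * ‖D‖) := by positivity
    linarith
  exact le_of_mul_le_mul_left h4 (by positivity)

/-- The row-wise error after one gradient step and realignment. -/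
theorem RowRegular.rowNorm_gradStep_mul_sub_le (h : RowRegular ℓ Zs K α β p q G Λ)
    (hτ : StepLength α β p q τ) {N : ℝ} (hN : rowNorm (score ℓ Zs * Zs) ≤ N * rowNorm Zs)
    {Y : Mat n r} (hY : Y ∈ K) (hd : ‖gradStep ℓ τ Y - Zs‖ ≤ p / (100 * q)) {Q : Mat r r}
    (hQ : IsAlignment (gradStep ℓ τ Y) Zs Q) :
    rowNorm (gradStep ℓ τ Y * Q - Zs) ≤
      (1 - 2 / 5 * (τ * α * p ^ 2)) * rowNorm (Y - Zs) +
        τ * (3 * (β * (q * p) * ‖Y - Zs‖) + 2 * N) * rowNorm Zs := by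
  have hτ0 := hτ.nonneg
  have hζ := rowNorm_nonneg Zs
  have hQ1 := h.norm_alignment_sub_one_le hτ hY hd hQ
  have hbase : rowNorm (gradStep ℓ τ Zs - Zs) ≤ τ * (2 * N) * rowNorm Zs := by
    have h1 : gradStep ℓ τ Zs - Zs = (-(2 * τ)) • (score ℓ Zs * Zs) := by
      rw [gradStep, matGrad_factored h.smooth, (h.symm Zs h.base).eq, ← two_smul ℝ (score ℓ Zs),
        Matrix.smul_mul, smul_smul, sub_sub_cancel_left, ← neg_smul, mul_comm]
    rw [h1, rowNorm_smul, abs_neg, abs_of_nonneg (by positivity)]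
    have := mul_le_mul_of_nonneg_left hN hτ0
    linarith
  have hrow : rowNorm (gradStep ℓ τ Y - gradStep ℓ τ Zs) ≤
      (1 - 2 / 5 * (τ * α * p ^ 2)) * rowNorm (Y - Zs) +
        τ * (102 / 50 * (β * (q * p) * ‖Y - Zs‖)) * rowNorm Zs := by
    refine rowNorm_le ?_ fun i => h.norm_rowPart_gradStep_sub_le hτ hY i
    have := h.step_alpha_le hτ
    have := h.cond.p_pos
    have := h.cond.q_pos
    have := h.beta_pos
    exact add_nonneg (mul_nonneg (by linarith) (rowNorm_nonneg _)) (by positivity)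
  -- Q preserves row norms, so realignment costs only Z* (Q - 1). The coefficients 102/50 + 1/20 are
  -- rounded up to 3.
  have hsplit : gradStep ℓ τ Y * Q - Zs =
      ((gradStep ℓ τ Y - gradStep ℓ τ Zs) + (gradStep ℓ τ Zs - Zs)) * Q + Zs * (Q - 1) := by
    rw [sub_add_sub_cancel, Matrix.sub_mul, Matrix.mul_sub, Matrix.mul_one]; abel
  rw [hsplit]
  refine (rowNorm_add_le _ _).trans ?_
  rw [rowNorm_mul_orthogonal _ hQ.1]
  have h1 := rowNorm_add_le (gradStep ℓ τ Y - gradStep ℓ τ Zs) (gradStep ℓ τ Zs - Zs)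
  have h2 := (rowNorm_mul_le Zs (Q - 1)).trans
    (mul_le_mul_of_nonneg_left ((opNorm_le_norm _).trans hQ1) hζ)
  have h3 : 0 ≤ τ * (β * (q * p) * ‖Y - Zs‖) * rowNorm Zs := by
    have := h.cond.p_pos
    have := h.cond.q_pos
    have := h.beta_pos
    positivity
  linarith

end Row

end LowRankGD

namespace LowRankGD

variable {m k n r : ℕ}

/-! ### Comparison of the curvature and Lipschitz constants -/

/-- The direction Z* e eᵀ changes the Gram matrix by multiples of M = (Z* e)(Z* e)ᵀ. As M has rank
one, it pairs with an operator norm bound without a factor depending on r. -/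
theorem exists_unit_eigenvector (Zs : Mat n r) (hr : 1 ≤ r) :
    ∃ (e : Mat r 1) (c : ℝ), e.transpose * e = 1 ∧ Zs.transpose * Zs * e = c • e := by
  have hA : (Zs.transpose * Zs).IsHermitian := by
    rw [← Matrix.conjTranspose_eq_transpose_of_trivial]
    exact Matrix.isHermitian_conjTranspose_mul_self Zs
  let i : Fin r := ⟨0, hr⟩
  refine ⟨Matrix.of fun j _ => hA.eigenvectorBasis i j, hA.eigenvalues i, ?_, ?_⟩
  · have h1 : ‖hA.eigenvectorBasis i‖ ^ 2 = 1 := by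
      rw [hA.eigenvectorBasis.orthonormal.1 i, one_pow]
    rw [EuclideanSpace.norm_sq_eq] at h1
    ext a b
    rw [Subsingleton.elim a b, Matrix.one_apply_eq, ← h1, Matrix.mul_apply]
    simp [sq]
  · have h2 := hA.mulVec_eigenvectorBasis i
    ext a b
    have h3 := congrFun h2 a
    simpa [Matrix.mulVec, dotProduct, Matrix.mul_apply] using h3

theorem ip_mul_orthogonal_le (B : Mat m k) {Q : Mat k k}
    (hQ : Q ∈ Matrix.orthogonalGroup (Fin k) ℝ) : ip (B * Q) B ≤ ip B B := by
  refine (ip_le _ _).trans ?_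
  rw [norm_mul_orthogonal _ hQ, ip_self, sq]

/-- The correlation of the perturbed point, rotated by Q, with Z* is the sum of that for Z* and s c
≥ 0 times that for eᵀ; by Cauchy-Schwarz each is largest at the identity. -/
theorem isAlignment_rank_one {Zs : Mat n r} {e : Mat r 1} {c : ℝ} (hu : e.transpose * e = 1)
    (he : Zs.transpose * Zs * e = c • e) {s : ℝ} (hs : 0 ≤ s) :
    IsAlignment (Zs + s • (Zs * (e * e.transpose))) Zs 1 := by
  have hc : 0 ≤ c := by
    have h1 : ip e (Zs.transpose * Zs * e) = c * ip e e := by rw [he, ip_smul_right]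
    have h2 : ip e e = 1 := by rw [ip, hu]; simp
    rw [Matrix.mul_assoc, ip_mul_right, Matrix.transpose_transpose, ip_self, h2, mul_one] at h1
    rw [← h1]
    positivity
  have key : ∀ Q : Mat r r, ip ((Zs + s • (Zs * (e * e.transpose))) * Q) Zs =
      ip (Zs * Q) Zs + s * c * ip (e.transpose * Q) e.transpose := by
    intro Q
    have h1 : ip (Zs * (e * (e.transpose * Q))) Zs = c * ip (e.transpose * Q) e.transpose := by
      rw [ip_comm, ip_mul_right, ip_mul_right]
      have h2 : e.transpose * (Zs.transpose * Zs) = c • e.transpose := by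
        have := congrArg Matrix.transpose he
        simpa [Matrix.transpose_mul] using this
      rw [h2, ip_smul_left, ip_comm]
    rw [Matrix.add_mul, ip_add_left, Matrix.smul_mul, ip_smul_left, Matrix.mul_assoc,
      Matrix.mul_assoc, h1]
    ring
  rw [isAlignment_one_iff]
  intro Q hQ
  have h1 := key 1
  rw [Matrix.mul_one, Matrix.mul_one, Matrix.mul_one] at h1
  rw [key Q, h1]
  have h2 := ip_mul_orthogonal_le Zs hQ
  have h3 := mul_le_mul_of_nonneg_left (ip_mul_orthogonal_le e.transpose hQ) (mul_nonneg hs hc)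
  linarith

theorem rank_one_path_mul_transpose (Zs : Mat n r) {e : Mat r 1} (hu : e.transpose * e = 1)
    (s : ℝ) :
    (Zs + s • (Zs * (e * e.transpose))) * (Zs + s • (Zs * (e * e.transpose))).transpose =
      Zs * Zs.transpose + (2 * s + s ^ 2) • ((Zs * e) * (Zs * e).transpose) ∧
    tangent (Zs + s • (Zs * (e * e.transpose))) (Zs * (e * e.transpose)) =
      (2 + 2 * s) • ((Zs * e) * (Zs * e).transpose) := by
  have h1 : Zs * (e * e.transpose) * (Zs * (e * e.transpose)).transpose =
      (Zs * e) * (Zs * e).transpose := by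
    simp only [Matrix.transpose_mul, Matrix.transpose_transpose, Matrix.mul_assoc]
    rw [← Matrix.mul_assoc e.transpose e, hu, Matrix.one_mul]
  have h2 : Zs * (Zs * (e * e.transpose)).transpose = (Zs * e) * (Zs * e).transpose := by
    simp only [Matrix.transpose_mul, Matrix.transpose_transpose, Matrix.mul_assoc]
  have h3 : Zs * (e * e.transpose) * Zs.transpose = (Zs * e) * (Zs * e).transpose := by
    simp only [Matrix.transpose_mul, Matrix.mul_assoc]
  simp only [tangent, Matrix.transpose_add, Matrix.transpose_smul, Matrix.add_mul, Matrix.mul_add,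
    Matrix.smul_mul, Matrix.mul_smul, h1, h2, h3]
  constructor <;> module

/-- At every point of the path M is a multiple of a tangent matrix, so restricted convexity bounds
the curvature along M from below; the mean value theorem turns this into growth of the score. -/
theorem le_ip_score_sub {ℓ : Mat n n → ℝ} (hℓ : ContDiff ℝ 2 ℓ) {Zs : Mat n r} {e : Mat r 1}
    (hu : e.transpose * e = 1) {D : Set (Mat n r)} {α β s₀ : ℝ} (hα : 0 ≤ α) (hs₀ : 0 < s₀)
    (hD : ∀ s ∈ Set.Icc 0 s₀, Zs + s • (Zs * (e * e.transpose)) ∈ D) (hrip : LocalRIP ℓ D α β) :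
    2 * s₀ * α * ‖(Zs * e) * (Zs * e).transpose‖ ^ 2 ≤
      ip (score ℓ (Zs + s₀ • (Zs * (e * e.transpose))) - score ℓ Zs)
        ((Zs * e) * (Zs * e).transpose) := by
  set M := (Zs * e) * (Zs * e).transpose with hM
  set W := Zs * (e * e.transpose) with hW
  have hcurv : ∀ s ∈ Set.Icc 0 s₀,
      α * ‖M‖ ^ 2 ≤ matHess ℓ (Zs * Zs.transpose + (2 * s + s ^ 2) • M) M M := by
    intro s hs
    have h1 := (hrip _ (hD s hs) ((2 + 2 * s)⁻¹ • W)).1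
    have h2 : (2 + 2 * s) ≠ 0 := by have := hs.1; positivity
    have h3 := rank_one_path_mul_transpose Zs hu s
    rw [tangent_smul_right, h3.2, h3.1, smul_smul, inv_mul_cancel₀ h2, one_smul] at h1
    exact h1
  have hder := fun s : ℝ => hasDerivAt_fderiv_quadratic hℓ (Zs * Zs.transpose) M s
  obtain ⟨s, hs, h⟩ := exists_hasDerivAt_eq_slope
    (fun s : ℝ => fderiv ℝ ℓ (Zs * Zs.transpose + (2 * s + s ^ 2) • M) M) _ hs₀
    (fun s _ => (hder s).continuousAt.continuousWithinAt) (fun s _ => hder s)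
  have h1 : matHess ℓ (Zs * Zs.transpose + (2 * s + s ^ 2) • M) ((2 + 2 * s) • M) M =
      (fderiv ℝ ℓ (Zs * Zs.transpose + (2 * s₀ + s₀ ^ 2) • M) M -
        fderiv ℝ ℓ (Zs * Zs.transpose + (2 * 0 + 0 ^ 2 : ℝ) • M) M) / (s₀ - 0) := h
  rw [matHess_smul_left, eq_div_iff (by linarith)] at h1
  have h2 : Zs * Zs.transpose + (2 * 0 + 0 ^ 2 : ℝ) • M = Zs * Zs.transpose := by simp
  rw [h2, ← (rank_one_path_mul_transpose Zs hu s₀).1, fderiv_eq_ip, fderiv_eq_ip,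
    ← ip_sub_left] at h1
  rw [score, score, ← h1]
  have h3 := hcurv s ⟨hs.1.le, hs.2.le⟩
  have h4 : 0 ≤ α * ‖M‖ ^ 2 := by positivity
  have h5 : 2 * (α * ‖M‖ ^ 2) ≤
      (2 + 2 * s) * matHess ℓ (Zs * Zs.transpose + (2 * s + s ^ 2) • M) M M :=
    mul_le_mul (by linarith [hs.1]) h3 h4 (by linarith [hs.1])
  have h6 := mul_le_mul_of_nonneg_right h5 hs₀.le
  linarith

section Mean

variable {Ω : Type*} [MeasurableSpace Ω] {μ : Measure Ω} {L : Ω → Mat n n → ℝ}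

theorem integrable_ip_score {Z : Mat n r} (h : ∀ i j, Integrable (fun ω => score (L ω) Z i j) μ)
    (M : Mat n n) : Integrable (fun ω => ip (score (L ω) Z) M) μ := by
  simp only [ip_eq_sum]
  exact integrable_finsetSum _ fun i _ => integrable_finsetSum _ fun j _ =>
    (h i j).mul_const _

theorem ip_meanScore {Z : Mat n r} (h : ∀ i j, Integrable (fun ω => score (L ω) Z i j) μ)
    (M : Mat n n) : ip (meanScore μ L Z) M = ∫ ω, ip (score (L ω) Z) M ∂μ := by
  simp only [ip_eq_sum]
  have h1 : ∀ i, ∫ ω, ∑ j, score (L ω) Z i j * M i j ∂μ = ∑ j, meanScore μ L Z i j * M i j := by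
    intro i
    refine (integral_finsetSum (f := fun j ω => score (L ω) Z i j * M i j) Finset.univ
      fun j _ => (h i j).mul_const _).trans ?_
    refine Finset.sum_congr rfl fun j _ => ?_
    rw [integral_mul_const, meanScore, Matrix.of_apply]
  refine Eq.trans ?_ (integral_finsetSum (f := fun i ω => ∑ j, score (L ω) Z i j * M i j)
    Finset.univ fun i _ => integrable_finsetSum _ fun j _ => (h i j).mul_const _).symm
  exact Finset.sum_congr rfl fun i _ => (h1 i).symm

/-- The strong convexity constant is at most twice the Lipschitz constant of the mean gradient. -/
theorem alpha_le_two_mul [IsProbabilityMeasure μ] {Zs : Mat n r} {D : Set (Mat n r)}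
    {α β p q L₂ : ℝ} (hr : 1 ≤ r) (hc : Conditioned Zs p q) (hα : 0 < α)
    (hL : StochasticLoss μ L Zs D) (hrip : ∀ᵐ ω ∂μ, LocalRIP (L ω) D α β)
    (hlip : GradLip (meanScore μ L) D L₂)
    (hD : ∀ W : Mat n r, (∀ s : ℝ, 0 ≤ s → IsAlignment (Zs + s • W) Zs 1) →
      ∃ s₀ ∈ Set.Ioc (0 : ℝ) 1, ∀ s ∈ Set.Icc 0 s₀, Zs + s • W ∈ D) :
    α ≤ 2 * L₂ := by
  obtain ⟨e, c, hu, he⟩ := exists_unit_eigenvector Zs hr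
  obtain ⟨s₀, ⟨hs₀, hs₁⟩, hs⟩ := hD (Zs * (e * e.transpose)) fun s hs =>
    isAlignment_rank_one hu he hs
  set M := (Zs * e) * (Zs * e).transpose with hM
  set Z₁ := Zs + s₀ • (Zs * (e * e.transpose)) with hZ₁
  have hZ₁D : Z₁ ∈ D := hs s₀ ⟨hs₀.le, le_rfl⟩
  have hZsD : Zs ∈ D := by simpa using hs 0 ⟨le_rfl, hs₀.le⟩
  have hae : ∀ᵐ ω ∂μ, 2 * s₀ * α * ‖M‖ ^ 2 ≤ ip (score (L ω) Z₁) M - ip (score (L ω) Zs) M := by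
    filter_upwards [hL.smooth, hrip] with ω h1 h2
    rw [← ip_sub_left]
    exact le_ip_score_sub h1 hu hα.le hs₀ hs h2
  have i1 := integrable_ip_score (hL.integrable Z₁ hZ₁D) M
  have i0 := integrable_ip_score (hL.integrable Zs hZsD) M
  have hint := integral_mono_ae (integrable_const _) (i1.sub i0) hae
  have hsub := integral_sub i1 i0
  simp only [Pi.sub_apply] at hint
  rw [hsub, ← ip_meanScore (hL.integrable Z₁ hZ₁D), ← ip_meanScore (hL.integrable Zs hZsD),
    ← ip_sub_left] at hint
  simp only [integral_const, probReal_univ, one_smul] at hint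
  have hup := (le_abs_self _).trans
    (abs_ip_mul_transpose_le (meanScore μ L Z₁ - meanScore μ L Zs) (Zs * e) (Zs * e))
  have hl := hlip Z₁ hZ₁D Zs hZsD
  rw [(rank_one_path_mul_transpose Zs hu s₀).1, add_sub_cancel_left, ← hM, norm_smul,
    Real.norm_eq_abs, abs_of_nonneg (by positivity)] at hl
  set a := ‖Zs * e‖ with ha
  have hMa : ‖M‖ = a ^ 2 := by
    have h1 : (Zs * e).transpose * (Zs * e) = (a ^ 2) • (1 : Mat 1 1) := by
      ext i j
      rw [ha, ← ip_self, ip, Matrix.trace, Subsingleton.elim j i]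
      simp [Subsingleton.elim i 0]
    have h2 : ‖M‖ ^ 2 = (a ^ 2) ^ 2 := by
      rw [← ip_self, hM, ip_mul_right', Matrix.transpose_transpose, Matrix.mul_assoc, h1,
        Matrix.mul_smul, Matrix.mul_one, ip_smul_left, ip_self]
      ring
    exact (sq_eq_sq₀ (norm_nonneg _) (by positivity)).1 h2
  have hapos : 0 < a := by
    have h1 := hc.lower e
    have h2 : ‖e‖ ^ 2 = 1 := by rw [← ip_self, ip, hu]; simp
    have h3 : ‖e‖ = 1 := by
      have := norm_nonneg e
      nlinarith
    rw [h3, mul_one] at h1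
    exact hc.p_pos.trans_le h1
  rw [hMa] at hl hint
  have h1 : 2 * s₀ * α * (a ^ 2) ^ 2 ≤ L₂ * ((2 * s₀ + s₀ ^ 2) * a ^ 2) * a * a := by
    refine (hint.trans hup).trans ?_
    gcongr
  have h2 : 2 * α ≤ L₂ * (2 + s₀) := by
    have h3 : 2 * α * (s₀ * (a ^ 2) ^ 2) ≤ L₂ * (2 + s₀) * (s₀ * (a ^ 2) ^ 2) := by
      nlinarith
    exact le_of_mul_le_mul_right h3 (by positivity)
  -- Positivity of α forces L₂ > 0; only then may 2 + s₀ be replaced by 3, which gives 2 α ≤ 3 L₂.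
  have h3 : 0 < L₂ := by
    by_contra! hneg
    nlinarith
  nlinarith

end Mean

end LowRankGD

namespace LowRankGD

variable {m k n r : ℕ}

/-! ### Aligned slices of the local regions -/

/-- The optimally aligned points of the Frobenius region. -/
def slice2 (Zs : Mat n r) (ε : ℝ) : Set (Mat n r) :=
  {Y | IsAlignment Y Zs 1 ∧ ‖Y - Zs‖ ≤ ε * ‖Zs‖}

/-- The optimally aligned points of the row-wise region. -/
def sliceInf (Zs : Mat n r) (ε : ℝ) : Set (Mat n r) :=
  {Y | Y ∈ slice2 Zs ε ∧ rowNorm (Y - Zs) ≤ ε * rowNorm Zs}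

theorem isAlignment_self (Zs : Mat n r) : IsAlignment Zs Zs 1 :=
  isAlignment_one_iff.2 fun _ hQ => ip_mul_orthogonal_le Zs hQ

theorem self_mem_slice2 (Zs : Mat n r) {ε : ℝ} (hε : 0 ≤ ε) : Zs ∈ slice2 Zs ε :=
  ⟨isAlignment_self Zs, by rw [sub_self, norm_zero]; positivity⟩

theorem rowNorm_zero : rowNorm (0 : Mat n r) = 0 :=
  le_antisymm ((rowNorm_le_norm _).trans_eq norm_zero) (rowNorm_nonneg _)

theorem self_mem_sliceInf (Zs : Mat n r) {ε : ℝ} (hε : 0 ≤ ε) : Zs ∈ sliceInf Zs ε :=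
  ⟨self_mem_slice2 Zs hε, by
    rw [sub_self, rowNorm_zero]; exact mul_nonneg hε (rowNorm_nonneg _)⟩

theorem convex_slice2 (Zs : Mat n r) (ε : ℝ) : Convex ℝ (slice2 Zs ε) := by
  intro Y hY Z hZ a b ha hb hab
  refine ⟨isAlignment_one_iff.2 fun Q hQ => ?_, ?_⟩
  · rw [Matrix.add_mul, ip_add_left, ip_add_left, Matrix.smul_mul, Matrix.smul_mul, ip_smul_left,
      ip_smul_left, ip_smul_left, ip_smul_left]
    exact add_le_add (mul_le_mul_of_nonneg_left (isAlignment_one_iff.1 hY.1 Q hQ) ha)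
      (mul_le_mul_of_nonneg_left (isAlignment_one_iff.1 hZ.1 Q hQ) hb)
  · have h := convex_closedBall Zs (ε * ‖Zs‖) (x := Y) (by rw [mem_closedBall_iff_norm]; exact hY.2)
      (y := Z) (by rw [mem_closedBall_iff_norm]; exact hZ.2) ha hb hab
    rwa [mem_closedBall_iff_norm] at h

/-- Once the alignment is fixed to be the identity, the row constraint is a ball for a seminorm. -/
theorem convex_sliceInf (Zs : Mat n r) (ε : ℝ) : Convex ℝ (sliceInf Zs ε) := by
  intro Y hY Z hZ a b ha hb hab
  refine ⟨convex_slice2 Zs ε hY.1 hZ.1 ha hb hab, ?_⟩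
  have h : a • Y + b • Z - Zs = a • (Y - Zs) + b • (Z - Zs) := by
    calc a • Y + b • Z - Zs = a • Y + b • Z - (a + b) • Zs := by rw [hab, one_smul]
      _ = _ := by module
  rw [h]
  refine (rowNorm_add_le _ _).trans ?_
  rw [rowNorm_smul, rowNorm_smul, abs_of_nonneg ha, abs_of_nonneg hb]
  calc a * rowNorm (Y - Zs) + b * rowNorm (Z - Zs)
      ≤ a * (ε * rowNorm Zs) + b * (ε * rowNorm Zs) :=
        add_le_add (mul_le_mul_of_nonneg_left hY.2 ha) (mul_le_mul_of_nonneg_left hZ.2 hb)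
    _ = ε * rowNorm Zs := by rw [← add_mul, hab, one_mul]

theorem isCompact_slice2 (Zs : Mat n r) (ε : ℝ) : IsCompact (slice2 Zs ε) := by
  apply Metric.isCompact_of_isClosed_isBounded
  · have h : slice2 Zs ε = (⋂ Q ∈ Matrix.orthogonalGroup (Fin r) ℝ,
        {Y : Mat n r | ‖Y * (1 : Mat r r) - Zs‖ ≤ ‖Y * Q - Zs‖}) ∩
          {Y : Mat n r | ‖Y - Zs‖ ≤ ε * ‖Zs‖} := by
      ext Y
      constructor
      · intro hY
        exact ⟨Set.mem_iInter₂.2 fun Q hQ => hY.1.2 Q hQ, hY.2⟩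
      · intro hY
        exact ⟨⟨one_mem _, fun Q hQ => Set.mem_iInter₂.1 hY.1 Q hQ⟩, hY.2⟩
    rw [h]
    refine IsClosed.inter (isClosed_biInter fun Q _ => isClosed_le ?_ ?_) (isClosed_le ?_ ?_) <;>
      fun_prop
  · refine (Metric.isBounded_iff_subset_closedBall Zs).2 ⟨ε * ‖Zs‖, fun Y hY => ?_⟩
    rw [mem_closedBall_iff_norm]
    exact hY.2

theorem isCompact_sliceInf (Zs : Mat n r) {ε : ℝ} (hε : 0 ≤ ε) : IsCompact (sliceInf Zs ε) := by
  have h : sliceInf Zs ε = slice2 Zs ε ∩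
      ⋂ i : Fin n, {Y : Mat n r | ‖Matrix.single i i (1 : ℝ) * (Y - Zs)‖ ≤ ε * rowNorm Zs} := by
    ext Y
    constructor
    · intro hY
      refine ⟨hY.1, Set.mem_iInter.2 fun i => ?_⟩
      have h1 := (norm_rowPart_le_rowNorm i _).trans hY.2
      rwa [rowPart_eq_mul] at h1
    · intro hY
      refine ⟨hY.1, rowNorm_le (mul_nonneg hε (rowNorm_nonneg _)) fun i => ?_⟩
      rw [rowPart_eq_mul]
      exact Set.mem_iInter.1 hY.2 i
  rw [h]
  refine (isCompact_slice2 Zs ε).inter_right (isClosed_iInter fun i => isClosed_le ?_ ?_) <;>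
    fun_prop

theorem Conditioned.norm_pos {Zs : Mat n r} {p q : ℝ} (hc : Conditioned Zs p q) (hr : 1 ≤ r) :
    0 < ‖Zs‖ := by
  have h := hc.lower (1 : Mat r r)
  rw [Matrix.mul_one] at h
  have h1 : (1 : Mat r r) ≠ 0 := fun h0 => by
    have := congrFun (congrFun h0 ⟨0, hr⟩) ⟨0, hr⟩
    simp at this
  exact (mul_pos hc.p_pos (norm_pos_iff.2 h1)).trans_le h

theorem Conditioned.rowNorm_pos {Zs : Mat n r} {p q : ℝ} (hc : Conditioned Zs p q) (hr : 1 ≤ r) :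
    0 < rowNorm Zs := by
  have h1 := hc.norm_pos hr
  have h2 := norm_le_sqrt_mul_rowNorm Zs
  by_contra! h3
  nlinarith [Real.sqrt_nonneg n]

/-- `K` consists of the optimally aligned points of `D`. -/
structure IsSlice (Zs : Mat n r) (D K : Set (Mat n r)) : Prop where
  mem_iff : ∀ {Z : Mat n r} {R : Mat r r}, IsAlignment Z Zs R → (Z ∈ D ↔ Z * R ∈ K)
  compact : IsCompact K

theorem isSlice_slice2 {Zs : Mat n r} (hZs : 0 < ‖Zs‖) (ε : ℝ) :
    IsSlice Zs (region2 Zs ε) (slice2 Zs ε) where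
  mem_iff {Z R} h := by
    have h2 : Z ∈ region2 Zs ε ↔ dist2 Z Zs / ‖Zs‖ ≤ ε := Iff.rfl
    rw [h2, div_le_iff₀ hZs, h.dist2_eq]
    exact ⟨fun h1 => ⟨h.mul, h1⟩, fun h1 => h1.2⟩
  compact := isCompact_slice2 Zs ε

theorem isSlice_sliceInf {Zs : Mat n r} {p q ε : ℝ} (hc : Conditioned Zs p q) (hr : 1 ≤ r)
    (hε : 0 ≤ ε) (hrad : ε * ‖Zs‖ ≤ p / (100 * q)) :
    IsSlice Zs (regionInf Zs ε) (sliceInf Zs ε) where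
  mem_iff {Z R} h := by
    have h2 : Z ∈ region2 Zs ε ↔ Z * R ∈ slice2 Zs ε :=
      (isSlice_slice2 (hc.norm_pos hr) ε).mem_iff h
    have h3 : Z ∈ regionInf Zs ε ↔ Z ∈ region2 Zs ε ∧ distInf Z Zs / rowNorm Zs ≤ ε := Iff.rfl
    rw [h3, h2, div_le_iff₀ (hc.rowNorm_pos hr)]
    refine and_congr_right fun h4 => ?_
    rw [distInf_eq hc h (by rw [h.dist2_eq]; exact h4.2.trans hrad)]
  compact := isCompact_sliceInf Zs hε

/-! ### Local minimizers -/

theorem nonneg_of_hasDerivAt_of_le {f : ℝ → ℝ} {d : ℝ} (hf : HasDerivAt f d 0)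
    (h : ∀ s ∈ Set.Ioc (0 : ℝ) 1, f 0 ≤ f s) : 0 ≤ d := by
  refine ge_of_tendsto hf.tendsto_slope_zero_right ?_
  filter_upwards [Ioc_mem_nhdsGT (zero_lt_one' ℝ)] with s hs
  rw [zero_add, smul_eq_mul]
  exact mul_nonneg (inv_nonneg.2 hs.1.le) (sub_nonneg.2 (h s hs))

section Minimizer

variable {ℓ : Mat n n → ℝ} {Zs : Mat n r} {D K : Set (Mat n r)} {α β p q τ N : ℝ}

theorem IsSlice.subset (hs : IsSlice Zs D K) (h : SliceRegular ℓ Zs K α β p q) : K ⊆ D :=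
  fun Y hY => (hs.mem_iff (h.aligned Y hY)).2 (by rwa [Matrix.mul_one])

theorem IsSlice.exists_isLocalMinimizer (hs : IsSlice Zs D K) (h : SliceRegular ℓ Zs K α β p q) :
    ∃ Y ∈ K, IsLocalMinimizer ℓ D Y := by
  obtain ⟨Y, hY, hmin⟩ := hs.compact.exists_isMinOn ⟨Zs, h.base⟩
    (continuous_factored (r := r) h.smooth).continuousOn
  refine ⟨Y, hY, hs.subset h hY, fun Z hZ => ?_⟩
  obtain ⟨R, hR⟩ := exists_isAlignment Z Zs
  rw [← factored_mul ℓ Z hR.1]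
  exact hmin ((hs.mem_iff hR).1 hZ)

theorem IsSlice.isLocalMinimizer_mul (hs : IsSlice Zs D K) (h : SliceRegular ℓ Zs K α β p q)
    {Z : Mat n r} {R : Mat r r} (hR : IsAlignment Z Zs R) (hZ : IsLocalMinimizer ℓ D Z) :
    Z * R ∈ K ∧ IsLocalMinimizer ℓ D (Z * R) := by
  have h1 := (hs.mem_iff hR).1 hZ.1
  exact ⟨h1, hs.subset h h1, by rw [factored_mul ℓ Z hR.1]; exact hZ.2⟩

/-- Strong monotonicity of the gradient is read off from the contraction of the gradient step, by
pairing with D and dividing by τ. -/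
theorem SliceRegular.le_ip_matGrad_sub (h : SliceRegular ℓ Zs K α β p q)
    (hτ : StepLength α β p q τ) (hτ0 : 0 < τ) {Y : Mat n r} (hY : Y ∈ K) :
    α * p ^ 2 / 2 * ‖Y - Zs‖ ^ 2 ≤
      ip (matGrad (factored r ℓ) Y - matGrad (factored r ℓ) Zs) (Y - Zs) := by
  have h1 := h.norm_gradStep_sub_le hτ h.base hY
  set D := Y - Zs with hD
  set g := matGrad (factored r ℓ) Y - matGrad (factored r ℓ) Zs with hg
  have h2 : gradStep ℓ τ Y - gradStep ℓ τ Zs = D - τ • g := by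
    rw [hg, hD, gradStep, gradStep, smul_sub]; abel
  rw [h2] at h1
  have h3 := ip_le (D - τ • g) D
  rw [ip_sub_left, ip_smul_left, ip_self] at h3
  have h4 := mul_le_mul_of_nonneg_right h1 (norm_nonneg D)
  have h5 : τ * (α * p ^ 2 / 2 * ‖D‖ ^ 2) ≤ τ * ip g D := by linarith
  exact le_of_mul_le_mul_left h5 hτ0

/-- The segment towards Z* stays in the region, so the derivative of the objective in that direction
is nonnegative even if Y lies on the boundary. Strong monotonicity then bounds ‖Y - Z*‖ by the
gradient at Z*. -/
theorem IsSlice.norm_sub_le_of_isLocalMinimizer (hs : IsSlice Zs D K)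
    (h : SliceRegular ℓ Zs K α β p q) (hτ : StepLength α β p q τ) (hτ0 : 0 < τ)
    (hN : opNorm (score ℓ Zs) ≤ N) {Y : Mat n r} (hYK : Y ∈ K) (hY : IsLocalMinimizer ℓ D Y) :
    ‖Y - Zs‖ ≤ 4 * (N / (α * p ^ 2)) * ‖Zs‖ := by
  have hap : 0 < α * p ^ 2 := mul_pos h.alpha_pos (pow_pos h.cond.p_pos 2)
  have h1 : 0 ≤ ip (matGrad (factored r ℓ) Y) (Zs - Y) := by
    refine nonneg_of_hasDerivAt_of_le (hasDerivAt_factored_line h.smooth Y (Zs - Y)) fun s hs1 => ?_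
    rw [zero_smul, add_zero]
    exact hY.2 _ (hs.subset h (h.convex.add_smul_sub_mem hYK h.base ⟨hs1.1.le, hs1.2⟩))
  have h2 := h.le_ip_matGrad_sub hτ hτ0 hYK
  have h3 := (neg_le_abs _).trans (abs_ip_le (matGrad (factored r ℓ) Zs) (Y - Zs))
  have h4 := h.norm_matGrad_base_le hN
  have h5 : ip (matGrad (factored r ℓ) Y) (Zs - Y) = - ip (matGrad (factored r ℓ) Y) (Y - Zs) := by
    rw [← neg_sub, ← neg_one_smul ℝ, ip_smul_right]; ring
  rw [ip_sub_left] at h2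
  have h6 := mul_le_mul_of_nonneg_right h4 (norm_nonneg (Y - Zs))
  have h7 : ‖Y - Zs‖ * (α * p ^ 2 / 2 * ‖Y - Zs‖) ≤ ‖Y - Zs‖ * (2 * N * ‖Zs‖) := by
    linarith
  have h8 : 4 * (N / (α * p ^ 2)) * ‖Zs‖ = 4 * N * ‖Zs‖ / (α * p ^ 2) := by ring
  rw [h8, le_div_iff₀ hap]
  rcases eq_or_lt_of_le (norm_nonneg (Y - Zs)) with h0 | h0
  · rw [← h0, zero_mul]
    have := (opNorm_nonneg _).trans hN
    positivity
  · linarith [le_of_mul_le_mul_left h7 h0]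

theorem matGrad_eq_zero_of_gradStep_mem (hℓ : ContDiff ℝ 2 ℓ) (hτ0 : 0 < τ) {Y : Mat n r}
    (hY : IsLocalMinimizer ℓ D Y) (hstep : ∀ t ∈ Set.Ioc 0 τ, gradStep ℓ t Y ∈ D) :
    matGrad (factored r ℓ) Y = 0 := by
  have h1 := hasDerivAt_factored_line hℓ Y ((-τ) • matGrad (factored r ℓ) Y)
  have h2 := nonneg_of_hasDerivAt_of_le h1 fun s hs => by
    have h3 : Y + s • ((-τ) • matGrad (factored r ℓ) Y) = gradStep ℓ (s * τ) Y := by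
      rw [gradStep, smul_smul]; module
    rw [zero_smul, add_zero, h3]
    exact hY.2 _ (hstep _ ⟨mul_pos hs.1 hτ0, mul_le_of_le_one_left hτ0.le hs.2⟩)
  rw [ip_smul_right, ip_self] at h2
  have h3 : ‖matGrad (factored r ℓ) Y‖ ^ 2 ≤ 0 := by
    by_contra! h4
    nlinarith
  exact norm_eq_zero.1 (pow_eq_zero_iff two_ne_zero |>.1 (le_antisymm h3 (sq_nonneg _)))

theorem SliceRegular.eq_of_matGrad_eq_zero (h : SliceRegular ℓ Zs K α β p q)
    (hτ : StepLength α β p q τ) (hτ0 : 0 < τ) {Y Z : Mat n r} (hY : Y ∈ K) (hZ : Z ∈ K)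
    (hY0 : matGrad (factored r ℓ) Y = 0) (hZ0 : matGrad (factored r ℓ) Z = 0) : Z = Y := by
  have h1 := h.norm_gradStep_sub_le hτ hY hZ
  rw [gradStep, gradStep, hY0, hZ0, smul_zero, sub_zero, sub_zero] at h1
  have h2 : 0 < τ * α * p ^ 2 := mul_pos (mul_pos hτ0 h.alpha_pos) (pow_pos h.cond.p_pos 2)
  have h3 : ‖Z - Y‖ ≤ 0 := by
    by_contra! h4
    nlinarith
  exact sub_eq_zero.1 (norm_le_zero_iff.1 h3)

theorem StepLength.mono (hτ : StepLength α β p q τ) (hα : 0 ≤ α) (hβ : 0 ≤ β) {t : ℝ}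
    (ht : t ∈ Set.Ioc 0 τ) : StepLength α β p q t :=
  ⟨ht.1.le, le_trans (mul_le_mul_of_nonneg_right ht.2 (by positivity)) hτ.le⟩

/-- Existence, uniqueness and stationarity of the aligned minimizer, provided gradient steps from
minimizers stay in the region. -/
theorem IsSlice.exists_isAlignedMinimizer (hs : IsSlice Zs D K)
    (h : SliceRegular ℓ Zs K α β p q) (hτ : StepLength α β p q τ) (hτ0 : 0 < τ)
    (hN : opNorm (score ℓ Zs) ≤ N)
    (hstay : ∀ Y ∈ K, ‖Y - Zs‖ ≤ 4 * (N / (α * p ^ 2)) * ‖Zs‖ →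
      ∀ t, StepLength α β p q t → gradStep ℓ t Y ∈ D) :
    ∃ Zt ∈ K, matGrad (factored r ℓ) Zt = 0 ∧ IsAlignedMinimizer ℓ D Zs Zt ∧
      StationaryMinimizers ℓ D Zt ∧ ‖Zt - Zs‖ ≤ 4 * (N / (α * p ^ 2)) * ‖Zs‖ := by
  -- A minimizer might sit on the boundary; the error bound supplies the hypothesis of `hstay`.
  -- Membership in D is asked rather than in K, since gradient steps leave the slice.
  have hstat : ∀ Y ∈ K, IsLocalMinimizer ℓ D Y → matGrad (factored r ℓ) Y = 0 := by
    intro Y hYK hY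
    refine matGrad_eq_zero_of_gradStep_mem h.smooth hτ0 hY fun t ht => ?_
    exact hstay Y hYK (hs.norm_sub_le_of_isLocalMinimizer h hτ hτ0 hN hYK hY) t
      (hτ.mono h.alpha_pos.le h.beta_pos.le ht)
  obtain ⟨Zt, hZtK, hZt⟩ := hs.exists_isLocalMinimizer h
  refine ⟨Zt, hZtK, hstat Zt hZtK hZt, ⟨⟨Zt, hZt⟩, fun Zh hZh R hR => ?_⟩,
    ⟨hstat Zt hZtK hZt, fun Zh hZh => ?_⟩,
    hs.norm_sub_le_of_isLocalMinimizer h hτ hτ0 hN hZtK hZt⟩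
  · have h1 := hs.isLocalMinimizer_mul h hR hZh
    exact h.eq_of_matGrad_eq_zero hτ hτ0 hZtK h1.1 (hstat Zt hZtK hZt) (hstat _ h1.1 h1.2)
  · obtain ⟨R, hR⟩ := exists_isAlignment Zh Zs
    have h1 := hs.isLocalMinimizer_mul h hR hZh
    have h2 := hstat _ h1.1 h1.2
    rw [matGrad_factored_mul h.smooth Zh hR.1] at h2
    rw [← norm_eq_zero, ← norm_mul_orthogonal _ hR.1, h2, norm_zero]

end Minimizer

end LowRankGD

namespace LowRankGD

variable {m k n r : ℕ}

/-! ### Gradient descent iterates -/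

/-- Equivariance of the gradient: rotating an iterate commutes with the step, so every step may
start from an aligned representative. -/
theorem iterate_succ_mul {ℓ : Mat n n → ℝ} (hℓ : ContDiff ℝ 2 ℓ) (η : ℝ) (Z₀ : Mat n r) (t : ℕ)
    {R : Mat r r} (hR : R ∈ Matrix.orthogonalGroup (Fin r) ℝ) :
    iterate ℓ η Z₀ (t + 1) * R = gradStep ℓ ((n : ℝ)⁻¹ * η) (iterate ℓ η Z₀ t * R) := by
  rw [iterate, gradStep, matGrad_factored_mul hℓ _ hR, Matrix.sub_mul, Matrix.smul_mul]

section Frobenius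

variable {ℓ : Mat n n → ℝ} {Zs : Mat n r} {K : Set (Mat n r)} {α β p q τ N ε φ : ℝ}

theorem SliceRegular.norm_gradStep_sub_base_le_mul (h : SliceRegular ℓ Zs K α β p q)
    (hτ : StepLength α β p q τ) (hN : opNorm (score ℓ Zs) ≤ N) {Y : Mat n r} (hY : Y ∈ K) {f : ℝ}
    (hf : ‖Y - Zs‖ ≤ f * ‖Zs‖) :
    ‖gradStep ℓ τ Y - Zs‖ ≤
      ((1 - τ * α * p ^ 2 / 2) * f + τ * α * p ^ 2 * (2 * (N / (α * p ^ 2)))) * ‖Zs‖ := by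
  have hap : α * p ^ 2 ≠ 0 := (mul_pos h.alpha_pos (pow_pos h.cond.p_pos 2)).ne'
  have h1 := h.norm_gradStep_sub_base_le hτ hN hY
  have h2 : τ * α * p ^ 2 * (2 * (N / (α * p ^ 2))) = τ * (2 * N) := by
    calc _ = τ * (2 * (α * p ^ 2 * (N / (α * p ^ 2)))) := by ring
      _ = _ := by rw [mul_div_cancel₀ _ hap]
  rw [h2]
  have h3 := mul_le_mul_of_nonneg_left hf
    (show 0 ≤ 1 - τ * α * p ^ 2 / 2 by linarith [h.step_alpha_le hτ])
  linarith

theorem SliceRegular.noise_nonneg (h : SliceRegular ℓ Zs K α β p q)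
    (hN : opNorm (score ℓ Zs) ≤ N) : 0 ≤ N / (α * p ^ 2) :=
  div_nonneg ((opNorm_nonneg _).trans hN) (mul_nonneg h.alpha_pos.le (sq_nonneg p))

/-- Convergence of gradient descent and statistical error of the minimizer in Frobenius norm. -/
theorem SliceRegular.frobenius_convergence (h : SliceRegular ℓ Zs (slice2 Zs ε) α β p q)
    (hr : 1 ≤ r) {η : ℝ} (hτ : StepLength α β p q ((n : ℝ)⁻¹ * η)) (hτ0 : 0 < (n : ℝ)⁻¹ * η)
    (hN : opNorm (score ℓ Zs) ≤ N) (hNε : 16 * (N / (α * p ^ 2)) ≤ ε) {Z₀ : Mat n r}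
    (hφ : φ ≤ ε / 2) (hZ₀ : dist2 Z₀ Zs ≤ φ * ‖Zs‖) :
    (∀ t : ℕ, dist2 (iterate ℓ η Z₀ t) Zs ≤
      ((1 - (n : ℝ)⁻¹ * η * α * p ^ 2 / 4) ^ t * φ + 8 * (N / (α * p ^ 2))) * ‖Zs‖) ∧
    ∃ Zt : Mat n r, IsAlignedMinimizer ℓ (region2 Zs ε) Zs Zt ∧
      StationaryMinimizers ℓ (region2 Zs ε) Zt ∧ ‖Zt - Zs‖ ≤ 8 * (N / (α * p ^ 2)) * ‖Zs‖ := by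
  have hZs := h.cond.norm_pos hr
  have hs := isSlice_slice2 hZs ε
  have hN0 := h.noise_nonneg hN
  set N' := N / (α * p ^ 2)
  have hφ0 : 0 ≤ φ := by
    have := (dist2_nonneg _ _).trans hZ₀
    exact nonneg_of_mul_nonneg_left this hZs
  constructor
  · have hy0 := h.step_alpha_nonneg hτ
    have hy1 := h.step_alpha_le hτ
    intro t
    induction t with
    | zero =>
      rw [pow_zero, one_mul]
      refine hZ₀.trans (mul_le_mul_of_nonneg_right (by linarith) hZs.le)
    | succ t ih =>
      obtain ⟨R, hR⟩ := exists_isAlignment (iterate ℓ η Z₀ t) Zs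
      have hx0 : 0 ≤ (1 - (n : ℝ)⁻¹ * η * α * p ^ 2 / 4) ^ t := pow_nonneg (by linarith) t
      have hx1 : (1 - (n : ℝ)⁻¹ * η * α * p ^ 2 / 4) ^ t ≤ 1 :=
        pow_le_one₀ (by linarith) (by linarith)
      rw [pow_succ]
      rw [hR.dist2_eq] at ih
      have hYK : iterate ℓ η Z₀ t * R ∈ slice2 Zs ε := by
        refine ⟨hR.mul, ih.trans (mul_le_mul_of_nonneg_right ?_ hZs.le)⟩
        have := mul_le_of_le_one_left hφ0 hx1
        linarith
      have h1 := h.norm_gradStep_sub_base_le_mul hτ hN hYK ih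
      rw [← dist2_mul hR.1, iterate_succ_mul h.smooth η Z₀ t hR.1]
      have h2 := dist2_le (Z := gradStep ℓ ((n : ℝ)⁻¹ * η) (iterate ℓ η Z₀ t * R)) (Zs := Zs)
        (one_mem (Matrix.orthogonalGroup (Fin r) ℝ))
      rw [Matrix.mul_one] at h2
      refine h2.trans (h1.trans (mul_le_mul_of_nonneg_right ?_ hZs.le))
      set y := (n : ℝ)⁻¹ * η * α * p ^ 2
      set x := (1 - y / 4) ^ t
      -- The recursion f ↦ (1 - y/2) f + 2 y N' has fixed point 4 N', below the claimed 8 N', and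
      -- contracts faster than 1 - y/4.
      have e1 : 0 ≤ y * (x * φ) := by positivity
      have e2 : 0 ≤ y * N' := by positivity
      linarith
  · obtain ⟨Zt, _, _, h1, h2, h3⟩ := hs.exists_isAlignedMinimizer h hτ hτ0 hN
      fun Y hYK _ t ht => by
        have h1 := h.norm_gradStep_sub_base_le_mul ht hN hYK hYK.2
        have h2 := dist2_le (Z := gradStep ℓ t Y) (Zs := Zs)
          (one_mem (Matrix.orthogonalGroup (Fin r) ℝ))
        rw [Matrix.mul_one] at h2
        have h3 : dist2 (gradStep ℓ t Y) Zs / ‖Zs‖ ≤ ε := by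
          rw [div_le_iff₀ hZs]
          refine h2.trans (h1.trans (mul_le_mul_of_nonneg_right ?_ hZs.le))
          -- The ball of radius ε is invariant because ε exceeds the fixed point 4 N' of the
          -- recursion.
          have e1 := mul_le_mul_of_nonneg_left hNε (h.step_alpha_nonneg ht)
          have e2 := mul_nonneg (h.step_alpha_nonneg ht) hN0
          linarith
        exact h3
    refine ⟨Zt, h1, h2, h3.trans (mul_le_mul_of_nonneg_right ?_ hZs.le)⟩
    linarith

end Frobenius

/-! ### Row-wise convergence. -/

section RowWise

variable {ℓ : Mat n n → ℝ} {Zs : Mat n r} {K : Set (Mat n r)} {α β p q τ N Ninf ε φ ψ Λ s : ℝ}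
  {G : Mat n r → Mat n n}

/-- The one-step bound in relative errors. Converting ‖Z*‖ ≤ s q p, with s = √r in the application,
produces the coupling coefficient (β/α) q² s in front of the Frobenius error f. -/
theorem RowRegular.rowNorm_gradStep_mul_sub_le_mul (h : RowRegular ℓ Zs K α β p q G Λ)
    (hτ : StepLength α β p q τ) (hN : rowNorm (score ℓ Zs * Zs) ≤ Ninf * rowNorm Zs)
    (hZs : ‖Zs‖ ≤ s * (q * p)) {Y : Mat n r} (hY : Y ∈ K)
    (hd : ‖gradStep ℓ τ Y - Zs‖ ≤ p / (100 * q)) {f g : ℝ} (hf0 : 0 ≤ f)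
    (hf : ‖Y - Zs‖ ≤ f * ‖Zs‖) (hg : rowNorm (Y - Zs) ≤ g * rowNorm Zs)
    {Q : Mat r r} (hQ : IsAlignment (gradStep ℓ τ Y) Zs Q) :
    rowNorm (gradStep ℓ τ Y * Q - Zs) ≤ ((1 - 2 / 5 * (τ * α * p ^ 2)) * g + τ * α * p ^ 2 *
      (3 * (β / α * q ^ 2 * s) * f + 2 * (Ninf / (α * p ^ 2)))) * rowNorm Zs := by
  have hα := h.alpha_pos
  have hp := h.cond.p_pos
  have hq := h.cond.q_pos
  have hβ := h.beta_pos
  have hτ0 := hτ.nonneg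
  have hζ := rowNorm_nonneg Zs
  refine (h.rowNorm_gradStep_mul_sub_le hτ hN hY hd hQ).trans ?_
  have h1 := mul_le_mul_of_nonneg_left hg
    (show 0 ≤ 1 - 2 / 5 * (τ * α * p ^ 2) by linarith [h.step_alpha_le hτ])
  have h2 : τ * (β * (q * p) * ‖Y - Zs‖) ≤ τ * (β * (q * p) * (f * (s * (q * p)))) := by
    refine mul_le_mul_of_nonneg_left (mul_le_mul_of_nonneg_left ?_ (by positivity)) hτ0
    exact hf.trans (mul_le_mul_of_nonneg_left hZs hf0)
  have h3 : τ * α * p ^ 2 * (3 * (β / α * q ^ 2 * s) * f + 2 * (Ninf / (α * p ^ 2))) =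
      3 * (τ * (β * (q * p) * (f * (s * (q * p))))) + τ * (2 * Ninf) := by
    field_simp
  rw [h3]
  have h4 := mul_le_mul_of_nonneg_right h2 hζ
  linarith

/-- Convergence of gradient descent and statistical error of the minimizer in Frobenius norm and
in two-to-infinity norm. -/
theorem RowRegular.rowWise_convergence (h : RowRegular ℓ Zs (sliceInf Zs ε) α β p q G Λ)
    (hr : 1 ≤ r) {η : ℝ} (hτ : StepLength α β p q ((n : ℝ)⁻¹ * η)) (hτ0 : 0 < (n : ℝ)⁻¹ * η)
    (hN : opNorm (score ℓ Zs) ≤ N) (hNinf : rowNorm (score ℓ Zs * Zs) ≤ Ninf * rowNorm Zs)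
    (hε : 0 ≤ ε) (hrad : ε * ‖Zs‖ ≤ p / (100 * q)) (hs0 : 0 ≤ s) (hZs : ‖Zs‖ ≤ s * (q * p))
    (hNε : 16 * (N / (α * p ^ 2)) ≤ ε) (hNinfε : 16 * (Ninf / (α * p ^ 2)) ≤ ε)
    (hNN : 24 * (β / α * q ^ 2 * s) * (N / (α * p ^ 2)) ≤ Ninf / (α * p ^ 2))
    {Z₀ : Mat n r} (hφ : φ ≤ ε / 2) (hψ : ψ ≤ ε / 2) (hφψ : 30 * (β / α * q ^ 2 * s) * φ ≤ ψ)
    (hZ₀ : dist2 Z₀ Zs ≤ φ * ‖Zs‖) (hZ₀' : distInf Z₀ Zs ≤ ψ * rowNorm Zs) :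
    (∀ t : ℕ, dist2 (iterate ℓ η Z₀ t) Zs ≤
        ((1 - (n : ℝ)⁻¹ * η * α * p ^ 2 / 4) ^ t * φ + 8 * (N / (α * p ^ 2))) * ‖Zs‖ ∧
      distInf (iterate ℓ η Z₀ t) Zs ≤
        ((1 - (n : ℝ)⁻¹ * η * α * p ^ 2 / 4) ^ t * ψ + 8 * (Ninf / (α * p ^ 2))) * rowNorm Zs) ∧
    ∃ Zt : Mat n r, IsAlignedMinimizer ℓ (regionInf Zs ε) Zs Zt ∧
      StationaryMinimizers ℓ (regionInf Zs ε) Zt ∧ ‖Zt - Zs‖ ≤ 8 * (N / (α * p ^ 2)) * ‖Zs‖ ∧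
      rowNorm (Zt - Zs) ≤ 8 * (Ninf / (α * p ^ 2)) * rowNorm Zs := by
  have hZpos := h.cond.norm_pos hr
  have hζ := h.cond.rowNorm_pos hr
  have hs := isSlice_sliceInf h.cond hr hε hrad
  have hN0 := h.noise_nonneg hN
  have hα := h.alpha_pos
  have hβ := h.beta_pos
  have hA : 0 ≤ β / α * q ^ 2 * s := by positivity
  have hrow := fun {τ : ℝ} (hτ : StepLength α β p q τ) {Y : Mat n r} (hY : Y ∈ sliceInf Zs ε) =>
    h.rowNorm_gradStep_mul_sub_le_mul hτ hNinf hZs hY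
  have hfrob := fun {τ : ℝ} (hτ : StepLength α β p q τ) {Y : Mat n r} (hY : Y ∈ sliceInf Zs ε)
      {f : ℝ} (hf : ‖Y - Zs‖ ≤ f * ‖Zs‖) => h.norm_gradStep_sub_base_le_mul hτ hN hY hf
  set N' := N / (α * p ^ 2)
  set M' := Ninf / (α * p ^ 2)
  set A := β / α * q ^ 2 * s
  have hM0 : 0 ≤ M' := le_trans (by positivity) hNN
  have hφ0 : 0 ≤ φ := nonneg_of_mul_nonneg_left ((dist2_nonneg _ _).trans hZ₀) hZpos
  have hψ0 : 0 ≤ ψ := nonneg_of_mul_nonneg_left ((distInf_nonneg _ _).trans hZ₀') hζ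
  constructor
  · have hy0 := h.step_alpha_nonneg hτ
    have hy1 := h.step_alpha_le hτ
    intro t
    induction t with
    | zero =>
      rw [pow_zero, one_mul, one_mul]
      exact ⟨hZ₀.trans (mul_le_mul_of_nonneg_right (by linarith) hZpos.le),
        hZ₀'.trans (mul_le_mul_of_nonneg_right (by linarith) hζ.le)⟩
    | succ t ih =>
      obtain ⟨R, hR⟩ := exists_isAlignment (iterate ℓ η Z₀ t) Zs
      have hx0 : 0 ≤ (1 - (n : ℝ)⁻¹ * η * α * p ^ 2 / 4) ^ t := pow_nonneg (by linarith) t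
      have hx1 : (1 - (n : ℝ)⁻¹ * η * α * p ^ 2 / 4) ^ t ≤ 1 :=
        pow_le_one₀ (by linarith) (by linarith)
      rw [pow_succ]
      obtain ⟨ih1, ih2⟩ := ih
      have hFε : (1 - (n : ℝ)⁻¹ * η * α * p ^ 2 / 4) ^ t * φ + 8 * N' ≤ ε := by
        have := mul_le_of_le_one_left hφ0 hx1
        linarith
      have hGε : (1 - (n : ℝ)⁻¹ * η * α * p ^ 2 / 4) ^ t * ψ + 8 * M' ≤ ε := by
        have := mul_le_of_le_one_left hψ0 hx1
        linarith
      have hd := ih1.trans ((mul_le_mul_of_nonneg_right hFε hZpos.le).trans hrad)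
      rw [distInf_eq h.cond hR hd] at ih2
      rw [hR.dist2_eq] at ih1
      have hYK : iterate ℓ η Z₀ t * R ∈ sliceInf Zs ε :=
        ⟨⟨hR.mul, ih1.trans (mul_le_mul_of_nonneg_right hFε hZpos.le)⟩,
          ih2.trans (mul_le_mul_of_nonneg_right hGε hζ.le)⟩
      have h1 := hfrob hτ hYK ih1
      rw [← dist2_mul hR.1, ← distInf_mul hR.1, iterate_succ_mul h.smooth η Z₀ t hR.1]
      obtain ⟨Q, hQ⟩ := exists_isAlignment
        (gradStep ℓ ((n : ℝ)⁻¹ * η) (iterate ℓ η Z₀ t * R)) Zs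
      have h2 := dist2_le (Z := gradStep ℓ ((n : ℝ)⁻¹ * η) (iterate ℓ η Z₀ t * R)) (Zs := Zs)
        (one_mem (Matrix.orthogonalGroup (Fin r) ℝ))
      rw [Matrix.mul_one] at h2
      have h3 := distInf_le hQ
      have h4 := fun hd hf0 => hrow hτ hYK hd hf0 ih1 ih2 hQ
      set y := (n : ℝ)⁻¹ * η * α * p ^ 2
      set x := (1 - y / 4) ^ t
      have e1 : 0 ≤ y * (x * φ) := by positivity
      have e2 : 0 ≤ y * N' := by positivity
      have e3 : 0 ≤ y * M' := by positivity
      have e4 : 0 ≤ y * (x * ψ) := by positivity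
      have h5 : (1 - y / 2) * (x * φ + 8 * N') + y * (2 * N') ≤
          x * (1 - y / 4) * φ + 8 * N' := by linarith
      have h6 : x * (1 - y / 4) * φ + 8 * N' ≤ ε := by linarith
      have h7 := h1.trans (mul_le_mul_of_nonneg_right h5 hZpos.le)
      refine ⟨h2.trans h7, h3.trans ((h4 ?_ (by positivity)).trans
        (mul_le_mul_of_nonneg_right ?_ hζ.le))⟩
      · exact h7.trans ((mul_le_mul_of_nonneg_right h6 hZpos.le).trans hrad)
      -- The drive 3 A (x φ + 8 N') is at most x ψ / 10 + M' by `hφψ` and `hNN`. The new bound is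
      -- then (1 - 3y/10) x ψ + 8 M' - (16/5) y M' + 3 y M', which is below the claim.
      · have e5 := mul_le_mul_of_nonneg_left hNN hy0
        have e6 := mul_le_mul_of_nonneg_left hφψ (mul_nonneg hy0 hx0)
        linarith
  · obtain ⟨Zt, hZtK, hgrad, h1, h2, h3⟩ := hs.exists_isAlignedMinimizer h.toSliceRegular hτ hτ0 hN
      fun Y hYK hY t ht => by
        have hy0 := h.step_alpha_nonneg ht
        obtain ⟨Q, hQ⟩ := exists_isAlignment (gradStep ℓ t Y) Zs
        have h1 : ‖gradStep ℓ t Y - Zs‖ ≤ ε * ‖Zs‖ := by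
          refine (hfrob ht hYK hY).trans (mul_le_mul_of_nonneg_right ?_ hZpos.le)
          linarith
        have h2 := hrow ht hYK (h1.trans hrad) (by positivity) hY hYK.2 hQ
        rw [hs.mem_iff hQ]
        refine ⟨⟨hQ.mul, ?_⟩, h2.trans (mul_le_mul_of_nonneg_right ?_ hζ.le)⟩
        · rw [← hQ.dist2_eq]
          have h3 := dist2_le (Z := gradStep ℓ t Y) (Zs := Zs)
            (one_mem (Matrix.orthogonalGroup (Fin r) ℝ))
          rw [Matrix.mul_one] at h3
          exact h3.trans h1
        · have e1 := mul_le_mul_of_nonneg_left hNN hy0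
          have e2 := mul_le_mul_of_nonneg_left hNinfε hy0
          have e3 := mul_nonneg hy0 hM0
          linarith
    refine ⟨Zt, h1, h2, h3.trans (mul_le_mul_of_nonneg_right (by linarith) hZpos.le), ?_⟩
    -- A stationary point is fixed by the step and already aligned, so the one-step bound with Q = 1
    -- is an inequality for its own row error: (2/5) w ≤ 12 A N' + 2 M'.
    have hfix : gradStep ℓ ((n : ℝ)⁻¹ * η) Zt = Zt := by
      rw [gradStep, hgrad, smul_zero, sub_zero]
    have h4 := h.rowNorm_gradStep_mul_sub_le_mul hτ hNinf hZs hZtK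
      (by rw [hfix]; exact hZtK.1.2.trans hrad) (by positivity) h3
      (g := rowNorm (Zt - Zs) / rowNorm Zs) (by rw [div_mul_cancel₀ _ hζ.ne']) (Q := 1)
      (by rw [hfix]; exact hZtK.1.1)
    rw [hfix, Matrix.mul_one, ← div_le_iff₀ hζ] at h4
    rw [← div_le_iff₀ hζ]
    set w := rowNorm (Zt - Zs) / rowNorm Zs
    have hy : 0 < (n : ℝ)⁻¹ * η * α * p ^ 2 :=
      mul_pos (mul_pos hτ0 hα) (pow_pos h.cond.p_pos 2)
    have e1 := mul_le_mul_of_nonneg_left hNN hy.le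
    have e3 := mul_nonneg hy.le hM0
    have h5 : (n : ℝ)⁻¹ * η * α * p ^ 2 * w ≤ (n : ℝ)⁻¹ * η * α * p ^ 2 * (8 * M') := by
      linarith
    exact le_of_mul_le_mul_left h5 hy

end RowWise

end LowRankGD

namespace LowRankGD

variable {m k n r : ℕ}

/-! ### Probability -/

/-- The exceptional null set need not be measurable, so a measurable null superset is removed from
the event. -/
theorem WithProbAtLeast.mono_ae {Ω : Type*} [MeasurableSpace Ω] {μ : Measure Ω} {c : ℝ}
    {P Q R : Ω → Prop} (hP : WithProbAtLeast μ c P) (hQ : ∀ᵐ ω ∂μ, Q ω)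
    (h : ∀ ω, P ω → Q ω → R ω) : WithProbAtLeast μ c R := by
  obtain ⟨E, hE, hμ, hEP⟩ := hP
  refine ⟨E \ toMeasurable μ {ω | ¬ Q ω}, hE.diff (measurableSet_toMeasurable _ _), ?_,
    fun ω hω => h ω (hEP ω hω.1) ?_⟩
  · rwa [measure_sdiff_null (by rw [measure_toMeasurable]; exact hQ)]
  · by_contra hn
    exact hω.2 (subset_toMeasurable μ _ hn)

/-! ### The local regions contain short aligned segments -/

theorem exists_segment_scale {a w : ℝ} (ha : 0 < a) (hw : 0 ≤ w) :
    ∃ s₀ ∈ Set.Ioc (0 : ℝ) 1, ∀ s ∈ Set.Icc 0 s₀, s * w ≤ a := by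
  have hw' : 0 < 1 + w := by linarith
  refine ⟨min 1 (a / (1 + w)), ⟨lt_min one_pos (div_pos ha hw'), min_le_left _ _⟩,
    fun s hs => ?_⟩
  have h1 := (le_div_iff₀ hw').1 (hs.2.trans (min_le_right _ _))
  linarith [hs.1]

/-- Only an upper bound on `distInf` is needed, so uniqueness of the alignment is not. This avoids
circularity: the radius is known to be small only after α ≤ 2 L₂, which is deduced from this
segment. -/
theorem exists_segment_regionInf {Zs : Mat n r} {ε : ℝ} (hε : 0 < ε) (hZs : 0 < ‖Zs‖)
    (hrow : 0 < rowNorm Zs) (W : Mat n r)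
    (hW : ∀ s : ℝ, 0 ≤ s → IsAlignment (Zs + s • W) Zs 1) :
    ∃ s₀ ∈ Set.Ioc (0 : ℝ) 1, ∀ s ∈ Set.Icc 0 s₀, Zs + s • W ∈ regionInf Zs ε := by
  obtain ⟨s₀, hs₀, h⟩ := exists_segment_scale
    (lt_min (mul_pos hε hZs) (mul_pos hε hrow)) (norm_nonneg W)
  refine ⟨s₀, hs₀, fun s hs => ?_⟩
  have hal := hW s hs.1
  have h1 : (Zs + s • W) * (1 : Mat r r) - Zs = s • W := by
    rw [Matrix.mul_one, add_sub_cancel_left]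
  have h2 := h s hs
  refine ⟨?_, ?_⟩
  · rw [div_le_iff₀ hZs, hal.dist2_eq, h1, norm_smul, Real.norm_of_nonneg hs.1]
    exact h2.trans (min_le_left _ _)
  · rw [div_le_iff₀ hrow]
    refine (distInf_le hal).trans ?_
    rw [h1]
    refine (rowNorm_le_norm _).trans ?_
    rw [norm_smul, Real.norm_of_nonneg hs.1]
    exact h2.trans (min_le_right _ _)

theorem exists_segment_region2 {Zs : Mat n r} {ε : ℝ} (hε : 0 < ε) (hZs : 0 < ‖Zs‖)
    (hrow : 0 < rowNorm Zs) (W : Mat n r)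
    (hW : ∀ s : ℝ, 0 ≤ s → IsAlignment (Zs + s • W) Zs 1) :
    ∃ s₀ ∈ Set.Ioc (0 : ℝ) 1, ∀ s ∈ Set.Icc 0 s₀, Zs + s • W ∈ region2 Zs ε :=
  let ⟨s₀, hs₀, h⟩ := exists_segment_regionInf hε hZs hrow W hW
  ⟨s₀, hs₀, fun s hs => (h s hs).1⟩

/-! ### Size of the local region -/

/-- The bound α ≤ 2 Λ turns a radius proportional to α into an absolute one: α / (1000 Λ) ≤ 1/500.
-/
theorem radius_bounds {p q s α ε Λ z : ℝ} (hp : 0 < p) (hq : 1 ≤ q) (hs : 1 ≤ s)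
    (hΛ : 1 ≤ Λ) (hαΛ : α ≤ 2 * Λ) (hε : 0 < ε)
    (h : ε ≤ 1 / (1000 * Λ) * (α / (q ^ 2 * s))) (hz : z ≤ s * (q * p)) :
    ε ≤ 1 / 500 ∧ ε * z ≤ p / (100 * q) ∧ Λ * (q * p * (ε * z)) ≤ α * p ^ 2 / 1000 := by
  have hq0 : 0 < q := by linarith
  have hs0 : 0 < s := by linarith
  have hΛ0 : 0 < Λ := by linarith
  have h1 : ε * (1000 * Λ * (q ^ 2 * s)) ≤ α := by
    rw [one_div_mul_eq_div, div_div, le_div_iff₀ (by positivity)] at h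
    linarith
  have h2 : ε * (500 * (q ^ 2 * s)) ≤ 1 := by
    have : Λ * (ε * (500 * (q ^ 2 * s))) ≤ Λ * 1 := by linarith
    exact le_of_mul_le_mul_left this hΛ0
  have hqs : 1 ≤ q ^ 2 * s := one_le_mul_of_one_le_of_one_le (one_le_pow₀ hq) hs
  have h3 : ε * z ≤ ε * (s * (q * p)) := mul_le_mul_of_nonneg_left hz hε.le
  refine ⟨?_, ?_, ?_⟩
  · have := mul_le_mul_of_nonneg_left hqs hε.le
    linarith
  · rw [le_div_iff₀ (by positivity)]
    have h4 := mul_le_mul_of_nonneg_right h3 (show 0 ≤ 100 * q by positivity)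
    have h5 := mul_le_mul_of_nonneg_right h2 hp.le
    have h6 : 0 ≤ ε * (q ^ 2 * s) * p := by positivity
    linarith
  · have h4 := mul_le_mul_of_nonneg_left h3 (show 0 ≤ Λ * (q * p) by positivity)
    have h5 := mul_le_mul_of_nonneg_right h1 (show 0 ≤ p ^ 2 by positivity)
    linarith

/-! ### Regularity from the mean gradient and the noise -/

theorem norm_gram_sub_le (Z Zs : Mat n r) :
    ‖Z * Z.transpose - Zs * Zs.transpose‖ ≤ (opNorm Z + opNorm Zs) * ‖Z - Zs‖ := by
  have h : Z * Z.transpose - Zs * Zs.transpose =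
      Z * (Z - Zs).transpose + (Z - Zs) * Zs.transpose := by
    rw [Matrix.transpose_sub, Matrix.mul_sub, Matrix.sub_mul]; abel
  rw [h]
  refine (norm_add_le _ _).trans ?_
  have h1 := norm_mul_le_opNorm Z (Z - Zs).transpose
  have h2 := norm_mul_le_opNorm' (Z - Zs) Zs.transpose
  rw [norm_transpose] at h1
  rw [opNorm_transpose] at h2
  linarith

/-- The score is noise plus mean, and the mean vanishes at Z*. In units of α p², the noise
contributes 1/1000 and the Lipschitz bound over the radius 3/1000, within the required 1/100. -/
theorem SliceRegular.of_noise_le {ℓ : Mat n n → ℝ} {Zs : Mat n r} {K : Set (Mat n r)}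
    {G : Mat n r → Mat n n} {α β p q ε N L₂ : ℝ} (hc : Conditioned Zs p q) (hα : 0 < α)
    (hαβ : α ≤ β) (hsm : ContDiff ℝ 2 ℓ) (hconv : Convex ℝ K) (hbase : Zs ∈ K)
    (hal : ∀ Z ∈ K, IsAlignment Z Zs 1 ∧ ‖Z - Zs‖ ≤ ε * ‖Zs‖)
    (hrad : ε * ‖Zs‖ ≤ p / (100 * q)) (hLrad : |L₂| * (q * p * (ε * ‖Zs‖)) ≤ α * p ^ 2 / 1000)
    (hrip : LocalRIP ℓ K α β) (hlip : GradLip G K L₂) (hG : G Zs = 0)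
    (hnoise : ∀ Z ∈ K, opNorm (score ℓ Z - G Z) ≤ N) (hN : N ≤ α * p ^ 2 / 1000) :
    SliceRegular ℓ Zs K α β p q where
  cond := hc
  alpha_pos := hα
  alpha_le := hαβ
  smooth := hsm
  convex := hconv
  base := hbase
  aligned Z hZ := (hal Z hZ).1
  near Z hZ := (hal Z hZ).2.trans hrad
  rip := hrip
  score_le Z hZ := by
    have hd := (hal Z hZ).2
    have h1 := hlip Z hZ Zs hbase
    rw [hG, sub_zero] at h1
    have h2 : opNorm (score ℓ Z) ≤ opNorm (score ℓ Z - G Z) + opNorm (G Z) := by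
      simpa using opNorm_add_le (score ℓ Z - G Z) (G Z)
    have h3 := norm_gram_sub_le Z Zs
    have h4 := hc.opNorm_le (hd.trans hrad)
    have h5 := hc.upper
    have hqp : 0 ≤ q * p := mul_nonneg hc.q_pos.le hc.p_pos.le
    have h6 : (opNorm Z + opNorm Zs) * ‖Z - Zs‖ ≤ 3 * (q * p) * (ε * ‖Zs‖) :=
      mul_le_mul (by linarith) hd (norm_nonneg _) (by linarith)
    have h7 : L₂ * ‖Z * Z.transpose - Zs * Zs.transpose‖ ≤ |L₂| * (3 * (q * p) * (ε * ‖Zs‖)) :=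
      (mul_le_mul_of_nonneg_right (le_abs_self _) (norm_nonneg _)).trans
        (mul_le_mul_of_nonneg_left (h3.trans h6) (abs_nonneg _))
    have h8 := hnoise Z hZ
    have h9 : 0 ≤ α * p ^ 2 := by positivity
    linarith

theorem LocalRIP.mono {ℓ : Mat n n → ℝ} {D K : Set (Mat n r)} {α β : ℝ}
    (h : LocalRIP ℓ D α β) (hK : K ⊆ D) : LocalRIP ℓ K α β :=
  fun Z hZ => h Z (hK hZ)

theorem GradLip.mono {G : Mat n r → Mat n n} {D K : Set (Mat n r)} {L₂ : ℝ}
    (h : GradLip G D L₂) (hK : K ⊆ D) : GradLip G K L₂ :=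
  fun Z₁ h₁ Z₂ h₂ => h Z₁ (hK h₁) Z₂ (hK h₂)

/-! ### The normalized constants of the theorem -/

/-- The constants of the problem, in terms of `p = √σ_r(X*)` and `q = √κ`. -/
structure Scaling (Zs : Mat n r) (p q : ℝ) : Prop where
  cond : Conditioned Zs p q
  n_pos : (0 : ℝ) < n
  sigmaMin_eq : sigmaMin Zs = p ^ 2 / n
  kappa_eq : kappa Zs = q ^ 2

theorem exists_scaling {Zs : Mat n r} (hr : 1 ≤ r) (hrank : (Zs * Zs.transpose).rank = r) :
    ∃ p q, Scaling Zs p q := by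
  have hc := conditioned_of_rank hr hrank
  refine ⟨_, _, hc, ?_, ?_, ?_⟩
  · rw [Nat.cast_pos]
    refine Nat.pos_of_ne_zero fun h => ?_
    subst h
    have h0 := hc.norm_pos hr
    rw [Subsingleton.elim Zs 0, norm_zero] at h0
    exact h0.false
  · rw [Real.sq_sqrt (sigma_rank_pos hr hrank).le, sigmaMin]
  · rw [Real.sq_sqrt (zero_le_one.trans (one_le_kappa hr hrank))]

section Scaling

variable {Zs : Mat n r} {p q α β : ℝ}

theorem Scaling.div_sigmaMin (h : Scaling Zs p q) (α Δ : ℝ) :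
    Δ / (α * sigmaMin Zs) = n * Δ / (α * p ^ 2) := by
  have := h.n_pos
  rw [h.sigmaMin_eq, mul_div_assoc', div_div_eq_mul_div, mul_comm Δ]

theorem Scaling.inv_mul_stepSize (h : Scaling Zs p q) (α β : ℝ) :
    (n : ℝ)⁻¹ * stepSize α β Zs = (10 * (α + β) * q ^ 2 * p ^ 2)⁻¹ := by
  have := h.n_pos.ne'
  rw [stepSize, h.sigmaMin_eq, h.kappa_eq, ← mul_inv]
  congr 1
  field_simp

theorem Scaling.rate_eq (h : Scaling Zs p q) (α β : ℝ) :
    rate α β Zs = 1 - (n : ℝ)⁻¹ * stepSize α β Zs * α * p ^ 2 / 4 := by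
  rw [rate, h.sigmaMin_eq]
  ring

theorem Scaling.denom_pos (h : Scaling Zs p q) (hα : 0 < α) (hαβ : α ≤ β) :
    0 < 10 * (α + β) * q ^ 2 * p ^ 2 := by
  have := h.cond.p_pos
  have := h.cond.q_pos
  have : 0 < α + β := by linarith
  positivity

theorem Scaling.step_pos (h : Scaling Zs p q) (hα : 0 < α) (hαβ : α ≤ β) :
    0 < (n : ℝ)⁻¹ * stepSize α β Zs := by
  rw [h.inv_mul_stepSize]
  exact inv_pos.2 (h.denom_pos hα hαβ)

theorem Scaling.stepLength (h : Scaling Zs p q) (hα : 0 < α) (hαβ : α ≤ β) :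
    StepLength α β p q ((n : ℝ)⁻¹ * stepSize α β Zs) where
  nonneg := (h.step_pos hα hαβ).le
  le := by
    rw [h.inv_mul_stepSize, inv_mul_cancel₀ (h.denom_pos hα hαβ).ne']

theorem Scaling.norm_le (h : Scaling Zs p q) : ‖Zs‖ ≤ Real.sqrt r * (q * p) :=
  (norm_le_sqrt_mul_opNorm Zs).trans
    (mul_le_mul_of_nonneg_left h.cond.upper (Real.sqrt_nonneg _))

theorem Scaling.opNorm_pos (h : Scaling Zs p q) (hr : 1 ≤ r) : 0 < opNorm Zs := by
  have h1 := h.cond.norm_pos hr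
  have h2 := norm_le_sqrt_mul_opNorm Zs
  by_contra! h3
  nlinarith [Real.sqrt_nonneg r]

end Scaling

theorem one_le_sqrt_natCast (hr : 1 ≤ r) : 1 ≤ Real.sqrt r :=
  Real.one_le_sqrt.2 (by exact_mod_cast hr)

/-! ### Convergence on the two regions -/

theorem frobenius_convergence_of_noise {ℓ : Mat n n → ℝ} {G : Mat n r → Mat n n} {Zs Z₀ : Mat n r}
    {p q α β ε φ Δ L₂ Λ : ℝ} (hr : 1 ≤ r) (hS : Scaling Zs p q) (hα : 0 < α) (hαβ : α ≤ β)
    (hε : 0 < ε) (hΛ : 1 ≤ Λ) (hL₂ : |L₂| ≤ Λ) (hαΛ : α ≤ 2 * Λ)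
    (hεΛ : ε ≤ 1 / (1000 * Λ) * (α / (kappa Zs * Real.sqrt r)))
    (hsm : ContDiff ℝ 2 ℓ) (hrip : LocalRIP ℓ (region2 Zs ε) α β)
    (hlip : GradLip G (region2 Zs ε) L₂) (hG : G Zs = 0)
    (hnoise : ∀ Z ∈ region2 Zs ε, opNorm (score ℓ Z - G Z) / n ≤ Δ)
    (hΔ : Δ / (α * sigmaMin Zs) ≤ 1 / (1000 * Λ) * ε) (hφ : φ ≤ ε / 2)
    (hZ₀ : dist2 Z₀ Zs ≤ φ * ‖Zs‖) :
    (∀ t : ℕ, dist2 (iterate ℓ (stepSize α β Zs) Z₀ t) Zs ≤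
      (rate α β Zs ^ t * φ + 8 * (Δ / (α * sigmaMin Zs))) * ‖Zs‖) ∧
    ∃ Zt : Mat n r,
      IsAlignedMinimizer ℓ (region2 Zs ε) Zs Zt ∧
      StationaryMinimizers ℓ (region2 Zs ε) Zt ∧
      ‖Zt - Zs‖ ≤ 8 * (Δ / (α * sigmaMin Zs)) * ‖Zs‖ := by
  have hc := hS.cond
  have hp := hc.p_pos
  have hαp : 0 < α * p ^ 2 := by positivity
  rw [hS.kappa_eq] at hεΛ
  obtain ⟨hε1, hrad, hLrad⟩ := radius_bounds hp hc.one_le_q (one_le_sqrt_natCast hr) hΛ hαΛ hε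
    hεΛ hS.norm_le
  have hsub : slice2 Zs ε ⊆ region2 Zs ε := fun Y hY =>
    ((isSlice_slice2 (hc.norm_pos hr) ε).mem_iff hY.1).2 (by rwa [Matrix.mul_one])
  have hΛ0 : 0 < Λ := by linarith
  have hc1 : 1 / (1000 * Λ) ≤ 1 / 1000 := one_div_le_one_div_of_le (by norm_num) (by linarith)
  have hnε : n * Δ / (α * p ^ 2) ≤ ε / 1000 := by
    rw [← hS.div_sigmaMin]
    refine hΔ.trans ((mul_le_mul_of_nonneg_right hc1 hε.le).trans_eq (by ring))
  have hn : ∀ Z ∈ region2 Zs ε, opNorm (score ℓ Z - G Z) ≤ n * Δ := fun Z hZ => by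
    have := (div_le_iff₀ hS.n_pos).1 (hnoise Z hZ)
    linarith
  have hbase := self_mem_slice2 Zs hε.le
  have h : SliceRegular ℓ Zs (slice2 Zs ε) α β p q :=
    .of_noise_le hc hα hαβ hsm (convex_slice2 Zs ε) hbase (fun Z hZ => hZ) hrad
      ((mul_le_mul_of_nonneg_right hL₂ (by have := hc.q_pos; positivity)).trans hLrad)
      (hrip.mono hsub) (hlip.mono hsub) hG (fun Z hZ => hn Z (hsub hZ)) (by
        rw [div_le_iff₀ hαp] at hnε
        have := mul_le_mul_of_nonneg_right hε1 hαp.le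
        linarith)
  have hN := hn Zs (hsub hbase)
  rw [hG, sub_zero] at hN
  have h1 := h.frobenius_convergence hr (hS.stepLength hα hαβ) (hS.step_pos hα hαβ) hN
    (by linarith) hφ hZ₀
  rw [← hS.rate_eq, ← hS.div_sigmaMin] at h1
  exact h1

theorem row_wise_convergence_of_noise {ℓ : Mat n n → ℝ} {G : Mat n r → Mat n n} {Zs Z₀ : Mat n r}
    {p q α β ε φ ψ Δ Δinf Δbar L₂ Linf Λ : ℝ} (hr : 1 ≤ r) (hS : Scaling Zs p q) (hα : 0 < α)
    (hαβ : α ≤ β) (hε : 0 < ε) (hΛ : 1 ≤ Λ) (hL₂ : |L₂| ≤ Λ) (hLinf : |Linf| ≤ Λ)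
    (hαΛ : α ≤ 2 * Λ) (hεΛ : ε ≤ 1 / (1000 * Λ) * (α / (kappa Zs * Real.sqrt r)))
    (hsm : ContDiff ℝ 2 ℓ) (hsymm : ∀ Z ∈ regionInf Zs ε, (score ℓ Z).IsSymm)
    (hrip : LocalRIP ℓ (regionInf Zs ε) α β) (hlip : GradLip G (regionInf Zs ε) L₂)
    (hcross : RowCrossCurvature ℓ (regionInf Zs ε) β)
    (hrlip : RowGradLip G (regionInf Zs ε) Linf) (hG : G Zs = 0)
    (hnoise : ∀ Z ∈ regionInf Zs ε, opNorm (score ℓ Z - G Z) / n ≤ Δ)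
    (hnoiseInf : rowNorm ((score ℓ Zs - G Zs) * Zs) / (Real.sqrt n * opNorm Zs) ≤ Δinf)
    (hnoiseBar : ∀ Z ∈ regionInf Zs ε, maxRowSum (score ℓ Z - G Z) / n ≤ Δbar)
    (hΔinf : (β / α + Real.sqrt r) * kappa Zs * Real.sqrt r * (Δinf / (α * sigmaMin Zs)) ≤
      1 / (1000 * Λ) * ε)
    (hΔ : (β / α * kappa Zs * Real.sqrt (kappa Zs * r) + r * kappa Zs) * Δ ≤
      1 / (1000 * Λ) * Δinf)
    (hΔbar : Δbar / (α * sigmaMin Zs) ≤ 1 / 4)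
    (hφ : φ ≤ ε / 2) (hψ : ψ ≤ ε / 2)
    (hφψ : β / α * kappa Zs ^ (3 / 2 : ℝ) * Real.sqrt r * φ ≤ 1 / (1000 * Λ) * ψ)
    (hZ₀ : dist2 Z₀ Zs ≤ φ * ‖Zs‖) (hZ₀' : distInf Z₀ Zs ≤ ψ * rowNorm Zs) :
    (∀ t : ℕ,
      dist2 (iterate ℓ (stepSize α β Zs) Z₀ t) Zs ≤
        (rate α β Zs ^ t * φ + 8 * (Δ / (α * sigmaMin Zs))) * ‖Zs‖ ∧
      distInf (iterate ℓ (stepSize α β Zs) Z₀ t) Zs ≤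
        (rate α β Zs ^ t * ψ + 8 * (Δinf / (α * sigmaMin Zs))) * rowNorm Zs) ∧
    ∃ Zt : Mat n r,
      IsAlignedMinimizer ℓ (regionInf Zs ε) Zs Zt ∧
      StationaryMinimizers ℓ (regionInf Zs ε) Zt ∧
      ‖Zt - Zs‖ ≤ 8 * (Δ / (α * sigmaMin Zs)) * ‖Zs‖ ∧
      rowNorm (Zt - Zs) ≤ 8 * (Δinf / (α * sigmaMin Zs)) * rowNorm Zs := by
  have hc := hS.cond
  have hp := hc.p_pos
  have hq := hc.one_le_q
  have hq0 := hc.q_pos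
  have hn0 := hS.n_pos
  have hs := one_le_sqrt_natCast hr
  have hop := hS.opNorm_pos hr
  have hαp : 0 < α * p ^ 2 := by positivity
  have ha : 1 ≤ β / α := (one_le_div hα).2 hαβ
  rw [hS.kappa_eq] at hεΛ hΔinf hΔ
  obtain ⟨hε1, hrad, hLrad⟩ := radius_bounds hp hq hs hΛ hαΛ hε hεΛ hS.norm_le
  have hsub : sliceInf Zs ε ⊆ regionInf Zs ε := fun Y hY =>
    ((isSlice_sliceInf hc hr hε.le hrad).mem_iff hY.1.1).2 (by rwa [Matrix.mul_one])
  have hbase := self_mem_sliceInf Zs hε.le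
  have hΛ0 : 0 < Λ := by linarith
  have hcpos : 0 < 1 / (1000 * Λ) := by positivity
  have hc1 : 1 / (1000 * Λ) ≤ 1 / 1000 := one_div_le_one_div_of_le (by norm_num) (by linarith)
  have hn : ∀ Z ∈ regionInf Zs ε, opNorm (score ℓ Z - G Z) ≤ n * Δ := fun Z hZ => by
    have := (div_le_iff₀ hn0).1 (hnoise Z hZ)
    linarith
  have hΔ0 : 0 ≤ Δ := (div_nonneg (opNorm_nonneg _) hn0.le).trans (hnoise Zs (hsub hbase))
  have hΔinf0 : 0 ≤ Δinf := (div_nonneg (rowNorm_nonneg _) (by positivity)).trans hnoiseInf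
  have hφ0 : 0 ≤ φ := nonneg_of_mul_nonneg_left ((dist2_nonneg _ _).trans hZ₀) (hc.norm_pos hr)
  have hψ0 : 0 ≤ ψ :=
    nonneg_of_mul_nonneg_left ((distInf_nonneg _ _).trans hZ₀') (hc.rowNorm_pos hr)
  rw [hS.div_sigmaMin] at hΔinf hΔbar
  rw [hS.div_sigmaMin, hS.div_sigmaMin]
  have hM0 : 0 ≤ n * Δinf / (α * p ^ 2) := by positivity
  have hN0 : 0 ≤ n * Δ / (α * p ^ 2) := by positivity
  have haqs : 1 ≤ β / α * q ^ 2 * Real.sqrt r :=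
    one_le_mul_of_one_le_of_one_le (one_le_mul_of_one_le_of_one_le ha (one_le_pow₀ hq)) hs
  have hM : n * Δinf / (α * p ^ 2) ≤ ε / 1000 := by
    have e1 : β / α * q ^ 2 * Real.sqrt r ≤ (β / α + Real.sqrt r) * q ^ 2 * Real.sqrt r := by
      have : 0 ≤ Real.sqrt r * q ^ 2 * Real.sqrt r := by positivity
      linarith
    have e2 := mul_le_mul_of_nonneg_right (haqs.trans e1) hM0
    have e3 := mul_le_mul_of_nonneg_right hc1 hε.le
    linarith
  have hNM : 1000 * (β / α * q ^ 2 * Real.sqrt r) * (n * Δ / (α * p ^ 2)) ≤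
      n * Δinf / (α * p ^ 2) := by
    have e1 : Real.sqrt r ≤ Real.sqrt (q ^ 2 * r) :=
      Real.sqrt_le_sqrt (le_mul_of_one_le_left (Nat.cast_nonneg r) (one_le_pow₀ hq))
    have e2 : β / α * q ^ 2 * Real.sqrt r ≤
        β / α * q ^ 2 * Real.sqrt (q ^ 2 * r) + r * q ^ 2 := by
      have := mul_le_mul_of_nonneg_left e1 (show 0 ≤ β / α * q ^ 2 by positivity)
      have : 0 ≤ (r : ℝ) * q ^ 2 := by positivity
      linarith
    have e3 := mul_le_mul_of_nonneg_right e2 hΔ0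
    have e4 := mul_le_mul_of_nonneg_right hc1 hΔinf0
    rw [mul_div_assoc', div_le_div_iff_of_pos_right hαp]
    have e5 : 1000 * (β / α * q ^ 2 * Real.sqrt r * Δ) ≤ Δinf := by linarith
    have e6 := mul_le_mul_of_nonneg_left e5 hn0.le
    linarith
  have hN : n * Δ / (α * p ^ 2) ≤ ε / 1000 := by
    have := mul_le_mul_of_nonneg_right haqs hN0
    linarith
  have hφψ' : 30 * (β / α * q ^ 2 * Real.sqrt r) * φ ≤ ψ := by
    have e1 : q ^ 2 ≤ kappa Zs ^ (3 / 2 : ℝ) := by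
      rw [hS.kappa_eq]
      exact Real.self_le_rpow_of_one_le (one_le_pow₀ hq) (by norm_num)
    have e2 : β / α * q ^ 2 * Real.sqrt r * φ ≤
        β / α * kappa Zs ^ (3 / 2 : ℝ) * Real.sqrt r * φ := by gcongr
    have e3 := mul_le_mul_of_nonneg_right hc1 hψ0
    linarith
  have hsmall : n * Δ ≤ α * p ^ 2 / 1000 := by
    rw [div_le_iff₀ hαp] at hN
    have := mul_le_mul_of_nonneg_right hε1 hαp.le
    linarith
  have hεZ : 0 ≤ q * p * (ε * ‖Zs‖) := by positivity
  -- The noise level Δ_∞ is normalized by √n ‖Z*‖ in operator norm; bounding that norm by √n times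
  -- the row norm gives the factor n.
  have hscore : rowNorm (score ℓ Zs * Zs) ≤ n * Δinf * rowNorm Zs := by
    rw [hG, sub_zero, div_le_iff₀ (by positivity)] at hnoiseInf
    refine hnoiseInf.trans ?_
    have e1 : opNorm Zs ≤ Real.sqrt n * rowNorm Zs :=
      (opNorm_le_norm Zs).trans (norm_le_sqrt_mul_rowNorm Zs)
    calc Δinf * (Real.sqrt n * opNorm Zs)
        ≤ Δinf * (Real.sqrt n * (Real.sqrt n * rowNorm Zs)) := by gcongr
      _ = (Real.sqrt n * Real.sqrt n) * Δinf * rowNorm Zs := by ring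
      _ = n * Δinf * rowNorm Zs := by rw [Real.mul_self_sqrt hn0.le]
  have h : RowRegular ℓ Zs (sliceInf Zs ε) α β p q G |Linf| :=
    { toSliceRegular := .of_noise_le hc hα hαβ hsm (convex_sliceInf Zs ε) hbase
        (fun Z hZ => hZ.1) hrad ((mul_le_mul_of_nonneg_right hL₂ hεZ).trans hLrad)
        (hrip.mono hsub) (hlip.mono hsub) hG (fun Z hZ => hn Z (hsub hZ)) hsmall
      symm := fun Z hZ => hsymm Z (hsub hZ)
      cross := fun Z hZ => hcross Z (hsub hZ)
      row_near := fun Z hZ => hZ.2.trans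
        (mul_le_of_le_one_left (rowNorm_nonneg _) (by linarith))
      lip_nonneg := abs_nonneg _
      mean_le := fun Z hZ => by
        have e1 := hrlip Z (hsub hZ) Zs (hsub hbase)
        rw [hG, sub_zero] at e1
        exact e1.trans (mul_le_mul_of_nonneg_right (le_abs_self _) (rowNorm_nonneg _))
      noise_le := fun Z hZ => by
        have e1 := (div_le_iff₀ hn0).1 (hnoiseBar Z (hsub hZ))
        rw [div_le_iff₀ hαp] at hΔbar
        linarith
      lip_near := fun Z hZ => by
        have e1 : |Linf| * (q * p * ‖Z - Zs‖) ≤ Λ * (q * p * (ε * ‖Zs‖)) := by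
          have := hZ.1.2
          gcongr
        linarith }
  have hNs := hn Zs (hsub hbase)
  rw [hG, sub_zero] at hNs
  have h1 := h.rowWise_convergence hr (hS.stepLength hα hαβ) (hS.step_pos hα hαβ) hNs hscore hε.le
    hrad (Real.sqrt_nonneg r) hS.norm_le (by linarith) (by linarith)
    (by
      have : 0 ≤ β / α * q ^ 2 * Real.sqrt r * (n * Δ / (α * p ^ 2)) := by positivity
      linarith)
    hφ hψ hφψ' hZ₀ hZ₀'
  rw [← hS.rate_eq] at h1
  exact h1

end LowRankGD

/-! ### Choice of constants and conclusion. -/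

open LowRankGD in
theorem theorem4 :
    ∃ C : ℝ, 0 < C ∧
      -- the `ℓ₂` part
      (∀ L₂ : ℝ, ∃ c₀ : ℝ, 0 < c₀ ∧
        ∀ (n r : ℕ) (Ω : Type*) [MeasurableSpace Ω] (μ : Measure Ω) [IsProbabilityMeasure μ]
          (L : Ω → Mat n n → ℝ) (Zs : Mat n r) (Z₀ : Ω → Mat n r)
          (α β ε δ φ Δ₂ : ℝ),
          1 ≤ r → (Zs * Zs.transpose).rank = r →
          0 < α → α ≤ β → 0 < δ → δ < 1 →
          0 < ε → ε ≤ c₀ * (α / (kappa Zs * Real.sqrt r)) →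
          StochasticLoss μ L Zs (region2 Zs ε) →
          (∀ᵐ ω ∂μ, LocalRIP (L ω) (region2 Zs ε) α β) →
          GradLip (meanScore μ L) (region2 Zs ε) L₂ →
          WithProbAtLeast μ (1 - δ) (fun ω =>
            ∀ Z ∈ region2 Zs ε, opNorm (noise μ L ω Z) / n ≤ Δ₂) →
          Δ₂ / (α * sigmaMin Zs) ≤ c₀ * ε →
          (∀ᵐ ω ∂μ, dist2 (Z₀ ω) Zs ≤ φ * ‖Zs‖) →
          φ ≤ ε / 2 → φ ≤ c₀ * (α / (kappa Zs * Real.sqrt r)) →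
          WithProbAtLeast μ (1 - δ) (fun ω =>
            (∀ t : ℕ, dist2 (iterate (L ω) (stepSize α β Zs) (Z₀ ω) t) Zs ≤
              (rate α β Zs ^ t * φ + C * (Δ₂ / (α * sigmaMin Zs))) * ‖Zs‖) ∧
            ∃ Zt : Mat n r,
              IsAlignedMinimizer (L ω) (region2 Zs ε) Zs Zt ∧
              StationaryMinimizers (L ω) (region2 Zs ε) Zt ∧
              ‖Zt - Zs‖ ≤ C * (Δ₂ / (α * sigmaMin Zs)) * ‖Zs‖)) ∧
      -- the `ℓ_∞` part
      (∀ L₂ Linf : ℝ, ∃ c₀ : ℝ, 0 < c₀ ∧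
        ∀ (n r : ℕ) (Ω : Type*) [MeasurableSpace Ω] (μ : Measure Ω) [IsProbabilityMeasure μ]
          (L : Ω → Mat n n → ℝ) (Zs : Mat n r) (Z₀ : Ω → Mat n r)
          (α β ε δ φ ψ Δ₂ Δinf Δbar : ℝ),
          1 ≤ r → (Zs * Zs.transpose).rank = r →
          0 < α → α ≤ β → 0 < δ → δ < 1 →
          0 < ε → ε ≤ c₀ * (α / (kappa Zs * Real.sqrt r)) →
          StochasticLoss μ L Zs (regionInf Zs ε) →
          (∀ᵐ ω ∂μ, ∀ Z ∈ regionInf Zs ε, (score (L ω) Z).IsSymm) →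
          (∀ᵐ ω ∂μ, LocalRIP (L ω) (regionInf Zs ε) α β) →
          GradLip (meanScore μ L) (regionInf Zs ε) L₂ →
          (∀ᵐ ω ∂μ, RowCrossCurvature (L ω) (regionInf Zs ε) β) →
          RowGradLip (meanScore μ L) (regionInf Zs ε) Linf →
          WithProbAtLeast μ (1 - δ) (fun ω =>
            (∀ Z ∈ regionInf Zs ε, opNorm (noise μ L ω Z) / n ≤ Δ₂) ∧
            rowNorm (noise μ L ω Zs * Zs) / (Real.sqrt n * opNorm Zs) ≤ Δinf ∧
            (∀ Z ∈ regionInf Zs ε, maxRowSum (noise μ L ω Z) / n ≤ Δbar)) →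
          (β / α + Real.sqrt r) * kappa Zs * Real.sqrt r * (Δinf / (α * sigmaMin Zs)) ≤ c₀ * ε →
          (β / α * kappa Zs * Real.sqrt (kappa Zs * r) + r * kappa Zs) * Δ₂ ≤ c₀ * Δinf →
          Δbar / (α * sigmaMin Zs) ≤ 1 / 4 →
          (∀ᵐ ω ∂μ, dist2 (Z₀ ω) Zs ≤ φ * ‖Zs‖) →
          φ ≤ ε / 2 → φ ≤ c₀ * (α / (kappa Zs * Real.sqrt r)) →
          (∀ᵐ ω ∂μ, distInf (Z₀ ω) Zs ≤ ψ * rowNorm Zs) →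
          ψ ≤ ε / 2 → β / α * kappa Zs ^ (3 / 2 : ℝ) * Real.sqrt r * φ ≤ c₀ * ψ →
          WithProbAtLeast μ (1 - δ) (fun ω =>
            (∀ t : ℕ,
              dist2 (iterate (L ω) (stepSize α β Zs) (Z₀ ω) t) Zs ≤
                (rate α β Zs ^ t * φ + C * (Δ₂ / (α * sigmaMin Zs))) * ‖Zs‖ ∧
              distInf (iterate (L ω) (stepSize α β Zs) (Z₀ ω) t) Zs ≤
                (rate α β Zs ^ t * ψ + C * (Δinf / (α * sigmaMin Zs))) * rowNorm Zs) ∧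
            ∃ Zt : Mat n r,
              IsAlignedMinimizer (L ω) (regionInf Zs ε) Zs Zt ∧
              StationaryMinimizers (L ω) (regionInf Zs ε) Zt ∧
              ‖Zt - Zs‖ ≤ C * (Δ₂ / (α * sigmaMin Zs)) * ‖Zs‖ ∧
              rowNorm (Zt - Zs) ≤ C * (Δinf / (α * sigmaMin Zs)) * rowNorm Zs)) := by
  -- With Λ = 1 + |L₂|, plus |Linf| in the second part, c₀ = 1/(1000 Λ). The summand 1 gives Λ ≥ 1,
  -- and Λ ≥ L₂ gives α ≤ 2 Λ.
  refine ⟨8, by norm_num, fun L₂ => ⟨1 / (1000 * (1 + |L₂|)), by positivity, ?_⟩,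
    fun L₂ Linf => ⟨1 / (1000 * (1 + |L₂| + |Linf|)), by positivity, ?_⟩⟩
  · intro n r Ω _ μ _ L Zs Z₀ α β ε δ φ Δ₂ hr hrank hα hαβ _ _ hε hεΛ hL hrip hlip hnoise hΔ
      hZ₀ hφ _
    obtain ⟨p, q, hS⟩ := exists_scaling hr hrank
    have hα₂ := alpha_le_two_mul hr hS.cond hα hL hrip hlip
      (exists_segment_region2 hε (hS.cond.norm_pos hr) (hS.cond.rowNorm_pos hr))
    have hle := le_abs_self L₂
    refine hnoise.mono_ae (hL.smooth.and (hrip.and hZ₀)) ?_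
    rintro ω hN ⟨hsm, hrip', hZ⟩
    exact frobenius_convergence_of_noise hr hS hα hαβ hε (by linarith [abs_nonneg L₂])
      (by linarith) (by linarith) hεΛ hsm hrip' hlip hL.mean_zero hN hΔ hφ hZ
  · intro n r Ω _ μ _ L Zs Z₀ α β ε δ φ ψ Δ₂ Δinf Δbar hr hrank hα hαβ _ _ hε hεΛ hL hsymm hrip
      hlip hcross hrlip hnoise hΔinf hΔ hΔbar hZ₀ hφ _ hZ₀' hψ hφψ
    obtain ⟨p, q, hS⟩ := exists_scaling hr hrank
    have hα₂ := alpha_le_two_mul hr hS.cond hα hL hrip hlip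
      (exists_segment_regionInf hε (hS.cond.norm_pos hr) (hS.cond.rowNorm_pos hr))
    have hle := le_abs_self L₂
    have h₂ := abs_nonneg L₂
    have hinf := abs_nonneg Linf
    refine hnoise.mono_ae (hL.smooth.and (hrip.and (hsymm.and (hcross.and (hZ₀.and hZ₀'))))) ?_
    rintro ω ⟨hN, hNinf, hNbar⟩ ⟨hsm, hrip', hsy, hcr, hZ, hZ'⟩
    exact row_wise_convergence_of_noise hr hS hα hαβ hε (by linarith) (by linarith) (by linarith)
      (by linarith) hεΛ hsm hsy hrip' hlip hcr hrlip hL.mean_zero hN hNinf hNbar hΔinf hΔ hΔbar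
      hφ hψ hφψ hZ hZ'
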